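/- Let $d\ge 1$ and let $\Omega\subset\mathbb{R}^d$ be a uniformly $C^2$ domain, possibly unbounded: $\Omega$ is open and connected, and there are $a,b,K>0$ such that for every $x_0\in\partial\Omega$, after a translation and a rotation taking $x_0$ to the origin, there is a $C^2$ function $h$ on $\{y\in\mathbb{R}^{d-1}:|y|<a\}$ with $h(0)=0$, $\nabla h(0)=0$ and derivatives up to order two bounded by $K$, such that inside $\{(y,s):|y|<a,\ |s-h(y)|<b\}$ the sets $\Omega$ and $\partial\Omega$ are $\{s>h(y)\}$ and $\{s=h(y)\}$ respectively. For $u\in L^1(\Omega)$ let $\int_\Omega|\nabla u|=\sup\{-\int_\Omega u\,\mathrm{div}\,\varphi\,dx:\varphi\in C^1_c(\Omega;\mathbb{R}^d),\ |\varphi|\le 1\}\in[0,\infty]$, and write $u\in BV(\Omega)$ if this is finite. Every $u\in BV(\Omega)$ has a trace $\gamma u\in L^1(\partial\Omega,\mathcal{H}^{d-1})$, i.e. a function, unique up to $\mathcal{H}^{d-1}$-null sets, such that $\int_\Omega u\,\mathrm{div}\,\varphi\,dx=-\int_\Omega\varphi\cdot dDu+\int_{\partial\Omega}\gamma u\,(\varphi\cdot\nu)\,d\mathcal{H}^{d-1}$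 for all $\varphi\in C^1_c(\mathbb{R}^d;\mathbb{R}^d)$, where $Du$ is the gradient measure of $u$ in $\Omega$ and $\nu$ is the outer unit normal. For $\beta\in L^\infty(\partial\Omega)$ let $$C_\beta(u)=\int_\Omega|\nabla u|+\int_{\partial\Omega}\beta\,\gamma u\,d\mathcal{H}^{d-1}\quad(u\in BV(\Omega)),\qquad C_\beta(u)=+\infty\quad(u\notin BV(\Omega)).$$ If $\|\beta\|_\infty\le 1$, then $C_\beta$ is lower semicontinuous with respect to the topology of $L^1(\Omega)$ at every $u\in BV(\Omega)$: $C_\beta(u)\le\liminf_i C_\beta(u_i)$ whenever $u\in BV(\Omega)$ and $u_i\to u$ in $L^1(\Omega)$. If $\|\beta\|_\infty<1$, then $C_\beta$ is lower semicontinuous on all of $L^1(\Omega)$. If $\Omega$ has finite measure, the same two assertions hold with $L^1(\Omega)$ replaced by $L^p(\Omega)$ for every $p\in[1,\infty)$ (at every $u\in BV(\Omega)\cap L^p(\Omega)$, respectively on all of $L^p(\Omega)$). -/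

import Mathlib

open MeasureTheory Topology Filter Set
open scoped ENNReal RealInnerProductSpace

noncomputable section

namespace Capillary

/-- A uniformly `C²` domain of `ℝ^d`: a connected open set `Ω` for which there are `a, b, K > 0`
such that, near every boundary point `x₀`, after a translation and a rotation (which sends the last
coordinate direction to the unit vector `e`, and the space of the first `d - 1` coordinates to the
hyperplane orthogonal to `e`), `Ω` and its boundary are
`{h(y) < s}` and `{s = h(y)}` inside `{|y| < a, |s - h(y)| < b}`, where `h` is a `C²` function with
`h(0) = 0`, `∇h(0) = 0`, whose derivatives up to order two are bounded by `K`. -/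
structure IsUniformlyC2Domain {d : ℕ} (Ω : Set (EuclideanSpace ℝ (Fin d))) : Prop where
  isOpen : IsOpen Ω
  isConnected : IsConnected Ω
  exists_chart : ∃ a b K : ℝ, 0 < a ∧ 0 < b ∧ 0 < K ∧ ∀ x₀ ∈ frontier Ω,
    ∃ e : EuclideanSpace ℝ (Fin d), ‖e‖ = 1 ∧
    ∃ h : (ℝ ∙ e)ᗮ → ℝ,
      ContDiffOn ℝ 2 h (Metric.ball 0 a) ∧ h 0 = 0 ∧ fderiv ℝ h 0 = 0 ∧
      (∀ k : ℕ, k ≤ 2 → ∀ y ∈ Metric.ball (0 : (ℝ ∙ e)ᗮ) a, ‖iteratedFDeriv ℝ k h y‖ ≤ K) ∧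
      ∀ (y : (ℝ ∙ e)ᗮ) (s : ℝ), ‖y‖ < a → |s - h y| < b →
        ((x₀ + (y : EuclideanSpace ℝ (Fin d)) + s • e ∈ Ω ↔ h y < s) ∧
          (x₀ + (y : EuclideanSpace ℝ (Fin d)) + s • e ∈ frontier Ω ↔ s = h y))

/-- The divergence `∑ i, ∂ᵢ φᵢ` of a vector field. -/
def divergence {d : ℕ} (φ : EuclideanSpace ℝ (Fin d) → EuclideanSpace ℝ (Fin d))
    (x : EuclideanSpace ℝ (Fin d)) : ℝ :=
  ∑ i : Fin d, (fderiv ℝ φ x (EuclideanSpace.single i 1)) i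

/-- The vector fields of class `C¹` with compact support in `Ω`. -/
def testFields {d : ℕ} (Ω : Set (EuclideanSpace ℝ (Fin d))) :
    Set (EuclideanSpace ℝ (Fin d) → EuclideanSpace ℝ (Fin d)) :=
  {φ | ContDiff ℝ 1 φ ∧ HasCompactSupport φ ∧ tsupport φ ⊆ Ω}

/-- The total variation `∫_Ω |∇u|`, with values in `[0, ∞]`. -/
def totalVariation {d : ℕ} (Ω : Set (EuclideanSpace ℝ (Fin d)))
    (u : EuclideanSpace ℝ (Fin d) → ℝ) : ℝ≥0∞ :=
  ⨆ φ ∈ {φ ∈ testFields Ω | ∀ x, ‖φ x‖ ≤ 1},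
    ENNReal.ofReal (-∫ x in Ω, u x * divergence φ x)

/-- `u ∈ BV(Ω)`. -/
def IsBV {d : ℕ} (Ω : Set (EuclideanSpace ℝ (Fin d))) (u : EuclideanSpace ℝ (Fin d) → ℝ) : Prop :=
  IntegrableOn u Ω ∧ totalVariation Ω u < ⊤

/-- The surface measure of the boundary of `Ω`: the restriction to `∂Ω` of the
`(d-1)`-dimensional Hausdorff measure, in its Euclidean normalization. -/
def surfaceMeasure {d : ℕ} (Ω : Set (EuclideanSpace ℝ (Fin d))) :
    Measure (EuclideanSpace ℝ (Fin d)) :=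
  (Measure.euclideanHausdorffMeasure (d - 1)).restrict (frontier Ω)

/-- `n` is the outer unit normal of `Ω` at `x`: near `x`, the set `Ω` contains every cone around
`-n` and misses every cone around `n`, of opening less than a half-space. -/
def IsOuterNormal {d : ℕ} (Ω : Set (EuclideanSpace ℝ (Fin d)))
    (x n : EuclideanSpace ℝ (Fin d)) : Prop :=
  ‖n‖ = 1 ∧ ∀ ε : ℝ, 0 < ε → ∀ᶠ y in 𝓝 x,
    (ε * ‖y - x‖ < ⟪y - x, n⟫ → y ∉ Ω) ∧ (⟪y - x, n⟫ < -(ε * ‖y - x‖) → y ∈ Ω)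

open Classical in
/-- The outer unit normal field of `Ω` (zero where there is none). -/
def outerNormal {d : ℕ} (Ω : Set (EuclideanSpace ℝ (Fin d))) (x : EuclideanSpace ℝ (Fin d)) :
    EuclideanSpace ℝ (Fin d) :=
  if h : ∃ n, IsOuterNormal Ω x n then h.choose else 0

/-- The distributional gradient of `u` in `Ω` is the vector measure `σ μ`, with `μ` a finite
measure on `Ω` and `|σ| = 1` (so `μ` is the measure `|∇u|`). -/
structure IsGradientMeasure {d : ℕ} (Ω : Set (EuclideanSpace ℝ (Fin d)))
    (u : EuclideanSpace ℝ (Fin d) → ℝ) (μ : Measure (EuclideanSpace ℝ (Fin d)))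
    (σ : EuclideanSpace ℝ (Fin d) → EuclideanSpace ℝ (Fin d)) : Prop where
  isFiniteMeasure : IsFiniteMeasure μ
  measure_compl : μ Ωᶜ = 0
  aestronglyMeasurable : AEStronglyMeasurable σ μ
  norm_eq_one : ∀ᵐ x ∂μ, ‖σ x‖ = 1
  integral_eq : ∀ φ ∈ testFields Ω,
    ∫ x in Ω, u x * divergence φ x = -∫ x, ⟪φ x, σ x⟫ ∂μ

/-- `g` is the trace on `∂Ω` of the function `u` of bounded variation in `Ω`: `g ∈ L¹(∂Ω)` and
`∫_Ω u div φ = - ∫_Ω φ · dDu + ∫_∂Ω g φ · ν dH^{d-1}` for every `φ ∈ C¹_c(ℝ^d; ℝ^d)`. -/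
def IsTrace {d : ℕ} (Ω : Set (EuclideanSpace ℝ (Fin d)))
    (u g : EuclideanSpace ℝ (Fin d) → ℝ) : Prop :=
  Integrable g (surfaceMeasure Ω) ∧
  ∃ (μ : Measure (EuclideanSpace ℝ (Fin d)))
    (σ : EuclideanSpace ℝ (Fin d) → EuclideanSpace ℝ (Fin d)),
    IsGradientMeasure Ω u μ σ ∧
    ∀ φ : EuclideanSpace ℝ (Fin d) → EuclideanSpace ℝ (Fin d),
      ContDiff ℝ 1 φ → HasCompactSupport φ →
      ∫ x in Ω, u x * divergence φ x =
        -∫ x, ⟪φ x, σ x⟫ ∂μ + ∫ x, g x * ⟪φ x, outerNormal Ω x⟫ ∂(surfaceMeasure Ω)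

open Classical in
/-- The trace `γu` on `∂Ω` of a function `u` of bounded variation in `Ω`. -/
def trace {d : ℕ} (Ω : Set (EuclideanSpace ℝ (Fin d)))
    (u : EuclideanSpace ℝ (Fin d) → ℝ) : EuclideanSpace ℝ (Fin d) → ℝ :=
  if h : ∃ g, IsTrace Ω u g then h.choose else 0

open Classical in
/-- The capillary functional `C_β(u) = ∫_Ω |∇u| + ∫_∂Ω β γu dH^{d-1}` for `u ∈ BV(Ω)`,
extended by `+∞` to the functions that are not of bounded variation. -/
def capillary {d : ℕ} (Ω : Set (EuclideanSpace ℝ (Fin d)))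
    (β u : EuclideanSpace ℝ (Fin d) → ℝ) : EReal :=
  if IsBV Ω u then
    (((totalVariation Ω u).toReal + ∫ x, β x * trace Ω u x ∂(surfaceMeasure Ω) : ℝ) : EReal)
  else ⊤

end Capillary

end

/-!
Throughout, `V(w, U)` is the total variation of `w` in the open set `U`, and `Ω_δ` is the part of
`Ω` at distance less than `δ` from the boundary.

The proof rests on the trace inequality (`exists_trace_bound`)
`∫_∂Ω |γw| ≤ D ∫_Ω |w| + V(w, Ω_δ)`, in which `D` depends only on `Ω` and `δ > 0`;
the point is that the total variation enters
with the constant `1` and only near the boundary. Suppose `|β| ≤ 1` and `u ∈ BV(Ω)`. Take a field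
`φ` with compact support in `Ω` that almost attains the variation of `u`, and `δ` so small that
the support of `φ` avoids `Ω_δ`. For `v ∈ BV(Ω)`, the trace inequality for `v - u` shows that the
boundary term drops by at most `V(v, Ω_δ) + V(u, Ω_δ) + D ‖v - u‖₁`. Here `V(u, Ω_δ)` is small,
and the variation of `v` is at least the sum of `V(v, Ω_δ)` and the pairing of `v` with `φ`, which
is close to that of `u`. Hence `C_β(v) ≥ C_β(u) - 2ε - Q ‖v - u‖₁` (`exists_capillary_sub_le`). If
`|β| ≤ b < 1`, the same inequality gives `C_β(v) ≥ (1 - b) V(v, Ω) - Q ‖v‖₁`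
(`exists_mul_totalVariation_le`), and lower semicontinuity of the variation makes `C_β(v)` large
near every function outside `BV(Ω)`. The case of `L^p` follows, since `L^p(Ω)` embeds in `L¹(Ω)`
when `Ω` has finite measure (`lowerSemicontinuousAt_Lp`).

The traces are obtained as limits of fluxes. Let `η` be a cutoff function built from the
regularized distance to the complement, at a small scale. The charts give tangent paraboloids of
uniform size at all boundary points (`exists_isParabolicNormal`), so the normal is Lipschitz and
`∇η = -c N` up to a small relative error, with `c ≥ 0` and `N` a Lipschitz extension of the normal
(`exists_isBoundaryCutoff`). For `w ∈ BV(Ω)`, the fluxes `-∫_Ω w ∇η · φ` converge to the boundary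
term of the Gauss–Green formula as the scale tends to zero (`tendsto_flux`), so `g` is a trace
exactly if the limit is `∫_∂Ω g φ · ν` for all `φ` (`isTrace_iff`). Testing with multiples of a
regularization of `N`, for which `-∇η · N ≥ 0`, bounds the flux by that of `|w|`, and a further
integration by parts, together with `V(|w|, ·) ≤ V(w, ·)` (`pairing_abs_le`), gives the trace
inequality. For existence, if `w` is bounded with bounded support, the limit flux is at most a
multiple of `∫_∂Ω |φ · ν|`, because, in a bounded set, strips of width `t` along
the boundary have volume `O(t)`
(`exists_strip_bound`); a Riesz representation in `L²` then provides the trace. Such functions are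
dense in `BV(Ω)` (`exists_bounded_support_approx`), and the trace inequality makes their traces
converge.

The gradient measure required in the definition of the trace exists by compactness: the variations
of mollifications of `u` have a limit measure that dominates the distributional gradient
(`exists_measure_pairing_le`), whose density is again found by a Riesz representation.
-/

noncomputable section

namespace Capillary

variable {d : ℕ}

/-! ### Divergence of vector fields -/

/-- The Euclidean space `ℝ^d`. -/
abbrev Space (d : ℕ) : Type := EuclideanSpace ℝ (Fin d)

lemma sum_apply_smul_single (v : Space d) :
    ∑ i, v i • (EuclideanSpace.single i (1 : ℝ) : Space d) = v := by
  ext j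
  simp [Finset.sum_apply, Pi.single_apply]

lemma divergence_smul {f : Space d → ℝ} {φ : Space d → Space d} {x : Space d}
    (hf : DifferentiableAt ℝ f x) (hφ : DifferentiableAt ℝ φ x) :
    divergence (fun y => f y • φ y) x = f x * divergence φ x + fderiv ℝ f x (φ x) := by
  have h := hf.hasFDerivAt.smul hφ.hasFDerivAt
  have h1 : fderiv ℝ f x (φ x) =
      ∑ i, fderiv ℝ f x (EuclideanSpace.single i (1 : ℝ)) * (φ x) i := by
    conv_lhs => rw [← sum_apply_smul_single (φ x), map_sum]
    simp [mul_comm]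
  rw [h1, divergence, divergence, Finset.mul_sum, ← Finset.sum_add_distrib]
  refine Finset.sum_congr rfl fun i _ => ?_
  have h2 : fderiv ℝ (fun y => f y • φ y) x = _ := h.fderiv
  rw [h2]
  simp

lemma divergence_add {φ ψ : Space d → Space d} {x : Space d}
    (hφ : DifferentiableAt ℝ φ x) (hψ : DifferentiableAt ℝ ψ x) :
    divergence (fun y => φ y + ψ y) x = divergence φ x + divergence ψ x := by
  simp only [divergence, ← Finset.sum_add_distrib]
  refine Finset.sum_congr rfl fun i _ => ?_
  rw [fderiv_fun_add hφ hψ]; simp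

lemma divergence_const_smul (c : ℝ) {φ : Space d → Space d} {x : Space d}
    (hφ : DifferentiableAt ℝ φ x) :
    divergence (fun y => c • φ y) x = c * divergence φ x := by
  simp only [divergence, Finset.mul_sum]
  refine Finset.sum_congr rfl fun i _ => ?_
  rw [fderiv_fun_const_smul hφ]; simp

lemma divergence_neg (φ : Space d → Space d) (x : Space d) :
    divergence (fun y => -φ y) x = -divergence φ x := by
  simp only [divergence, fderiv_fun_neg, ← Finset.sum_neg_distrib]
  simp

lemma divergence_comp_add (φ : Space d → Space d) (z x : Space d) :
    divergence (fun y => φ (y + z)) x = divergence φ (x + z) := by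
  simp only [divergence, fderiv_comp_add_right]

lemma abs_divergence_le (φ : Space d → Space d) (x : Space d) :
    |divergence φ x| ≤ d * ‖fderiv ℝ φ x‖ := by
  calc |divergence φ x|
      ≤ ∑ i : Fin d, |(fderiv ℝ φ x (EuclideanSpace.single i (1 : ℝ))) i| :=
        Finset.abs_sum_le_sum_abs _ _
    _ ≤ ∑ _i : Fin d, ‖fderiv ℝ φ x‖ := by
        refine Finset.sum_le_sum fun i _ => ?_
        refine (PiLp.norm_apply_le (fderiv ℝ φ x (EuclideanSpace.single i (1 : ℝ))) i).trans ?_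
        simpa using (fderiv ℝ φ x).le_opNorm (EuclideanSpace.single i (1 : ℝ))
    _ = d * ‖fderiv ℝ φ x‖ := by simp

lemma continuous_divergence {φ : Space d → Space d} (hφ : ContDiff ℝ 1 φ) :
    Continuous (divergence φ) := by
  have h : Continuous (fderiv ℝ φ) := hφ.continuous_fderiv (by norm_num)
  unfold divergence
  fun_prop

lemma divergence_eq_zero_of_notMem_tsupport {φ : Space d → Space d} {x : Space d}
    (hx : x ∉ tsupport φ) : divergence φ x = 0 := by
  simp [divergence, fderiv_of_notMem_tsupport (𝕜 := ℝ) hx]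

lemma hasCompactSupport_divergence {φ : Space d → Space d} (hφ : HasCompactSupport φ) :
    HasCompactSupport (divergence φ) :=
  HasCompactSupport.intro' hφ (isClosed_tsupport φ)
    fun _ hx => divergence_eq_zero_of_notMem_tsupport hx

lemma exists_bound_divergence {φ : Space d → Space d} (hφ : ContDiff ℝ 1 φ)
    (hc : HasCompactSupport φ) : ∃ C, 0 ≤ C ∧ ∀ x, |divergence φ x| ≤ C := by
  obtain ⟨C, hC⟩ := (hasCompactSupport_divergence hc).exists_bound_of_continuous
    (continuous_divergence hφ)
  exact ⟨C, (norm_nonneg _).trans (hC 0), hC⟩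

/-- Integration by parts against a compactly supported vector field. -/
lemma integral_mul_divergence {f : Space d → ℝ} {φ : Space d → Space d}
    (hf : ContDiff ℝ 1 f) (hφ : ContDiff ℝ 1 φ) (hc : HasCompactSupport φ) :
    ∫ x, f x * divergence φ x = -∫ x, fderiv ℝ f x (φ x) := by
  have hφi : ∀ i, ContDiff ℝ 1 (fun x => φ x i) := fun i => by fun_prop
  have hci : ∀ i, HasCompactSupport (fun x => φ x i) := fun i =>
    hc.comp_left (g := fun v : Space d => v i) rfl
  have hfd : ∀ i x v, fderiv ℝ (fun x => φ x i) x v = (fderiv ℝ φ x v) i := by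
    intro i x v
    have h1 : HasFDerivAt (fun x => φ x i)
        ((EuclideanSpace.proj i : Space d →L[ℝ] ℝ).comp (fderiv ℝ φ x)) x :=
      (EuclideanSpace.proj i : Space d →L[ℝ] ℝ).hasFDerivAt.comp x
        (hφ.differentiable (by norm_num) x).hasFDerivAt
    rw [h1.fderiv]; rfl
  have hcf : Continuous (fderiv ℝ f) := hf.continuous_fderiv (by norm_num)
  have i1 : ∀ i, Integrable fun x => f x * fderiv ℝ (fun x => φ x i) x
      (EuclideanSpace.single i (1 : ℝ)) := by
    intro i
    have hcd : Continuous (fderiv ℝ (fun x => φ x i)) := (hφi i).continuous_fderiv (by norm_num)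
    refine Continuous.integrable_of_hasCompactSupport
      (hf.continuous.mul (by fun_prop)) ?_
    exact ((hci i).fderiv_apply (𝕜 := ℝ) _).mul_left
  have i2 : ∀ i, Integrable fun x => fderiv ℝ f x (EuclideanSpace.single i (1 : ℝ)) * φ x i := by
    intro i
    exact Continuous.integrable_of_hasCompactSupport
      ((by fun_prop : Continuous fun x => fderiv ℝ f x (EuclideanSpace.single i (1 : ℝ))).mul
        (hφi i).continuous) (hci i).mul_left
  have i3 : ∀ i, Integrable fun x => f x * φ x i := fun i =>
    (hf.continuous.mul (hφi i).continuous).integrable_of_hasCompactSupport (hci i).mul_left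
  calc ∫ x, f x * divergence φ x
      = ∫ x, ∑ i, f x * fderiv ℝ (fun x => φ x i) x (EuclideanSpace.single i (1 : ℝ)) := by
        simp only [divergence, Finset.mul_sum, hfd]
    _ = ∑ i, ∫ x, f x * fderiv ℝ (fun x => φ x i) x (EuclideanSpace.single i (1 : ℝ)) :=
        integral_finsetSum _ fun i _ => i1 i
    _ = ∑ i, -∫ x, fderiv ℝ f x (EuclideanSpace.single i (1 : ℝ)) * φ x i := by
        refine Finset.sum_congr rfl fun i _ => ?_
        exact integral_mul_fderiv_eq_neg_fderiv_mul_of_integrable (i2 i) (i1 i) (i3 i)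
          (fun x _ => hf.differentiable (by norm_num) x)
          (fun x _ => (hφi i).differentiable (by norm_num) x)
    _ = -∫ x, ∑ i, fderiv ℝ f x (EuclideanSpace.single i (1 : ℝ)) * φ x i := by
        rw [integral_finsetSum _ fun i _ => i2 i, Finset.sum_neg_distrib]
    _ = -∫ x, fderiv ℝ f x (φ x) := by
        congr 2
        ext x
        conv_rhs => rw [← sum_apply_smul_single (φ x), map_sum]
        simp [mul_comm]

/-! ### Test fields and the total variation -/

section TestFields

variable {U V : Set (Space d)} {φ ψ : Space d → Space d}

lemma testFields_mono (h : U ⊆ V) : testFields U ⊆ testFields V :=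
  fun _ hφ => ⟨hφ.1, hφ.2.1, hφ.2.2.trans h⟩

lemma mem_testFields_of_tsupport_subset (hφ : φ ∈ testFields U) (hψ : ContDiff ℝ 1 ψ)
    (h : tsupport ψ ⊆ tsupport φ) : ψ ∈ testFields U :=
  ⟨hψ, HasCompactSupport.of_support_subset_isCompact hφ.2.1 ((subset_tsupport ψ).trans h),
    h.trans hφ.2.2⟩

lemma testFields_add (hφ : φ ∈ testFields U) (hψ : ψ ∈ testFields U) :
    (fun x => φ x + ψ x) ∈ testFields U :=
  ⟨hφ.1.add hψ.1, hφ.2.1.add hψ.2.1,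
    (tsupport_add φ ψ).trans (union_subset hφ.2.2 hψ.2.2)⟩

lemma smul_mem_testFields' {f : Space d → ℝ} (hf : ContDiff ℝ 1 f) (hφ : φ ∈ testFields U) :
    (fun x => f x • φ x) ∈ testFields U :=
  mem_testFields_of_tsupport_subset hφ (by have := hφ.1; fun_prop)
    (tsupport_smul_subset_right f φ)

lemma testFields_const_smul (c : ℝ) (hφ : φ ∈ testFields U) :
    (fun x => c • φ x) ∈ testFields U :=
  smul_mem_testFields' (f := fun _ => c) contDiff_const hφ

lemma testFields_neg (hφ : φ ∈ testFields U) : (fun x => -φ x) ∈ testFields U := by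
  simpa using testFields_const_smul (-1) hφ

lemma zero_mem_testFields : (fun _ => 0 : Space d → Space d) ∈ testFields U := by
  have h : tsupport (fun _ => 0 : Space d → Space d) = ∅ := by
    rw [tsupport_eq_empty_iff]; rfl
  exact ⟨contDiff_const, by rw [HasCompactSupport, h]; exact isCompact_empty, by simp [h]⟩

/-- Cutting off a compactly supported field by a function supported in `U`. -/
lemma smul_mem_testFields {f : Space d → ℝ} (hf : ContDiff ℝ 1 f) (hfU : tsupport f ⊆ U)
    (hφ : ContDiff ℝ 1 φ) (hc : HasCompactSupport φ) : (fun x => f x • φ x) ∈ testFields U :=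
  ⟨by fun_prop, HasCompactSupport.of_support_subset_isCompact hc
    ((subset_tsupport _).trans (tsupport_smul_subset_right f φ)),
    (tsupport_smul_subset_left f φ).trans hfU⟩

end TestFields

/-- The distributional gradient of `u` in `Ω`, evaluated on the vector field `φ`. -/
def pairing (Ω : Set (Space d)) (u : Space d → ℝ) (φ : Space d → Space d) : ℝ :=
  -∫ x in Ω, u x * divergence φ x

section Pairing

variable {Ω U U' : Set (Space d)} {u v : Space d → ℝ} {φ ψ : Space d → Space d}

lemma integrableOn_mul_divergence (hu : IntegrableOn u Ω) (hφ : ContDiff ℝ 1 φ)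
    (hc : HasCompactSupport φ) : IntegrableOn (fun x => u x * divergence φ x) Ω := by
  obtain ⟨C, -, hC⟩ := exists_bound_divergence hφ hc
  exact hu.mul_bdd (continuous_divergence hφ).aestronglyMeasurable (ae_of_all _ hC)

lemma pairing_eq_of_subset (hΩ : MeasurableSet Ω) (hU : U ⊆ Ω) (hφ : tsupport φ ⊆ U) :
    pairing Ω u φ = pairing U u φ := by
  unfold pairing
  rw [setIntegral_eq_of_subset_of_forall_sdiff_eq_zero hΩ hU]
  intro x hx
  rw [divergence_eq_zero_of_notMem_tsupport (fun h => hx.2 (hφ h)), mul_zero]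

lemma pairing_congr (h : u =ᵐ[volume.restrict Ω] v) : pairing Ω u φ = pairing Ω v φ := by
  unfold pairing
  rw [integral_congr_ae]
  filter_upwards [h] with x hx
  rw [hx]

lemma pairing_add_left (hu : IntegrableOn u Ω) (hv : IntegrableOn v Ω)
    (hφ : ContDiff ℝ 1 φ) (hc : HasCompactSupport φ) :
    pairing Ω (fun x => u x + v x) φ = pairing Ω u φ + pairing Ω v φ := by
  unfold pairing
  rw [← neg_add, ← integral_add (integrableOn_mul_divergence hu hφ hc)
    (integrableOn_mul_divergence hv hφ hc)]
  simp only [add_mul]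

lemma pairing_neg_left : pairing Ω (fun x => -u x) φ = -pairing Ω u φ := by
  simp [pairing, integral_neg]

lemma pairing_sub_left (hu : IntegrableOn u Ω) (hv : IntegrableOn v Ω)
    (hφ : ContDiff ℝ 1 φ) (hc : HasCompactSupport φ) :
    pairing Ω (fun x => u x - v x) φ = pairing Ω u φ - pairing Ω v φ := by
  simp only [sub_eq_add_neg]
  rw [← pairing_neg_left]
  exact pairing_add_left hu hv.neg hφ hc

lemma pairing_add_right (hu : IntegrableOn u Ω) (hφ : φ ∈ testFields U)
    (hψ : ψ ∈ testFields U') :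
    pairing Ω u (fun x => φ x + ψ x) = pairing Ω u φ + pairing Ω u ψ := by
  unfold pairing
  rw [← neg_add, ← integral_add (integrableOn_mul_divergence hu hφ.1 hφ.2.1)
    (integrableOn_mul_divergence hu hψ.1 hψ.2.1)]
  congr 2
  ext x
  rw [divergence_add (hφ.1.differentiable (by norm_num) x)
    (hψ.1.differentiable (by norm_num) x), mul_add]

lemma pairing_const_smul_right (c : ℝ) (hφ : ContDiff ℝ 1 φ) :
    pairing Ω u (fun x => c • φ x) = c * pairing Ω u φ := by
  unfold pairing
  rw [mul_neg, ← integral_const_mul]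
  congr 2
  ext x
  rw [divergence_const_smul c (hφ.differentiable (by norm_num) x)]
  ring

lemma pairing_neg_right : pairing Ω u (fun x => -φ x) = -pairing Ω u φ := by
  simp [pairing, divergence_neg, integral_neg]

lemma ofReal_pairing_le (hφ : φ ∈ testFields Ω) (h1 : ∀ x, ‖φ x‖ ≤ 1) :
    ENNReal.ofReal (pairing Ω u φ) ≤ totalVariation Ω u :=
  le_iSup₂_of_le (f := fun φ (_ : φ ∈ {φ ∈ testFields Ω | ∀ x, ‖φ x‖ ≤ 1}) =>
    ENNReal.ofReal (-∫ x in Ω, u x * divergence φ x)) φ ⟨hφ, h1⟩ le_rfl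

lemma totalVariation_le {A : ℝ≥0∞}
    (h : ∀ φ ∈ testFields Ω, (∀ x, ‖φ x‖ ≤ 1) → ENNReal.ofReal (pairing Ω u φ) ≤ A) :
    totalVariation Ω u ≤ A :=
  iSup₂_le fun φ hφ => h φ hφ.1 hφ.2

lemma exists_lt_pairing {a : ℝ≥0∞} (ha : a < totalVariation Ω u) :
    ∃ φ ∈ testFields Ω, (∀ x, ‖φ x‖ ≤ 1) ∧ a < ENNReal.ofReal (pairing Ω u φ) := by
  by_contra! h
  exact ha.not_ge (totalVariation_le h)

lemma pairing_le_toReal (hV : totalVariation Ω u ≠ ⊤) (hφ : φ ∈ testFields Ω)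
    (h1 : ∀ x, ‖φ x‖ ≤ 1) : pairing Ω u φ ≤ (totalVariation Ω u).toReal :=
  (ENNReal.ofReal_le_iff_le_toReal hV).1 (ofReal_pairing_le hφ h1)

lemma pairing_le_mul_toReal (hV : totalVariation Ω u ≠ ⊤) (hφ : φ ∈ testFields Ω) {C : ℝ}
    (hC : 0 < C) (h1 : ∀ x, ‖φ x‖ ≤ C) : pairing Ω u φ ≤ C * (totalVariation Ω u).toReal := by
  have h := pairing_le_toReal hV (testFields_const_smul C⁻¹ hφ) (fun x => by
    rw [norm_smul, norm_inv, Real.norm_of_nonneg hC.le, inv_mul_le_iff₀ hC]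
    simpa using h1 x)
  rwa [pairing_const_smul_right _ hφ.1, inv_mul_le_iff₀ hC] at h

lemma totalVariation_mono (hΩ : MeasurableSet Ω) (hU : U ⊆ Ω) :
    totalVariation U u ≤ totalVariation Ω u :=
  totalVariation_le fun φ hφ hb => by
    rw [← pairing_eq_of_subset hΩ hU hφ.2.2]
    exact ofReal_pairing_le (testFields_mono hU hφ) hb

lemma totalVariation_neg : totalVariation Ω (fun x => -u x) = totalVariation Ω u := by
  have key : ∀ w : Space d → ℝ, totalVariation Ω (fun x => -w x) ≤ totalVariation Ω w := by
    refine fun w => totalVariation_le fun φ hφ hb => ?_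
    rw [pairing_neg_left, ← pairing_neg_right]
    exact ofReal_pairing_le (testFields_neg hφ) (by simpa using hb)
  refine le_antisymm (key u) ?_
  simpa using key fun x => -u x

lemma totalVariation_add_le (hu : IntegrableOn u Ω) (hv : IntegrableOn v Ω) :
    totalVariation Ω (fun x => u x + v x) ≤ totalVariation Ω u + totalVariation Ω v :=
  totalVariation_le fun φ hφ hb => by
    rw [pairing_add_left hu hv hφ.1 hφ.2.1]
    exact ENNReal.ofReal_add_le.trans
      (add_le_add (ofReal_pairing_le hφ hb) (ofReal_pairing_le hφ hb))

lemma totalVariation_sub_le (hu : IntegrableOn u Ω) (hv : IntegrableOn v Ω) :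
    totalVariation Ω (fun x => u x - v x) ≤ totalVariation Ω u + totalVariation Ω v := by
  rw [← totalVariation_neg (u := v)]
  simpa only [sub_eq_add_neg] using! totalVariation_add_le hu hv.neg

lemma norm_add_le_one_of_disjoint (h : Disjoint (tsupport φ) (tsupport ψ))
    (hφ : ∀ x, ‖φ x‖ ≤ 1) (hψ : ∀ x, ‖ψ x‖ ≤ 1) (x : Space d) : ‖φ x + ψ x‖ ≤ 1 := by
  by_cases hx : x ∈ tsupport φ
  · rw [image_eq_zero_of_notMem_tsupport (disjoint_left.1 h hx), add_zero]
    exact hφ x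
  · rw [image_eq_zero_of_notMem_tsupport hx, zero_add]
    exact hψ x

lemma totalVariation_add_le_of_disjoint (hΩ : MeasurableSet Ω) (hu : IntegrableOn u Ω)
    (hU : U ⊆ Ω) (hU' : U' ⊆ Ω) (hd : Disjoint U U') :
    totalVariation U u + totalVariation U' u ≤ totalVariation Ω u := by
  refine ENNReal.biSup_add_biSup_le' ⟨_, zero_mem_testFields, by simp⟩
    ⟨_, zero_mem_testFields, by simp⟩ fun φ hφ ψ hψ => ?_
  change ENNReal.ofReal (pairing U u φ) + ENNReal.ofReal (pairing U' u ψ) ≤ _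
  rw [← pairing_eq_of_subset hΩ hU hφ.1.2.2, ← pairing_eq_of_subset hΩ hU' hψ.1.2.2]
  have hφ' := testFields_mono hU hφ.1
  have hψ' := testFields_mono hU' hψ.1
  rcases le_total (pairing Ω u φ) 0 with h1 | h1
  · rw [ENNReal.ofReal_of_nonpos h1, zero_add]
    exact ofReal_pairing_le hψ' hψ.2
  rcases le_total (pairing Ω u ψ) 0 with h2 | h2
  · rw [ENNReal.ofReal_of_nonpos h2, add_zero]
    exact ofReal_pairing_le hφ' hφ.2
  rw [← ENNReal.ofReal_add h1 h2, ← pairing_add_right hu hφ' hψ']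
  exact ofReal_pairing_le (testFields_add hφ' hψ')
    (norm_add_le_one_of_disjoint (hd.mono hφ.1.2.2 hψ.1.2.2) hφ.2 hψ.2)

/-- The total variation is concentrated on compact sets: it is small on the open sets that avoid
a suitable compact subset of `Ω`. -/
lemma exists_isCompact_totalVariation_le (hΩ : MeasurableSet Ω) (hu : IntegrableOn u Ω)
    (hV : totalVariation Ω u ≠ ⊤) {ε : ℝ} (hε : 0 < ε) :
    ∃ K ⊆ Ω, IsCompact K ∧
      (∀ U ⊆ Ω, Disjoint U K → totalVariation U u ≤ ENNReal.ofReal ε) ∧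
      ∃ φ ∈ testFields Ω, tsupport φ = K ∧ (∀ x, ‖φ x‖ ≤ 1) ∧
        (totalVariation Ω u).toReal - ε ≤ pairing Ω u φ := by
  obtain ⟨φ, hφ, hb, hlt⟩ : ∃ φ ∈ testFields Ω, (∀ x, ‖φ x‖ ≤ 1) ∧
      (totalVariation Ω u).toReal - ε ≤ pairing Ω u φ := by
    rcases eq_or_ne (totalVariation Ω u) 0 with h0 | h0
    · refine ⟨_, zero_mem_testFields, by simp, ?_⟩
      have : pairing Ω u (fun _ => 0) = 0 := by simp [pairing, divergence]
      rw [h0, this]; simpa using hε.le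
    · obtain ⟨φ, hφ, hb, h⟩ := exists_lt_pairing (ENNReal.sub_lt_self hV h0
        (ENNReal.ofReal_pos.2 hε).ne')
      refine ⟨φ, hφ, hb, ?_⟩
      by_contra! hlt
      refine h.not_ge ?_
      rw [← ENNReal.ofReal_toReal hV, ← ENNReal.ofReal_sub _ hε.le]
      exact ENNReal.ofReal_le_ofReal hlt.le
  refine ⟨tsupport φ, hφ.2.2, hφ.2.1, fun U hU hd => totalVariation_le fun ψ hψ hψb => ?_,
    φ, hφ, rfl, hb, hlt⟩
  have hψ' := testFields_mono hU hψ
  have h := pairing_le_toReal hV (testFields_add hφ hψ')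
    (norm_add_le_one_of_disjoint (hd.symm.mono_right hψ.2.2) hb hψb)
  rw [pairing_add_right hu hφ hψ'] at h
  rw [← pairing_eq_of_subset hΩ hU hψ.2.2]
  exact ENNReal.ofReal_le_ofReal (by linarith)

lemma abs_pairing_sub_le (hu : IntegrableOn u Ω) (hv : IntegrableOn v Ω)
    (hφ : ContDiff ℝ 1 φ) (hc : HasCompactSupport φ) {C : ℝ} (hC : ∀ x, |divergence φ x| ≤ C) :
    |pairing Ω u φ - pairing Ω v φ| ≤ C * ∫ x in Ω, |u x - v x| := by
  rw [← pairing_sub_left hu hv hφ hc, pairing, abs_neg, ← integral_const_mul]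
  refine norm_integral_le_of_norm_le (μ := volume.restrict Ω)
    (f := fun x => (u x - v x) * divergence φ x)
    (g := fun x => C * |u x - v x|) ((hu.sub hv).abs.const_mul C) (ae_of_all _ fun x => ?_)
  rw [norm_mul, mul_comm]
  exact mul_le_mul_of_nonneg_right (hC x) (abs_nonneg _)

end Pairing

/-! ### Mollification -/

/-- `ρ` is a probability density of class `C²` supported in the ball of radius `ε`. -/
structure IsMollifier (ρ : Space d → ℝ) (ε : ℝ) : Prop where
  contDiff : ContDiff ℝ 2 ρ
  hasCompactSupport : HasCompactSupport ρ
  nonneg : ∀ x, 0 ≤ ρ x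
  integral_eq_one : ∫ x, ρ x = 1
  support_subset : Function.support ρ ⊆ Metric.ball 0 ε

lemma exists_isMollifier {ε : ℝ} (hε : 0 < ε) : ∃ ρ : Space d → ℝ, IsMollifier ρ ε := by
  let b : ContDiffBump (0 : Space d) := ⟨ε / 2, ε, by linarith, by linarith⟩
  exact ⟨b.normed volume, b.contDiff_normed, b.hasCompactSupport_normed, b.nonneg_normed,
    b.integral_normed, b.support_normed_eq.subset⟩

/-- The convolution `ρ * g`. -/
def mollify {F : Type*} [NormedAddCommGroup F] [NormedSpace ℝ F] (ρ : Space d → ℝ)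
    (g : Space d → F) (x : Space d) : F :=
  ∫ z, ρ z • g (x - z)

section Mollify

variable {F : Type*} [NormedAddCommGroup F] [NormedSpace ℝ F]
  {ρ : Space d → ℝ} {ε : ℝ} {g : Space d → F} {x : Space d}

lemma mollify_eq_convolution :
    mollify ρ g = (MeasureTheory.convolution ρ g (ContinuousLinearMap.lsmul ℝ ℝ) volume) := rfl

lemma IsMollifier.integrable (h : IsMollifier ρ ε) : Integrable ρ :=
  h.contDiff.continuous.integrable_of_hasCompactSupport h.hasCompactSupport

lemma IsMollifier.contDiff_mollify [CompleteSpace F] (h : IsMollifier ρ ε)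
    (hg : LocallyIntegrable g) : ContDiff ℝ 2 (mollify ρ g) := by
  rw [mollify_eq_convolution]
  exact h.hasCompactSupport.contDiff_convolution_left (n := 2) _ h.contDiff hg

lemma IsMollifier.norm_mollify_sub_le [CompleteSpace F] (h : IsMollifier ρ ε) {w : F} {c : ℝ}
    (hc : 0 ≤ c) (hg : AEStronglyMeasurable g)
    (hw : ∀ y ∈ Metric.ball x ε, ‖g y - w‖ ≤ c) : ‖mollify ρ g x - w‖ ≤ c := by
  rw [mollify_eq_convolution, ← dist_eq_norm]
  exact dist_convolution_le hc h.support_subset h.nonneg h.integral_eq_one hg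
    fun y hy => by rw [dist_eq_norm]; exact hw y hy

lemma IsMollifier.integrable_mollify (h : IsMollifier ρ ε) (hg : Integrable g) :
    Integrable (mollify ρ g) :=
  h.integrable.integrable_convolution (ContinuousLinearMap.lsmul ℝ ℝ) hg

lemma IsMollifier.integrable_smul_comp_sub (h : IsMollifier ρ ε) (hg : Continuous g)
    (x : Space d) : Integrable fun z => ρ z • g (x - z) :=
  (h.contDiff.continuous.smul (by fun_prop)).integrable_of_hasCompactSupport
    h.hasCompactSupport.smul_right

lemma IsMollifier.mollify_sub_mollify (h : IsMollifier ρ ε) (hg : Continuous g)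
    (x y : Space d) : mollify ρ g x - mollify ρ g y = ∫ z, ρ z • (g (x - z) - g (y - z)) := by
  simp only [mollify, smul_sub]
  rw [integral_sub (h.integrable_smul_comp_sub hg x) (h.integrable_smul_comp_sub hg y)]

/-- Averages of quantities bounded by `c` are bounded by `c`. -/
lemma IsMollifier.norm_integral_smul_le (h : IsMollifier ρ ε) {f : Space d → F} {c : ℝ}
    (hf : ∀ z ∈ Metric.ball (0 : Space d) ε, ‖f z‖ ≤ c) : ‖∫ z, ρ z • f z‖ ≤ c := by
  have h1 : ‖∫ z, ρ z • f z‖ ≤ ∫ z, ρ z * c := by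
    refine norm_integral_le_of_norm_le (h.integrable.mul_const c) (ae_of_all _ fun z => ?_)
    rw [norm_smul, Real.norm_of_nonneg (h.nonneg z)]
    by_cases hz : z ∈ Metric.ball (0 : Space d) ε
    · exact mul_le_mul_of_nonneg_left (hf z hz) (h.nonneg z)
    · have : ρ z = 0 := by
        by_contra h0
        exact hz (h.support_subset h0)
      simp [this]
  rwa [integral_mul_const, h.integral_eq_one, one_mul] at h1

lemma IsMollifier.integral_mul_le (h : IsMollifier ρ ε) {f : Space d → ℝ} {c : ℝ} (hc : 0 ≤ c)
    (hf : ∀ z ∈ Metric.ball (0 : Space d) ε, f z ≤ c) : ∫ z, ρ z * f z ≤ c := by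
  by_cases hi : Integrable fun z => ρ z * f z
  · have h1 : ∫ z, ρ z * f z ≤ ∫ z, ρ z * c := by
      refine integral_mono hi (h.integrable.mul_const c) fun z => ?_
      by_cases hz : z ∈ Metric.ball (0 : Space d) ε
      · exact mul_le_mul_of_nonneg_left (hf z hz) (h.nonneg z)
      · have : ρ z = 0 := by
          by_contra h0
          exact hz (h.support_subset h0)
        simp [this]
    rwa [integral_mul_const, h.integral_eq_one, one_mul] at h1
  · rw [integral_undef hi]; exact hc

lemma IsMollifier.lipschitzWith_mollify (h : IsMollifier ρ ε) {L : NNReal}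
    (hg : LipschitzWith L g) : LipschitzWith L (mollify ρ g) := by
  refine LipschitzWith.of_dist_le_mul fun x y => ?_
  rw [dist_eq_norm, h.mollify_sub_mollify hg.continuous]
  refine h.norm_integral_smul_le fun z _ => ?_
  have := hg.dist_le_mul (x - z) (y - z)
  rwa [dist_eq_norm, dist_sub_right] at this

lemma IsMollifier.integral_abs_mollify_le (h : IsMollifier ρ ε) {u : Space d → ℝ}
    (hu : Integrable u) : ∫ x, |mollify ρ u x| ≤ ∫ x, |u x| := by
  have h1 : ∫ x, mollify ρ (fun x => |u x|) x = ∫ x, |u x| := by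
    have := integral_convolution (ContinuousLinearMap.lsmul ℝ ℝ) h.integrable hu.abs
      (μ := volume) (ν := volume)
    rw [h.integral_eq_one] at this
    simpa [mollify_eq_convolution] using this
  rw [← h1]
  refine integral_mono (h.integrable_mollify hu).abs (h.integrable_mollify hu.abs) fun x => ?_
  refine (abs_integral_le_integral_abs).trans_eq ?_
  refine integral_congr_ae (ae_of_all _ fun z => ?_)
  simp [abs_mul, abs_of_nonneg (h.nonneg z)]

lemma mollify_sub_of_integrable (h : IsMollifier ρ ε) {u v : Space d → ℝ}
    (hu : Integrable u) (hv : Integrable v) :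
    mollify ρ (fun x => u x - v x) =ᵐ[volume] fun x => mollify ρ u x - mollify ρ v x := by
  filter_upwards with x
  have hi : ∀ w : Space d → ℝ, Integrable w → Integrable fun z => ρ z • w (x - z) := by
    intro w hw
    obtain ⟨C, hC⟩ := h.hasCompactSupport.exists_bound_of_continuous h.contDiff.continuous
    exact (hw.comp_sub_left x).bdd_mul h.contDiff.continuous.aestronglyMeasurable
      (ae_of_all _ hC)
  simp only [mollify, smul_sub]
  exact integral_sub (hi u hu) (hi v hv)

/-- Mollifications converge in `L¹`. -/
lemma exists_integral_abs_mollify_sub_le {u : Space d → ℝ} (hu : Integrable u) {η : ℝ}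
    (hη : 0 < η) : ∃ ε₀ > 0, ∀ ε ≤ ε₀, ∀ ρ : Space d → ℝ, IsMollifier ρ ε →
      ∫ x, |mollify ρ u x - u x| ≤ η := by
  obtain ⟨g, hgc, hug, hgcont, hgi⟩ := hu.exists_hasCompactSupport_integral_sub_le
    (ε := η / 4) (by positivity)
  set K := Metric.cthickening 1 (tsupport g) with hK
  have hKc : IsCompact K := hgc.isCompact.cthickening
  have hvol : 0 ≤ volume.real K := measureReal_nonneg
  set δ := η / (4 * (volume.real K + 1)) with hδ
  have hδ0 : 0 < δ := by positivity
  obtain ⟨ε₁, hε₁, huc⟩ := Metric.uniformContinuous_iff.1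
    (hgc.uniformContinuous_of_continuous hgcont) δ hδ0
  refine ⟨min ε₁ 1, by positivity, fun ε hε ρ h => ?_⟩
  have hbound : ∀ x, |mollify ρ g x - g x| ≤ K.indicator (fun _ => δ) x := by
    intro x
    by_cases hx : x ∈ K
    · rw [indicator_of_mem hx]
      refine h.norm_mollify_sub_le hδ0.le hgcont.aestronglyMeasurable fun y hy => ?_
      rw [← dist_eq_norm]
      exact (huc ((Metric.mem_ball.1 hy).trans_le (hε.trans (min_le_left _ _)))).le
    · rw [indicator_of_notMem hx]
      have hz : ∀ y ∈ Metric.ball x ε, g y = 0 := by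
        intro y hy
        apply image_eq_zero_of_notMem_tsupport
        intro hy'
        refine hx (Metric.mem_cthickening_of_dist_le x y 1 _ hy' ?_)
        rw [dist_comm]
        exact (Metric.mem_ball.1 hy).le.trans (hε.trans (min_le_right _ _))
      have hx0 : g x = 0 := by
        apply image_eq_zero_of_notMem_tsupport
        intro hy'
        exact hx (Metric.self_subset_cthickening _ hy')
      exact h.norm_mollify_sub_le le_rfl hgcont.aestronglyMeasurable fun y hy => by
        simp [hz y hy, hx0]
  have i1 := h.integrable_mollify hu
  have i2 := h.integrable_mollify hgi
  have e1 : ∫ x, |mollify ρ u x - mollify ρ g x| ≤ η / 4 := by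
    calc ∫ x, |mollify ρ u x - mollify ρ g x|
        = ∫ x, |mollify ρ (fun x => u x - g x) x| := by
          refine integral_congr_ae ?_
          filter_upwards [mollify_sub_of_integrable h hu hgi] with x hx
          rw [hx]
      _ ≤ ∫ x, |u x - g x| := h.integral_abs_mollify_le (hu.sub hgi)
      _ ≤ η / 4 := hug
  have e2 : ∫ x, |mollify ρ g x - g x| ≤ η / 4 := by
    calc ∫ x, |mollify ρ g x - g x| ≤ ∫ x, K.indicator (fun _ => δ) x :=
          integral_mono (i2.sub hgi).abs ((integrable_indicator_iff hKc.measurableSet).2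
            (integrableOn_const hKc.measure_lt_top.ne)) hbound
      _ = volume.real K * δ := by
          rw [integral_indicator hKc.measurableSet, setIntegral_const, smul_eq_mul]
      _ ≤ (volume.real K + 1) * δ := by gcongr; linarith
      _ = η / 4 := by rw [hδ]; field_simp
  have e3 : ∫ x, |u x - g x| ≤ η / 4 := hug
  calc ∫ x, |mollify ρ u x - u x|
      ≤ ∫ x, (|mollify ρ u x - mollify ρ g x| + |mollify ρ g x - g x| + |u x - g x|) := by
        refine integral_mono (i1.sub hu).abs
          (((i1.sub i2).abs.add (i2.sub hgi).abs).add (hu.sub hgi).abs) fun x => ?_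
        have := abs_sub_le (mollify ρ u x) (mollify ρ g x) (u x)
        have h2 := abs_sub_le (mollify ρ g x) (g x) (u x)
        rw [abs_sub_comm (g x)] at h2
        dsimp only
        linarith
    _ = (∫ x, |mollify ρ u x - mollify ρ g x|) + (∫ x, |mollify ρ g x - g x|) +
          ∫ x, |u x - g x| := by
        rw [integral_add (by exact (i1.sub i2).abs.add (i2.sub hgi).abs)
          (by exact (hu.sub hgi).abs),
          integral_add (by exact (i1.sub i2).abs) (by exact (i2.sub hgi).abs)]
    _ ≤ η := by linarith

end Mollify

/-! ### Compositions with Lipschitz functions -/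

section Chain

variable {U : Set (Space d)} {u : Space d → ℝ} {φ ψ : Space d → Space d} {ρ : Space d → ℝ} {ε : ℝ}

lemma comp_add_mem_testFields (hφ : φ ∈ testFields U) {z : Space d}
    (hz : ∀ x ∈ tsupport φ, x - z ∈ U) : (fun x => φ (x + z)) ∈ testFields U := by
  have h1 : tsupport (fun x => φ (x + z)) = (Homeomorph.addRight z) ⁻¹' tsupport φ :=
    tsupport_comp_eq_preimage φ (Homeomorph.addRight z)
  refine ⟨hφ.1.comp (contDiff_id.add contDiff_const),
    hφ.2.1.comp_homeomorph (Homeomorph.addRight z), ?_⟩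
  rw [h1]
  intro x hx
  simpa using hz _ hx

/-- The divergence tested against a mollification is an average of translates. -/
lemma integral_mollify_mul_divergence (h : IsMollifier ρ ε) (hu : Integrable u)
    (hφ : ContDiff ℝ 1 φ) (hc : HasCompactSupport φ) :
    ∫ x, mollify ρ u x * divergence φ x =
      ∫ z, ρ z * ∫ x, u x * divergence (fun y => φ (y + z)) x := by
  obtain ⟨C, -, hC⟩ := exists_bound_divergence hφ hc
  have hint : Integrable (fun p : Space d × Space d =>
      (ρ p.2 * u (p.1 - p.2)) * divergence φ p.1) (volume.prod volume) := by
    refine Integrable.mul_bdd (c := C)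
      (h.integrable.convolution_integrand (ContinuousLinearMap.lsmul ℝ ℝ) hu) ?_
      (ae_of_all _ fun p => hC p.1)
    exact ((continuous_divergence hφ).comp continuous_fst).aestronglyMeasurable
  calc ∫ x, mollify ρ u x * divergence φ x
      = ∫ x, ∫ z, (ρ z * u (x - z)) * divergence φ x := by
        simp only [mollify, smul_eq_mul, integral_mul_const]
    _ = ∫ z, ∫ x, (ρ z * u (x - z)) * divergence φ x := integral_integral_swap hint
    _ = ∫ z, ρ z * ∫ x, u x * divergence (fun y => φ (y + z)) x := by
        refine integral_congr_ae (ae_of_all _ fun z => ?_)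
        dsimp only
        rw [← integral_const_mul, ← integral_add_right_eq_self _ z]
        simp only [add_sub_cancel_right, divergence_comp_add, mul_assoc]

/-- The gradient of a mollification, tested against a field of norm at most one supported in `U`,
is bounded by the total variation in `U`. -/
lemma integral_fderiv_mollify_le (hU : IsOpen U) (hu : IntegrableOn u U)
    (hV : totalVariation U u ≠ ⊤) {K : Set (Space d)} (hK : IsCompact K) (hKU : K ⊆ U) :
    ∃ ε₀ > 0, ∀ ε ≤ ε₀, ∀ ρ : Space d → ℝ, IsMollifier ρ ε → ∀ φ : Space d → Space d,
      ContDiff ℝ 1 φ → tsupport φ ⊆ K → (∀ x, ‖φ x‖ ≤ 1) →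
      ∫ x, fderiv ℝ (mollify ρ (U.indicator u)) x (φ x) ≤ (totalVariation U u).toReal := by
  obtain ⟨ε₀, hε₀, hsub⟩ := hK.exists_thickening_subset_open hU hKU
  refine ⟨ε₀, hε₀, fun ε hε ρ h φ hφ hφK hb => ?_⟩
  have hc : HasCompactSupport φ := hK.of_isClosed_subset (isClosed_tsupport φ) hφK
  have hui : Integrable (U.indicator u) := (integrable_indicator_iff hU.measurableSet).2 hu
  have h1 := integral_mul_divergence
    ((h.contDiff_mollify hui.locallyIntegrable).of_le (by norm_num)) hφ hc
  rw [integral_mollify_mul_divergence h hui hφ hc] at h1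
  have h2 : ∫ x, fderiv ℝ (mollify ρ (U.indicator u)) x (φ x) =
      ∫ z, ρ z * pairing U u (fun y => φ (y + z)) := by
    rw [← neg_eq_iff_eq_neg] at h1
    rw [← h1, ← integral_neg]
    refine integral_congr_ae (ae_of_all _ fun z => ?_)
    dsimp only
    rw [pairing, ← integral_indicator hU.measurableSet, ← mul_neg]
    congr 3
    ext x
    by_cases hx : x ∈ U <;> simp [hx]
  rw [h2]
  refine h.integral_mul_le ENNReal.toReal_nonneg fun z hz => ?_
  refine pairing_le_toReal hV (comp_add_mem_testFields ⟨hφ, hc, hφK.trans hKU⟩ fun x hx => ?_)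
    fun x => hb _
  refine hsub (Metric.mem_thickening_iff.2 ⟨x, hφK hx, ?_⟩)
  rw [dist_eq_norm]
  simpa using (mem_ball_zero_iff.1 hz).trans_le hε

lemma lipschitz_of_abs_deriv_le_one {S : ℝ → ℝ} (hS : Differentiable ℝ S)
    (h : ∀ t, |deriv S t| ≤ 1) (s t : ℝ) : |S s - S t| ≤ |s - t| := by
  have := Convex.norm_image_sub_le_of_norm_deriv_le (f := S) (C := 1) (s := univ) (x := t) (y := s)
    (fun x _ => hS x) (fun x _ => h x) convex_univ (mem_univ _) (mem_univ _)
  simpa using this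

lemma integrableOn_comp_of_abs_deriv_le_one {S : ℝ → ℝ} (hS : ContDiff ℝ 2 S)
    (h : ∀ t, |deriv S t| ≤ 1) (h0 : S 0 = 0) (hu : IntegrableOn u U) :
    IntegrableOn (fun x => S (u x)) U := by
  refine Integrable.mono hu (hS.continuous.comp_aestronglyMeasurable hu.aestronglyMeasurable)
    (ae_of_all _ fun x => ?_)
  simpa [h0] using lipschitz_of_abs_deriv_le_one (hS.differentiable (by norm_num)) h (u x) 0

lemma tendsto_integral_comp_mul_divergence (hU : IsOpen U) (hu : IntegrableOn u U) {S : ℝ → ℝ}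
    (hS : ContDiff ℝ 2 S) (h : ∀ t, |deriv S t| ≤ 1) (h0 : S 0 = 0) (hφ : φ ∈ testFields U)
    {w : ℕ → Space d → ℝ} (hw : ∀ n, Integrable (w n))
    (hlim : Tendsto (fun n => ∫ x, |w n x - U.indicator u x|) atTop (𝓝 0)) :
    Tendsto (fun n => -∫ x, S (w n x) * divergence φ x) atTop
      (𝓝 (pairing U (fun x => S (u x)) φ)) := by
  obtain ⟨C, hC0, hC⟩ := exists_bound_divergence hφ.1 hφ.2.1
  have hui : Integrable (U.indicator u) := (integrable_indicator_iff hU.measurableSet).2 hu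
  have hSi : ∀ v : Space d → ℝ, Integrable v → Integrable fun x => S (v x) := fun v hv => by
    rw [← integrableOn_univ] at hv ⊢
    exact integrableOn_comp_of_abs_deriv_le_one hS h h0 hv
  have e : pairing U (fun x => S (u x)) φ = pairing univ (fun x => S (U.indicator u x)) φ := by
    rw [pairing_eq_of_subset MeasurableSet.univ (subset_univ U) hφ.2.2]
    refine pairing_congr ?_
    filter_upwards [self_mem_ae_restrict hU.measurableSet] with x hx
    rw [indicator_of_mem hx]
  rw [e]
  have e2 : ∀ n, -∫ x, S (w n x) * divergence φ x = pairing univ (fun x => S (w n x)) φ :=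
    fun n => by rw [pairing, setIntegral_univ]
  simp only [e2]
  rw [tendsto_iff_dist_tendsto_zero]
  refine squeeze_zero (fun n => dist_nonneg) (fun n => ?_) (by simpa using hlim.const_mul C)
  rw [Real.dist_eq]
  refine (abs_pairing_sub_le (hSi _ (hw n)).integrableOn (hSi _ hui).integrableOn hφ.1 hφ.2.1
    hC).trans ?_
  rw [setIntegral_univ]
  refine mul_le_mul_of_nonneg_left ?_ hC0
  exact integral_mono ((hSi _ (hw n)).sub (hSi _ hui)).abs ((hw n).sub hui).abs fun x =>
    lipschitz_of_abs_deriv_le_one (hS.differentiable (by norm_num)) h _ _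

lemma exists_seq_mollify (hu : Integrable u) :
    ∃ (ε : ℕ → ℝ) (ρ : ℕ → Space d → ℝ), Tendsto ε atTop (𝓝 0) ∧ (∀ n, IsMollifier (ρ n) (ε n)) ∧
      Tendsto (fun n => ∫ x, |mollify (ρ n) u x - u x|) atTop (𝓝 0) := by
  have hpos : ∀ n : ℕ, (0 : ℝ) < 1 / (n + 1) := fun n => by positivity
  choose ρ hρ using fun n => exists_isMollifier (d := d) (hpos n)
  refine ⟨_, ρ, tendsto_one_div_add_atTop_nhds_zero_nat, hρ, ?_⟩
  rw [Metric.tendsto_nhds]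
  intro η hη
  obtain ⟨ε₀, hε₀, h⟩ := exists_integral_abs_mollify_sub_le hu (half_pos hη)
  filter_upwards [(tendsto_one_div_add_atTop_nhds_zero_nat (𝕜 := ℝ)).eventually_le_const hε₀]
    with n hn
  rw [Real.dist_eq, sub_zero, abs_of_nonneg (integral_nonneg fun _ => abs_nonneg _)]
  exact (h _ hn _ (hρ n)).trans_lt (half_lt_self hη)

/-- If `|S'| + |T'| ≤ 1`, then the variations of `S ∘ u` and `T ∘ u` add up to at most that of
`u`. After mollification both are tested by the single field `S'(u) φ + T'(u) ψ`. -/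
lemma pairing_comp_add_pairing_comp_le (hU : IsOpen U) (hu : IntegrableOn u U)
    (hV : totalVariation U u ≠ ⊤) {S T : ℝ → ℝ} (hS : ContDiff ℝ 2 S) (hT : ContDiff ℝ 2 T)
    (hS0 : S 0 = 0) (hT0 : T 0 = 0) (hST : ∀ t, |deriv S t| + |deriv T t| ≤ 1)
    (hφ : φ ∈ testFields U) (hφ1 : ∀ x, ‖φ x‖ ≤ 1) (hψ : ψ ∈ testFields U)
    (hψ1 : ∀ x, ‖ψ x‖ ≤ 1) :
    pairing U (fun x => S (u x)) φ + pairing U (fun x => T (u x)) ψ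
      ≤ (totalVariation U u).toReal := by
  have hui : Integrable (U.indicator u) := (integrable_indicator_iff hU.measurableSet).2 hu
  obtain ⟨ε, ρ, hε, hρ, hlim⟩ := exists_seq_mollify hui
  obtain ⟨ε₀, hε₀, hle⟩ := integral_fderiv_mollify_le hU hu hV (hφ.2.1.union hψ.2.1)
    (union_subset hφ.2.2 hψ.2.2)
  have hS1 : ∀ t, |deriv S t| ≤ 1 := fun t => by
    linarith [hST t, abs_nonneg (deriv T t)]
  have hT1 : ∀ t, |deriv T t| ≤ 1 := fun t => by
    linarith [hST t, abs_nonneg (deriv S t)]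
  set w := fun n => mollify (ρ n) (U.indicator u) with hw
  have hwi : ∀ n, Integrable (w n) := fun n => (hρ n).integrable_mollify hui
  refine le_of_tendsto ((tendsto_integral_comp_mul_divergence hU hu hS hS1 hS0 hφ hwi hlim).add
    (tendsto_integral_comp_mul_divergence hU hu hT hT1 hT0 hψ hwi hlim)) ?_
  filter_upwards [hε.eventually_le_const hε₀] with n hn
  have hwd : ContDiff ℝ 1 (w n) :=
    ((hρ n).contDiff_mollify hui.locallyIntegrable).of_le (by norm_num)
  have hdS : ContDiff ℝ 1 (deriv S) := hS.deriv' (n := 1) 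
  have hdT : ContDiff ℝ 1 (deriv T) := hT.deriv' (n := 1)
  have key : ∀ {R : ℝ → ℝ} {χ : Space d → Space d}, ContDiff ℝ 2 R → χ ∈ testFields U →
      -∫ x, R (w n x) * divergence χ x = ∫ x, fderiv ℝ (w n) x (deriv R (w n x) • χ x) := by
    intro R χ hR hχ
    have h0 := integral_mul_divergence (f := fun x => R (w n x))
      ((hR.of_le (by norm_num)).comp hwd) hχ.1 hχ.2.1
    rw [h0, neg_neg]
    refine integral_congr_ae (ae_of_all _ fun x => ?_)
    have h1 : HasFDerivAt (fun x => R (w n x)) (deriv R (w n x) • fderiv ℝ (w n) x) x :=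
      (hR.differentiable (by norm_num) _).hasDerivAt.comp_hasFDerivAt x
        (hwd.differentiable (by norm_num) x).hasFDerivAt
    dsimp only
    rw [h1.fderiv]
    simp
  have hfi : ∀ {R : ℝ → ℝ} {χ : Space d → Space d}, ContDiff ℝ 1 (deriv R) → χ ∈ testFields U →
      Integrable fun x => fderiv ℝ (w n) x (deriv R (w n x) • χ x) := by
    intro R χ hR hχ
    refine Continuous.integrable_of_hasCompactSupport ?_ ?_
    · have h1 := hwd.continuous_fderiv (by norm_num)
      have h2 := hR.continuous
      have h3 := hwd.continuous
      have h4 := hχ.1.continuous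
      fun_prop
    · refine HasCompactSupport.of_support_subset_isCompact hχ.2.1 fun x hx => ?_
      by_contra h0
      exact hx (by simp [image_eq_zero_of_notMem_tsupport h0])
  rw [key hS hφ, key hT hψ, ← integral_add (hfi hdS hφ) (hfi hdT hψ)]
  simp only [← map_add]
  refine hle _ hn _ (hρ n) (fun x => deriv S (w n x) • φ x + deriv T (w n x) • ψ x) ?_ ?_ ?_
  · have := hφ.1
    have := hψ.1
    exact ((hdS.comp hwd).smul hφ.1).add ((hdT.comp hwd).smul hψ.1)
  · refine (tsupport_add _ _).trans (union_subset_union ?_ ?_)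
    · exact tsupport_smul_subset_right (fun x => deriv S (w n x)) φ
    · exact tsupport_smul_subset_right (fun x => deriv T (w n x)) ψ
  · intro x
    refine (norm_add_le _ _).trans ?_
    rw [norm_smul, norm_smul, Real.norm_eq_abs, Real.norm_eq_abs]
    calc |deriv S (w n x)| * ‖φ x‖ + |deriv T (w n x)| * ‖ψ x‖
        ≤ |deriv S (w n x)| * 1 + |deriv T (w n x)| * 1 := by
          gcongr
          · exact hφ1 x
          · exact hψ1 x
      _ ≤ 1 := by simpa using hST (w n x)

/-- The modulus does not increase the total variation. -/
lemma pairing_abs_le (hU : IsOpen U) (hu : IntegrableOn u U) (hV : totalVariation U u ≠ ⊤)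
    (hφ : φ ∈ testFields U) (hφ1 : ∀ x, ‖φ x‖ ≤ 1) :
    pairing U (fun x => |u x|) φ ≤ (totalVariation U u).toReal := by
  -- `|t|` is the limit of the smooth functions `√(t² + ε²) - ε`
  set S : ℝ → ℝ → ℝ := fun ε t => √(t ^ 2 + ε ^ 2) - ε with hSdef
  have hle : ∀ n : ℕ, pairing U (fun x => S (1 / ((n : ℝ) + 1)) (u x)) φ
      ≤ (totalVariation U u).toReal := by
    intro n
    set ε : ℝ := 1 / ((n : ℝ) + 1) with hε
    have hε0 : 0 < ε := by positivity
    have hne : ∀ t : ℝ, t ^ 2 + ε ^ 2 ≠ 0 := fun t => by positivity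
    have hcd : ContDiff ℝ 2 (S ε) :=
      ContDiff.sub (ContDiff.sqrt (by fun_prop) hne) contDiff_const
    have hd : ∀ t, deriv (S ε) t = t / √(t ^ 2 + ε ^ 2) := by
      intro t
      have h1 : HasDerivAt (fun t : ℝ => t ^ 2 + ε ^ 2) (2 * t) t := by
        simpa using (hasDerivAt_pow 2 t).add_const (ε ^ 2)
      have h2 := (h1.sqrt (hne t)).sub_const ε
      rw [h2.deriv]
      field_simp
    have h := pairing_comp_add_pairing_comp_le (φ := φ) (ψ := fun _ => 0) hU hu hV hcd
      (contDiff_const (c := (0 : ℝ))) (by simp [hSdef, Real.sqrt_sq hε0.le]) rfl (fun t => ?_)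
      hφ hφ1 zero_mem_testFields (by simp)
    · simpa [pairing] using h
    · rw [hd, abs_div, abs_of_nonneg (Real.sqrt_nonneg _)]
      simp only [deriv_const, abs_zero, add_zero]
      refine div_le_one_of_le₀ (Real.abs_le_sqrt ?_) (Real.sqrt_nonneg _)
      nlinarith [sq_nonneg ε]
  refine le_of_tendsto' (x := atTop)
    (f := fun n : ℕ => pairing U (fun x => S (1 / ((n : ℝ) + 1)) (u x)) φ) ?_ hle
  refine Tendsto.neg ?_
  have hn0 : Tendsto (fun n : ℕ => 1 / ((n : ℝ) + 1)) atTop (𝓝 0) :=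
    tendsto_one_div_add_atTop_nhds_zero_nat
  refine tendsto_integral_of_dominated_convergence (fun x => |u x * divergence φ x|) ?_
    (integrableOn_mul_divergence hu hφ.1 hφ.2.1).abs ?_ ?_
  · intro n
    have : Continuous (S (1 / ((n : ℝ) + 1))) := by fun_prop
    exact (this.comp_aestronglyMeasurable hu.aestronglyMeasurable).mul
      (continuous_divergence hφ.1).aestronglyMeasurable
  · intro n
    refine ae_of_all _ fun x => ?_
    set ε : ℝ := 1 / ((n : ℝ) + 1) with hε
    have hε0 : 0 < ε := by positivity
    rw [norm_mul, abs_mul]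
    refine mul_le_mul_of_nonneg_right ?_ (abs_nonneg _)
    have h1 : ε ≤ √(u x ^ 2 + ε ^ 2) := Real.le_sqrt_of_sq_le (by nlinarith [sq_nonneg (u x)])
    have h2 : √(u x ^ 2 + ε ^ 2) ≤ |u x| + ε := by
      rw [Real.sqrt_le_left (by positivity)]
      nlinarith [sq_abs (u x), mul_nonneg (abs_nonneg (u x)) hε0.le]
    rw [Real.norm_eq_abs, abs_of_nonneg (by simpa [hSdef] using h1)]
    simp only [hSdef]
    linarith
  · refine ae_of_all _ fun x => Tendsto.mul_const _ ?_
    have hc : Continuous fun ε => S ε (u x) := by fun_prop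
    have := (hc.tendsto 0).comp hn0
    simpa [hSdef, Function.comp_def, Real.sqrt_sq_eq_abs] using this

lemma totalVariation_comp_add_totalVariation_comp_le (hU : IsOpen U) (hu : IntegrableOn u U)
    {S T : ℝ → ℝ} (hS : ContDiff ℝ 2 S) (hT : ContDiff ℝ 2 T)
    (hS0 : S 0 = 0) (hT0 : T 0 = 0) (hST : ∀ t, |deriv S t| + |deriv T t| ≤ 1) :
    totalVariation U (fun x => S (u x)) + totalVariation U (fun x => T (u x))
      ≤ totalVariation U u := by
  rcases eq_or_ne (totalVariation U u) ⊤ with hV | hV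
  · simp [hV]
  have key : ∀ φ ∈ testFields U, (∀ x, ‖φ x‖ ≤ 1) → ∀ ψ ∈ testFields U, (∀ x, ‖ψ x‖ ≤ 1) →
      pairing U (fun x => S (u x)) φ + pairing U (fun x => T (u x)) ψ
        ≤ (totalVariation U u).toReal := fun φ hφ hφ1 ψ hψ hψ1 =>
    pairing_comp_add_pairing_comp_le hU hu hV hS hT hS0 hT0 hST hφ hφ1 hψ hψ1
  have hz : ∀ w : Space d → ℝ, pairing U w (fun _ => 0) = 0 := fun w => by
    simp [pairing, divergence]
  refine ENNReal.biSup_add_biSup_le' ⟨_, zero_mem_testFields, by simp⟩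
    ⟨_, zero_mem_testFields, by simp⟩ fun φ hφ ψ hψ => ?_
  change ENNReal.ofReal (pairing U _ φ) + ENNReal.ofReal (pairing U _ ψ) ≤ _
  rcases le_total (pairing U (fun x => S (u x)) φ) 0 with h1 | h1
  · rw [ENNReal.ofReal_of_nonpos h1, zero_add, ENNReal.ofReal_le_iff_le_toReal hV]
    simpa [hz] using key _ zero_mem_testFields (by simp) ψ hψ.1 hψ.2
  rcases le_total (pairing U (fun x => T (u x)) ψ) 0 with h2 | h2
  · rw [ENNReal.ofReal_of_nonpos h2, add_zero, ENNReal.ofReal_le_iff_le_toReal hV]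
    simpa [hz] using key φ hφ.1 hφ.2 _ zero_mem_testFields (by simp)
  rw [← ENNReal.ofReal_add h1 h2, ENNReal.ofReal_le_iff_le_toReal hV]
  exact key φ hφ.1 hφ.2 ψ hψ.1 hψ.2

/-- Bounded functions are dense in `BV(U)`. The approximations are the smooth truncations
`n arctan(u / n)`: the variation splits between a truncation and the remainder, and
semicontinuity forces the remainder to vanish. -/
lemma exists_bounded_approx (hU : IsOpen U) (hu : IntegrableOn u U) (hV : totalVariation U u ≠ ⊤)
    {δ : ℝ} (hδ : 0 < δ) :
    ∃ v : Space d → ℝ, (∃ M, ∀ x, |v x| ≤ M) ∧ IntegrableOn v U ∧ totalVariation U v ≠ ⊤ ∧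
      ∫ x in U, |u x - v x| ≤ δ ∧
      totalVariation U (fun x => u x - v x) ≤ ENNReal.ofReal δ := by
  set T : ℕ → ℝ → ℝ := fun n t => (n + 1) * Real.arctan (t / (n + 1)) with hT
  have hpos : ∀ n : ℕ, (0 : ℝ) < n + 1 := fun n => by positivity
  have hd : ∀ n t, HasDerivAt (T n) (1 / (1 + (t / (n + 1)) ^ 2)) t := by
    intro n t
    have h1 : HasDerivAt (fun t : ℝ => t / ((n : ℝ) + 1)) (1 / ((n : ℝ) + 1)) t :=
      (hasDerivAt_id t).div_const _
    have h2 := (h1.arctan).const_mul ((n : ℝ) + 1)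
    convert! h2 using 1
    field_simp
  have hcd : ∀ n, ContDiff ℝ 2 (T n) := fun n =>
    contDiff_const.mul (Real.contDiff_arctan.comp (contDiff_id.div_const _))
  have hT0 : ∀ n, T n 0 = 0 := fun n => by simp [hT]
  have hd01 : ∀ n t, 0 ≤ deriv (T n) t ∧ deriv (T n) t ≤ 1 := by
    intro n t
    rw [(hd n t).deriv]
    refine ⟨by positivity, ?_⟩
    rw [div_le_one (by positivity)]
    nlinarith [sq_nonneg (t / ((n : ℝ) + 1))]
  have hd1 : ∀ n t, |deriv (T n) t| ≤ 1 := fun n t => by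
    rw [abs_of_nonneg (hd01 n t).1]; exact (hd01 n t).2
  have habs : ∀ n t, |T n t| ≤ |t| := fun n t => by
    simpa [hT0] using lipschitz_of_abs_deriv_le_one ((hcd n).differentiable (by norm_num))
      (hd1 n) t 0
  have hlim : ∀ t, Tendsto (fun n => T n t) atTop (𝓝 t) := by
    intro t
    have h0 : Tendsto (fun n : ℕ => ((n : ℝ) + 1)⁻¹) atTop (𝓝 0) := by
      simpa using tendsto_one_div_add_atTop_nhds_zero_nat (𝕜 := ℝ)
    rcases eq_or_ne t 0 with rfl | ht
    · simp [hT0]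
    have h1 := (Real.hasDerivAt_arctan 0).tendsto_slope_zero
    have h2 : Tendsto (fun n : ℕ => t / ((n : ℝ) + 1)) atTop (𝓝[≠] 0) := by
      refine tendsto_nhdsWithin_iff.2 ⟨by simpa [div_eq_mul_inv] using h0.const_mul t, ?_⟩
      exact Eventually.of_forall fun n => div_ne_zero ht (hpos n).ne'
    have h3 := (h1.comp h2).const_mul t
    simp only [Real.arctan_zero, sub_zero, zero_add] at h3
    convert! h3 using 2 with n
    · simp only [hT, Function.comp, smul_eq_mul]
      field_simp
    · norm_num
  have hTi : ∀ n, IntegrableOn (fun x => T n (u x)) U := fun n =>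
    integrableOn_comp_of_abs_deriv_le_one (hcd n) (hd1 n) (hT0 n) hu
  have hL1 : Tendsto (fun n => ∫ x in U, |u x - T n (u x)|) atTop (𝓝 0) := by
    have h0 : (∫ x in U, (0 : ℝ)) = 0 := by simp
    rw [← h0]
    refine tendsto_integral_of_dominated_convergence (fun x => 2 * |u x|)
      (fun n => (hu.sub (hTi n)).abs.aestronglyMeasurable) (hu.abs.const_mul 2) ?_ ?_
    · refine fun n => ae_of_all _ fun x => ?_
      rw [Real.norm_eq_abs, abs_abs]
      have := abs_sub (u x) (T n (u x))
      linarith [habs n (u x)]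
    · refine ae_of_all _ fun x => ?_
      have := ((hlim (u x)).const_sub (u x)).abs
      simpa using this
  obtain ⟨K, -, -, -, φ, hφ, -, hφ1, hφV⟩ :=
    exists_isCompact_totalVariation_le hU.measurableSet hu hV (half_pos hδ)
  obtain ⟨C, hC0, hC⟩ := exists_bound_divergence hφ.1 hφ.2.1
  have hev := (hL1.const_mul C).eventually_le_const (u := δ / 2) (by simpa using half_pos hδ)
  obtain ⟨n, hn1, hn2⟩ := ((hL1.eventually_le_const hδ).and hev).exists
  have hsplit := totalVariation_comp_add_totalVariation_comp_le (S := T n)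
    (T := fun t => t - T n t) hU hu (hcd n) (contDiff_id.sub (hcd n)) (hT0 n) (by simp [hT0])
    (fun t => by
      have hd' : deriv (fun t => t - T n t) t = 1 - deriv (T n) t :=
        ((hasDerivAt_id t).sub (hd n t).differentiableAt.hasDerivAt).deriv
      rw [hd', abs_of_nonneg (hd01 n t).1, abs_of_nonneg (by linarith [(hd01 n t).2])]
      linarith)
  have hVT : totalVariation U (fun x => T n (u x)) ≠ ⊤ :=
    ((le_self_add.trans hsplit).trans_lt hV.lt_top).ne
  have hVR : totalVariation U (fun x => u x - T n (u x)) ≠ ⊤ :=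
    ((le_add_self.trans hsplit).trans_lt hV.lt_top).ne
  refine ⟨fun x => T n (u x), ⟨(n + 1) * (Real.pi / 2), fun x => ?_⟩, hTi n, hVT, hn1, ?_⟩
  · simp only [hT]
    rw [abs_mul, abs_of_pos (hpos n)]
    exact mul_le_mul_of_nonneg_left (abs_le.2 ⟨(Real.neg_pi_div_two_lt_arctan _).le,
      (Real.arctan_lt_pi_div_two _).le⟩) (hpos n).le
  · have h1 := abs_pairing_sub_le hu (hTi n) hφ.1 hφ.2.1 hC
    have h2 := pairing_le_toReal hVT hφ hφ1
    have h3 := ENNReal.toReal_mono hV hsplit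
    rw [ENNReal.toReal_add hVT hVR] at h3
    rw [← ENNReal.ofReal_toReal hVR]
    refine ENNReal.ofReal_le_ofReal ?_
    have := (abs_le.1 h1).2
    linarith

end Chain

/-! ### The gradient measure -/

lemma exists_contDiff_cutoff {K U : Set (Space d)} (hK : IsCompact K) (hU : IsOpen U)
    (hKU : K ⊆ U) : ∃ χ : Space d → ℝ, ContDiff ℝ 1 χ ∧ HasCompactSupport χ ∧ tsupport χ ⊆ U ∧
      (∀ x, 0 ≤ χ x ∧ χ x ≤ 1) ∧ ∀ x ∈ K, χ x = 1 := by
  obtain ⟨L, hL, hKL, hLU⟩ := exists_compact_between hK hU hKU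
  obtain ⟨f, hf1, hf0, hf⟩ := exists_contMDiffMap_one_nhds_of_subset_interior
    (n := 1) (modelWithCornersSelf ℝ (Space d)) hK.isClosed hKL
  have hsub : tsupport f ⊆ L := closure_minimal
    (fun x hx => by by_contra h; exact hx (hf0 x h)) hL.isClosed
  exact ⟨f, f.contMDiff.contDiff, hL.of_isClosed_subset (isClosed_tsupport _) hsub,
    hsub.trans hLU, fun x => hf x, fun x hx => (hf1.self_of_nhdsSet x hx)⟩

/-- A linear functional bounded through a map to a Hilbert space is represented by a vector. -/
lemma exists_inner_eq_of_le {W X : Type*} [AddCommGroup W] [Module ℝ W]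
    [NormedAddCommGroup X] [InnerProductSpace ℝ X] [CompleteSpace X] (T : W →ₗ[ℝ] ℝ)
    (J : W →ₗ[ℝ] X) (C : ℝ) (h : ∀ w, |T w| ≤ C * ‖J w‖) : ∃ x : X, ∀ w, T w = ⟪x, J w⟫ := by
  obtain ⟨s, hs⟩ := J.rangeRestrict.exists_rightInverse_of_surjective J.range_rangeRestrict
  have hs' : ∀ y : J.range, J (s y) = y := fun y => congrArg Subtype.val (LinearMap.congr_fun hs y)
  have hT : ∀ w, T (s (J.rangeRestrict w)) = T w := by
    intro w
    have h1 := h (s (J.rangeRestrict w) - w)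
    rw [map_sub, map_sub, hs'] at h1
    have h2 : ((J.rangeRestrict w : J.range) : X) = J w := rfl
    rw [h2, sub_self, norm_zero, mul_zero] at h1
    exact sub_eq_zero.1 (abs_nonpos_iff.1 h1)
  let T' : J.range →L[ℝ] ℝ := (T ∘ₗ s).mkContinuous C fun y => by
    have := h (s y)
    rwa [hs'] at this
  obtain ⟨g, hg, -⟩ := exists_extension_norm_eq J.range T'
  refine ⟨(InnerProductSpace.toDual ℝ X).symm g, fun w => ?_⟩
  rw [InnerProductSpace.toDual_symm_apply, ← hT w]
  exact (hg (J.rangeRestrict w)).symm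

/-- A linear functional bounded by the `L¹` norm of a finite measure has a square integrable
density. -/
lemma exists_density_of_le {W F : Type*} [AddCommGroup W] [Module ℝ W]
    [NormedAddCommGroup F] [InnerProductSpace ℝ F] [CompleteSpace F]
    {m : Measure (Space d)} [IsFiniteMeasure m] (T : W →ₗ[ℝ] ℝ)
    (J : W →ₗ[ℝ] (Space d → F)) (hJ : ∀ w, MemLp (J w) 2 m) (C : ℝ) (hC : 0 ≤ C)
    (h : ∀ w, |T w| ≤ C * ∫ x, ‖J w x‖ ∂m) :
    ∃ σ : Space d → F, MemLp σ 2 m ∧ ∀ w, T w = ∫ x, ⟪J w x, σ x⟫ ∂m := by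
  let J' : W →ₗ[ℝ] Lp F 2 m :=
    { toFun := fun w => (hJ w).toLp
      map_add' := fun w w' => by
        rw [← MemLp.toLp_add]
        congr 1
        exact map_add J w w'
      map_smul' := fun c w => by
        rw [RingHom.id_apply, ← MemLp.toLp_const_smul]
        congr 1
        exact map_smul J c w }
  obtain ⟨σ, hσ⟩ := exists_inner_eq_of_le T J' (C * (m univ ^ (1 / 2 : ℝ)).toReal) fun w => by
    refine (h w).trans ?_
    rw [mul_assoc]
    refine mul_le_mul_of_nonneg_left ?_ hC
    have h1 := eLpNorm_le_eLpNorm_mul_rpow_measure_univ (p := 1) (q := 2) (by norm_num)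
      (hJ w).aestronglyMeasurable
    have h2 : ∫ x, ‖J w x‖ ∂m = (eLpNorm (J w) 1 m).toReal := by
      rw [integral_norm_eq_lintegral_enorm (hJ w).aestronglyMeasurable,
        eLpNorm_one_eq_lintegral_enorm]
    have h3 : ‖J' w‖ = (eLpNorm (J w) 2 m).toReal := Lp.norm_toLp _ (hJ w)
    rw [h2, h3, mul_comm, ← ENNReal.toReal_mul]
    refine ENNReal.toReal_mono (ENNReal.mul_ne_top (hJ w).eLpNorm_ne_top
      (ENNReal.rpow_ne_top_of_nonneg (by norm_num) (measure_ne_top _ _))) (h1.trans_eq ?_)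
    norm_num
  refine ⟨σ, Lp.memLp σ, fun w => ?_⟩
  rw [hσ, L2.inner_def]
  refine integral_congr_ae ?_
  filter_upwards [(hJ w).coeFn_toLp] with x hx
  change ⟪σ x, ((hJ w).toLp : Space d → F) x⟫ = _
  rw [hx, real_inner_comm]

lemma exists_isCompact_exhaustion {Ω : Set (Space d)} (hΩ : IsOpen Ω) :
    ∃ K : ℕ → Set (Space d), (∀ n, IsCompact (K n)) ∧ (∀ n, K n ⊆ Ω) ∧
      ∀ L ⊆ Ω, IsCompact L → ∀ᶠ n in atTop, L ⊆ K n := by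
  have : LocallyCompactSpace Ω := hΩ.locallyCompactSpace
  have K := CompactExhaustion.choice Ω
  refine ⟨fun n => Subtype.val '' K n, fun n => (K.isCompact n).image continuous_subtype_val,
    fun n => by simp, fun L hL hLc => ?_⟩
  have hc : IsCompact (Subtype.val ⁻¹' L : Set Ω) :=
    Topology.IsEmbedding.subtypeVal.isCompact_preimage_iff (by simpa using hL) |>.2 hLc
  obtain ⟨n, hn⟩ := K.exists_superset_of_isCompact hc
  filter_upwards [eventually_ge_atTop n] with m hm
  intro x hx
  exact ⟨⟨x, hL hx⟩, K.subset hm (hn hx), rfl⟩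

/-- On compact subsets of `Ω` the gradients of fine mollifications of `u` have integral at most the
total variation of `u`. -/
lemma setIntegral_norm_fderiv_mollify_le {Ω : Set (Space d)} {u : Space d → ℝ} (hΩ : IsOpen Ω)
    (hu : IntegrableOn u Ω) (hV : totalVariation Ω u ≠ ⊤) {K : Set (Space d)} (hK : IsCompact K)
    (hKΩ : K ⊆ Ω) : ∃ ε₀ > 0, ∀ ε ≤ ε₀, ∀ ρ : Space d → ℝ, IsMollifier ρ ε →
      ∫ x in K, ‖fderiv ℝ (mollify ρ (Ω.indicator u)) x‖ ≤ (totalVariation Ω u).toReal := by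
  obtain ⟨χ, hχ, hχc, hχΩ, hχ01, hχ1⟩ := exists_contDiff_cutoff hK hΩ hKΩ
  obtain ⟨ε₀, hε₀, h⟩ := integral_fderiv_mollify_le hΩ hu hV hχc hχΩ
  refine ⟨ε₀, hε₀, fun ε hε ρ hρ => ?_⟩
  have hui : Integrable (Ω.indicator u) := (integrable_indicator_iff hΩ.measurableSet).2 hu
  set w := mollify ρ (Ω.indicator u) with hw
  have hwd : ContDiff ℝ 2 w := hρ.contDiff_mollify hui.locallyIntegrable
  have hdw : ContDiff ℝ 1 (fderiv ℝ w) := hwd.fderiv_right (by norm_num)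
  set G : Space d → Space d := fun x => (InnerProductSpace.toDual ℝ (Space d)).symm (fderiv ℝ w x)
    with hG
  have hGd : ContDiff ℝ 1 G :=
    (InnerProductSpace.toDual ℝ (Space d)).symm.toContinuousLinearEquiv.contDiff.comp hdw
  have hGn : ∀ x, ‖G x‖ = ‖fderiv ℝ w x‖ := fun x => by simp [hG]
  have hGi : ∀ x v, fderiv ℝ w x v = ⟪G x, v⟫ := fun x v => by
    simp [hG]
  -- the regularized direction field `G / √(|G|² + τ²)` almost attains the integral of `|G|`
  have key : ∀ τ : ℝ, 0 < τ → (∫ x in K, ‖G x‖) - τ * volume.real K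
      ≤ (totalVariation Ω u).toReal := by
    intro τ hτ
    have hpos : ∀ x, 0 < ‖G x‖ ^ 2 + τ ^ 2 := fun x => by positivity
    set f : Space d → ℝ := fun x => χ x * (√(‖G x‖ ^ 2 + τ ^ 2))⁻¹ with hf
    have hfd : ContDiff ℝ 1 f := hχ.mul
      (ContDiff.inv (ContDiff.sqrt ((hGd.norm_sq ℝ).add contDiff_const) fun x => (hpos x).ne')
        fun x => (Real.sqrt_pos.2 (hpos x)).ne')
    have hfs : tsupport (fun x => f x • G x) ⊆ tsupport χ :=
      (tsupport_smul_subset_left f G).trans (tsupport_mul_subset_left)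
    have hle := h ε hε ρ hρ (fun x => f x • G x) (hfd.smul hGd) hfs fun x => by
      rw [norm_smul, hf, norm_mul, norm_inv, Real.norm_of_nonneg (hχ01 x).1,
        Real.norm_of_nonneg (Real.sqrt_nonneg _), mul_assoc]
      refine mul_le_one₀ (hχ01 x).2 (by positivity) ?_
      rw [inv_mul_le_one₀ (Real.sqrt_pos.2 (hpos x))]
      exact Real.le_sqrt_of_sq_le (by nlinarith [sq_nonneg τ])
    refine le_trans ?_ hle
    have hci : Continuous fun x => fderiv ℝ w x (f x • G x) := by
      have h1 := hdw.continuous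
      have h2 := hfd.continuous
      have h3 := hGd.continuous
      fun_prop
    have hcs : HasCompactSupport fun x => fderiv ℝ w x (f x • G x) := by
      refine HasCompactSupport.of_support_subset_isCompact hχc fun x hx => ?_
      by_contra h0
      exact hx (by simp [hf, image_eq_zero_of_notMem_tsupport h0])
    have hval : ∀ x, fderiv ℝ w x (f x • G x) = χ x * (‖G x‖ ^ 2 * (√(‖G x‖ ^ 2 + τ ^ 2))⁻¹) := by
      intro x
      rw [hGi, inner_smul_right, real_inner_self_eq_norm_sq, hf]
      ring
    calc (∫ x in K, ‖G x‖) - τ * volume.real K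
        = ∫ x in K, (‖G x‖ - τ) := by
          rw [integral_sub (hGd.continuous.norm.continuousOn.integrableOn_compact hK)
            (integrableOn_const hK.measure_lt_top.ne), setIntegral_const, smul_eq_mul, mul_comm]
      _ ≤ ∫ x in K, fderiv ℝ w x (f x • G x) := by
          refine setIntegral_mono_on
            ((hGd.continuous.norm.sub continuous_const).continuousOn.integrableOn_compact hK)
            (hci.continuousOn.integrableOn_compact hK) hK.measurableSet fun x hx => ?_
          rw [hval, hχ1 x hx, one_mul, ← div_eq_mul_inv, le_div_iff₀ (Real.sqrt_pos.2 (hpos x))]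
          have h1 : ‖G x‖ ≤ √(‖G x‖ ^ 2 + τ ^ 2) :=
            Real.le_sqrt_of_sq_le (by nlinarith [sq_nonneg τ])
          have h2 := Real.sq_sqrt (hpos x).le
          have h3 : √(‖G x‖ ^ 2 + τ ^ 2) ≤ ‖G x‖ + τ := by
            rw [Real.sqrt_le_left (by positivity)]
            nlinarith [mul_nonneg (norm_nonneg (G x)) hτ.le]
          rcases le_total ‖G x‖ τ with h4 | h4
          · exact (mul_nonpos_of_nonpos_of_nonneg (by linarith) (Real.sqrt_nonneg _)).trans
              (sq_nonneg _)
          · nlinarith [mul_nonneg (sub_nonneg.2 h4) (sub_nonneg.2 h3), sq_nonneg τ]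
      _ ≤ ∫ x, fderiv ℝ w x (f x • G x) := by
          refine setIntegral_le_integral (hci.integrable_of_hasCompactSupport hcs)
            (ae_of_all _ fun x => ?_)
          change 0 ≤ fderiv ℝ w x (f x • G x)
          rw [hval]
          have := (hχ01 x).1
          positivity
  have hlim : Tendsto (fun τ : ℝ => (∫ x in K, ‖G x‖) - τ * volume.real K) (𝓝[>] 0)
      (𝓝 ((∫ x in K, ‖G x‖) - 0 * volume.real K)) := by
    refine Tendsto.mono_left ?_ nhdsWithin_le_nhds
    exact (continuous_const.sub (continuous_id.mul continuous_const)).tendsto 0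
  have := le_of_tendsto hlim (eventually_mem_nhdsWithin.mono fun τ hτ => key τ hτ)
  simpa [hGn] using this

open CompactlySupported in
/-- The gradient of a function of bounded variation is dominated by a finite measure: the
limit, along an ultrafilter, of the measures `|∇(ρₙ * u)| dx` on an exhaustion of `Ω`. -/
lemma exists_measure_pairing_le {Ω : Set (Space d)} {u : Space d → ℝ} (hΩ : IsOpen Ω)
    (hu : IntegrableOn u Ω) (hV : totalVariation Ω u ≠ ⊤) :
    ∃ μ : Measure (Space d), IsFiniteMeasure μ ∧
      ∀ φ ∈ testFields Ω, pairing Ω u φ ≤ ∫ x, ‖φ x‖ ∂μ := by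
  have hui : Integrable (Ω.indicator u) := (integrable_indicator_iff hΩ.measurableSet).2 hu
  obtain ⟨K, hKc, hKΩ, hKL⟩ := exists_isCompact_exhaustion hΩ
  have hex : ∀ n : ℕ, ∃ ρ : Space d → ℝ, (∃ ε, IsMollifier ρ ε) ∧
      (∫ x in K n, ‖fderiv ℝ (mollify ρ (Ω.indicator u)) x‖ ≤ (totalVariation Ω u).toReal) ∧
      ∫ x, |mollify ρ (Ω.indicator u) x - Ω.indicator u x| ≤ 1 / ((n : ℝ) + 1) := by
    intro n
    obtain ⟨ε₀, hε₀, h1⟩ := setIntegral_norm_fderiv_mollify_le hΩ hu hV (hKc n) (hKΩ n)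
    obtain ⟨ε₁, hε₁, h2⟩ := exists_integral_abs_mollify_sub_le hui
      (η := 1 / ((n : ℝ) + 1)) (by positivity)
    obtain ⟨ρ, hρ⟩ := exists_isMollifier (d := d) (lt_min hε₀ hε₁)
    exact ⟨ρ, ⟨_, hρ⟩, h1 _ (min_le_left _ _) ρ hρ, h2 _ (min_le_right _ _) ρ hρ⟩
  choose ρ hρ hρV hρ1 using hex
  set w : ℕ → Space d → ℝ := fun n => mollify (ρ n) (Ω.indicator u) with hw
  have hwd : ∀ n, ContDiff ℝ 1 (w n) := fun n => by
    obtain ⟨ε, h⟩ := hρ n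
    exact (h.contDiff_mollify hui.locallyIntegrable).of_le (by norm_num)
  have hwi : ∀ n, Integrable (w n) := fun n => by
    obtain ⟨ε, h⟩ := hρ n
    exact h.integrable_mollify hui
  have hcd : ∀ n, Continuous fun x => ‖fderiv ℝ (w n) x‖ := fun n =>
    ((hwd n).continuous_fderiv (by norm_num)).norm
  have hlim : Tendsto (fun n => ∫ x, |w n x - Ω.indicator u x|) atTop (𝓝 0) :=
    squeeze_zero (fun n => integral_nonneg fun x => abs_nonneg _) hρ1
      tendsto_one_div_add_atTop_nhds_zero_nat
  set a : ℕ → (Space d → ℝ) → ℝ := fun n f => ∫ x in K n, f x * ‖fderiv ℝ (w n) x‖ with ha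
  have hai : ∀ n {f : Space d → ℝ}, Continuous f →
      IntegrableOn (fun x => f x * ‖fderiv ℝ (w n) x‖) (K n) := fun n f hf =>
    (hf.mul (hcd n)).continuousOn.integrableOn_compact (hKc n)
  have habs : ∀ n {f : Space d → ℝ}, Continuous f → ∀ {C : ℝ}, (∀ x, |f x| ≤ C) →
      |a n f| ≤ C * (totalVariation Ω u).toReal := by
    intro n f hf C hC
    have hC0 : 0 ≤ C := (abs_nonneg _).trans (hC 0)
    refine le_trans ?_ (mul_le_mul_of_nonneg_left (hρV n) hC0)
    rw [← integral_const_mul]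
    refine norm_integral_le_of_norm_le (μ := volume.restrict (K n))
      (f := fun x => f x * ‖fderiv ℝ (w n) x‖)
      (((hcd n).continuousOn.integrableOn_compact (hKc n)).const_mul C) (ae_of_all _ fun x => ?_)
    rw [norm_mul, norm_norm]
    exact mul_le_mul_of_nonneg_right (hC x) (norm_nonneg _)
  let 𝒰 : Ultrafilter ℕ := hyperfilter ℕ
  have h𝒰 : (𝒰 : Filter ℕ) ≤ atTop := by
    rw [← Nat.cofinite_eq_atTop]; exact hyperfilter_le_cofinite
  have hconv : ∀ f : C_c(Space d, ℝ), ∃ l, Tendsto (fun n => a n f) 𝒰 (𝓝 l) := by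
    intro f
    obtain ⟨C, hC⟩ := f.hasCompactSupport.exists_bound_of_continuous f.continuous
    have hcpt := (isCompact_Icc (a := -(C * (totalVariation Ω u).toReal))
      (b := C * (totalVariation Ω u).toReal)).ultrafilter_le_nhds (𝒰.map fun n => a n f) (by
        rw [le_principal_iff]
        exact Eventually.of_forall (f := (𝒰 : Filter ℕ))
          fun n => abs_le.1 (habs n f.continuous hC))
    obtain ⟨l, -, hl⟩ := hcpt
    exact ⟨l, hl⟩
  choose Λ₀ hΛ₀ using hconv
  let Λ₁ : C_c(Space d, ℝ) →ₗ[ℝ] ℝ :=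
    { toFun := Λ₀
      map_add' := fun f g => by
        refine tendsto_nhds_unique (hΛ₀ (f + g)) (((hΛ₀ f).add (hΛ₀ g)).congr fun n => ?_)
        simp only [ha]
        rw [← integral_add (hai n (f := ⇑f) (map_continuous f))
        (hai n (f := ⇑g) (map_continuous g))]
        simp [add_mul]
      map_smul' := fun c f => by
        refine tendsto_nhds_unique (hΛ₀ (c • f)) (((hΛ₀ f).const_mul c).congr fun n => ?_)
        simp only [ha]
        rw [← integral_const_mul]
        simp [mul_assoc] }
  let Λ : C_c(Space d, ℝ) →ₚ[ℝ] ℝ := PositiveLinearMap.mk₀ Λ₁ fun f hf =>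
    ge_of_tendsto' (hΛ₀ f) fun n => integral_nonneg fun x =>
      mul_nonneg (hf x) (norm_nonneg _)
  have hΛ : ∀ f : C_c(Space d, ℝ), Tendsto (fun n => a n f) 𝒰 (𝓝 (Λ f)) := hΛ₀
  refine ⟨RealRMK.rieszMeasure Λ, ⟨?_⟩, fun φ hφ => ?_⟩
  · refine lt_of_le_of_lt ?_ (ENNReal.ofReal_lt_top (r := (totalVariation Ω u).toReal))
    have hmono : Monotone fun n : ℕ => Metric.closedBall (0 : Space d) n := fun m n hmn =>
      Metric.closedBall_subset_closedBall (by exact_mod_cast hmn)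
    rw [← Metric.iUnion_closedBall_nat (0 : Space d), hmono.measure_iUnion]
    refine iSup_le fun n => ?_
    obtain ⟨χ, hχ, hχc, -, hχ01, hχ1⟩ := exists_contDiff_cutoff
      (isCompact_closedBall (0 : Space d) n) isOpen_univ (subset_univ _)
    let f : C_c(Space d, ℝ) := ⟨⟨χ, hχ.continuous⟩, hχc⟩
    refine (RealRMK.rieszMeasure_le_of_eq_one Λ (f := f) (fun x => (hχ01 x).1)
      (isCompact_closedBall _ _) hχ1).trans (ENNReal.ofReal_le_ofReal ?_)
    refine le_of_tendsto' (hΛ f) fun m => ?_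
    have := habs m (f := χ) hχ.continuous (C := 1) fun x => by
      rw [abs_of_nonneg (hχ01 x).1]; exact (hχ01 x).2
    rw [one_mul] at this
    exact (le_abs_self _).trans this
  · let f : C_c(Space d, ℝ) := ⟨⟨fun x => ‖φ x‖, hφ.1.continuous.norm⟩, hφ.2.1.norm⟩
    have h1 : ∫ x, ‖φ x‖ ∂(RealRMK.rieszMeasure Λ) = Λ f := RealRMK.integral_rieszMeasure Λ f
    rw [h1]
    have h2 := (tendsto_integral_comp_mul_divergence hΩ hu (S := fun t => t) contDiff_id
      (by simp) rfl hφ hwi hlim).mono_left h𝒰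
    refine le_of_tendsto_of_tendsto h2 (hΛ f) ?_
    filter_upwards [h𝒰 (hKL _ hφ.2.2 hφ.2.1)] with n hn
    rw [integral_mul_divergence (hwd n) hφ.1 hφ.2.1, neg_neg]
    have h3 : ∫ x, fderiv ℝ (w n) x (φ x) = ∫ x in K n, fderiv ℝ (w n) x (φ x) := by
      rw [setIntegral_eq_integral_of_forall_compl_eq_zero]
      intro x hx
      rw [image_eq_zero_of_notMem_tsupport fun h => hx (hn h), map_zero]
    rw [h3]
    have hc1 : Continuous fun x => fderiv ℝ (w n) x (φ x) := by
      have h1 := (hwd n).continuous_fderiv (by norm_num)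
      have h2 := hφ.1.continuous
      fun_prop
    refine integral_mono (hc1.continuousOn.integrableOn_compact (hKc n))
      (hai n (f := fun x => ‖φ x‖) hφ.1.continuous.norm) fun x => ?_
    refine (le_abs_self _).trans (((fderiv ℝ (w n) x).le_opNorm _).trans_eq (mul_comm _ _))

/-- The real vector space of test fields. -/
def testSubmodule (Ω : Set (Space d)) : Submodule ℝ (Space d → Space d) where
  carrier := testFields Ω
  add_mem' := testFields_add
  zero_mem' := zero_mem_testFields
  smul_mem' c _ hφ := testFields_const_smul c hφ

lemma memLp_of_mem_testFields {Ω : Set (Space d)} {φ : Space d → Space d} (hφ : φ ∈ testFields Ω)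
    (p : ℝ≥0∞) (μ : Measure (Space d)) [IsFiniteMeasureOnCompacts μ] : MemLp φ p μ :=
  hφ.1.continuous.memLp_of_hasCompactSupport hφ.2.1

/-- The polar decomposition of the distributional gradient. The direction is obtained by normalizing
a square integrable density of the gradient with respect to a dominating measure. -/
theorem exists_isGradientMeasure {Ω : Set (Space d)} {u : Space d → ℝ} (hΩ : IsOpen Ω)
    (hu : IntegrableOn u Ω) (hV : totalVariation Ω u ≠ ⊤) :
    ∃ μ σ, IsGradientMeasure Ω u μ σ := by
  obtain ⟨μ, hμ, hle⟩ := exists_measure_pairing_le hΩ hu hV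
  set m := μ.restrict Ω with hm
  have hint : ∀ φ ∈ testFields Ω, ∫ x, ‖φ x‖ ∂μ = ∫ x, ‖φ x‖ ∂m := by
    intro φ hφ
    rw [hm, setIntegral_eq_integral_of_forall_compl_eq_zero]
    intro x hx
    rw [image_eq_zero_of_notMem_tsupport fun h => hx (hφ.2.2 h), norm_zero]
  let T : testSubmodule Ω →ₗ[ℝ] ℝ :=
    { toFun := fun φ => pairing Ω u φ.1
      map_add' := fun φ ψ => pairing_add_right hu φ.2 ψ.2
      map_smul' := fun c φ => pairing_const_smul_right c φ.2.1 }
  obtain ⟨σ₀, hσ₀, hrep⟩ := exists_density_of_le (m := m) T (testSubmodule Ω).subtype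
    (fun φ => memLp_of_mem_testFields φ.2 2 m) 1 zero_le_one fun φ => by
      rw [one_mul]
      change |pairing Ω u φ.1| ≤ ∫ x, ‖φ.1 x‖ ∂m
      rw [← hint _ φ.2, abs_le']
      refine ⟨hle _ φ.2, ?_⟩
      rw [← pairing_neg_right]
      simpa using hle _ (testFields_neg φ.2)
  have hrep' : ∀ φ ∈ testFields Ω, pairing Ω u φ = ∫ x, ⟪φ x, σ₀ x⟫ ∂m :=
    fun φ hφ => hrep ⟨φ, hφ⟩
  have hσm : AEMeasurable (fun x => ‖σ₀ x‖₊) m := hσ₀.aestronglyMeasurable.nnnorm.aemeasurable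
  -- normalize the density
  refine ⟨m.withDensity fun x => (‖σ₀ x‖₊ : ℝ≥0∞), fun x => ‖σ₀ x‖⁻¹ • σ₀ x, ?_, ?_, ?_, ?_, ?_⟩
  · exact isFiniteMeasure_withDensity (hσ₀.integrable (by norm_num)).2.ne
  · exact (withDensity_absolutelyContinuous _ _)
      (by simp [hm, Measure.restrict_apply_eq_zero' hΩ.measurableSet])
  · exact ((hσ₀.aestronglyMeasurable.norm.inv₀).smul hσ₀.aestronglyMeasurable).mono_ac
      (withDensity_absolutelyContinuous _ _)
  · rw [ae_withDensity_iff' hσm.coe_nnreal_ennreal]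
    refine ae_of_all _ fun x hx => ?_
    have : ‖σ₀ x‖ ≠ 0 := by simpa using hx
    rw [norm_smul, norm_inv, norm_norm, inv_mul_cancel₀ this]
  · intro φ hφ
    rw [integral_withDensity_eq_integral_smul₀ hσm, ← neg_eq_iff_eq_neg]
    refine (hrep' φ hφ).trans (integral_congr_ae (ae_of_all _ fun x => ?_))
    simp only [NNReal.smul_def, coe_nnnorm, smul_eq_mul, inner_smul_right]
    rcases eq_or_ne ‖σ₀ x‖ 0 with h0 | h0
    · rw [norm_eq_zero] at h0
      simp [h0]
    · rw [mul_inv_cancel_left₀ h0]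

/-! ### The outer normal -/

/-- Near `x`, the boundary of `Ω` lies between the two paraboloids of curvature `K` tangent to the
hyperplane orthogonal to `n`. -/
def IsParabolicNormal (Ω : Set (Space d)) (r K : ℝ) (x n : Space d) : Prop :=
  ‖n‖ = 1 ∧ ∀ z : Space d, ‖z‖ < r →
    (K * ‖z‖ ^ 2 < ⟪z, n⟫ → x + z ∉ Ω) ∧ (⟪z, n⟫ < -(K * ‖z‖ ^ 2) → x + z ∈ Ω)

lemma IsParabolicNormal.isOuterNormal {Ω : Set (Space d)} {r K : ℝ} {x n : Space d}
    (hr : 0 < r) (hK : 0 < K) (h : IsParabolicNormal Ω r K x n) : IsOuterNormal Ω x n := by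
  refine ⟨h.1, fun ε hε => ?_⟩
  filter_upwards [Metric.ball_mem_nhds x (lt_min hr (div_pos hε hK))] with y hy
  rw [Metric.mem_ball, dist_eq_norm, lt_min_iff, lt_div_iff₀ hK] at hy
  have h1 := h.2 (y - x) hy.1
  rw [add_sub_cancel] at h1
  have h2 : K * ‖y - x‖ ^ 2 ≤ ε * ‖y - x‖ := by
    nlinarith [mul_le_mul_of_nonneg_right hy.2.le (norm_nonneg (y - x))]
  exact ⟨fun h3 => h1.1 (h2.trans_lt h3), fun h3 => h1.2 (h3.trans_le (neg_le_neg h2))⟩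

lemma IsOuterNormal.unique {Ω : Set (Space d)} {x n n' : Space d}
    (h : IsOuterNormal Ω x n) (h' : IsOuterNormal Ω x n') : n = n' := by
  by_contra hne
  set v := n - n' with hv
  have hv0 : 0 < ‖v‖ := norm_pos_iff.2 (sub_ne_zero.2 hne)
  have hvn : ⟪v, n⟫ = ‖v‖ ^ 2 / 2 := by
    have h1 : ‖v‖ ^ 2 = ‖n‖ ^ 2 - 2 * ⟪n, n'⟫ + ‖n'‖ ^ 2 := norm_sub_sq_real n n'
    rw [h.1, h'.1] at h1
    rw [hv, inner_sub_left, real_inner_self_eq_norm_sq, h.1, real_inner_comm]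
    linarith
  have hvn' : ⟪v, n'⟫ = -(‖v‖ ^ 2 / 2) := by
    have h1 : ‖v‖ ^ 2 = ‖n‖ ^ 2 - 2 * ⟪n, n'⟫ + ‖n'‖ ^ 2 := norm_sub_sq_real n n'
    rw [h.1, h'.1] at h1
    rw [hv, inner_sub_left, real_inner_self_eq_norm_sq, h'.1]
    linarith
  have hε : 0 < ‖v‖ / 4 := by positivity
  have hev := (h.2 _ hε).and (h'.2 _ hε)
  have hc : Tendsto (fun t : ℝ => x + t • v) (𝓝[>] 0) (𝓝 x) := by
    refine Tendsto.mono_left ?_ nhdsWithin_le_nhds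
    have : Continuous fun t : ℝ => x + t • v := by fun_prop
    simpa using this.tendsto 0
  obtain ⟨t, ht, ht0⟩ := ((hc.eventually hev).and eventually_mem_nhdsWithin).exists
  have ht0 : 0 < t := ht0
  simp only [add_sub_cancel_left, inner_smul_left, norm_smul, Real.norm_of_nonneg ht0.le,
    hvn, hvn', RCLike.conj_to_real] at ht
  have h3 : ‖v‖ / 4 * (t * ‖v‖) < t * (‖v‖ ^ 2 / 2) := by
    nlinarith [mul_pos ht0 (pow_pos hv0 2)]
  exact ht.1.1 h3 (ht.2.2 (by linarith))

lemma IsOuterNormal.outerNormal_eq {Ω : Set (Space d)} {x n : Space d}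
    (h : IsOuterNormal Ω x n) : outerNormal Ω x = n := by
  have hex : ∃ n, IsOuterNormal Ω x n := ⟨n, h⟩
  rw [outerNormal, dif_pos hex]
  exact hex.choose_spec.unique h

section Chart

variable {F : Type*} [NormedAddCommGroup F] [NormedSpace ℝ F] {h : F → ℝ} {a K : ℝ}

lemma norm_fderiv_le_of_iteratedFDeriv
    (hb : ∀ k : ℕ, k ≤ 2 → ∀ y ∈ Metric.ball (0 : F) a, ‖iteratedFDeriv ℝ k h y‖ ≤ K) {y : F}
    (hy : y ∈ Metric.ball 0 a) : ‖fderiv ℝ h y‖ ≤ K := by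
  have := hb 1 (by norm_num) y hy
  rwa [norm_iteratedFDeriv_one] at this

lemma norm_fderiv_le_mul_norm (hh : ContDiffOn ℝ 2 h (Metric.ball 0 a)) (hd0 : fderiv ℝ h 0 = 0)
    (hb : ∀ k : ℕ, k ≤ 2 → ∀ y ∈ Metric.ball (0 : F) a, ‖iteratedFDeriv ℝ k h y‖ ≤ K) {y : F}
    (hy : y ∈ Metric.ball 0 a) : ‖fderiv ℝ h y‖ ≤ K * ‖y‖ := by
  have h0 : (0 : F) ∈ Metric.ball (0 : F) a :=
    Metric.mem_ball_self ((norm_nonneg y).trans_lt (mem_ball_zero_iff.1 hy))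
  have hdiff : ∀ z ∈ Metric.ball (0 : F) a, DifferentiableAt ℝ (fderiv ℝ h) z := fun z hz =>
    ((hh.contDiffAt (Metric.isOpen_ball.mem_nhds hz)).fderiv_right (m := 1)
      (by norm_num)).differentiableAt (by norm_num)
  have := (convex_ball (0 : F) a).norm_image_sub_le_of_norm_fderiv_le (𝕜 := ℝ) hdiff
    (C := K) (fun z hz => ?_) h0 hy
  · simpa [hd0] using this
  · have := hb 2 le_rfl z hz
    rwa [← norm_iteratedFDeriv_fderiv, norm_iteratedFDeriv_one] at this

lemma abs_sub_le_of_iteratedFDeriv (hh : ContDiffOn ℝ 2 h (Metric.ball 0 a))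
    (hb : ∀ k : ℕ, k ≤ 2 → ∀ y ∈ Metric.ball (0 : F) a, ‖iteratedFDeriv ℝ k h y‖ ≤ K) {y y' : F}
    (hy : y ∈ Metric.ball 0 a) (hy' : y' ∈ Metric.ball 0 a) : |h y - h y'| ≤ K * ‖y - y'‖ :=
  (convex_ball (0 : F) a).norm_image_sub_le_of_norm_fderiv_le (𝕜 := ℝ)
    (fun z hz => (hh.contDiffAt (Metric.isOpen_ball.mem_nhds hz)).differentiableAt (by norm_num))
    (fun _ hz => norm_fderiv_le_of_iteratedFDeriv hb hz) hy' hy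

lemma abs_le_mul_norm_sq (hh : ContDiffOn ℝ 2 h (Metric.ball 0 a)) (h0 : h 0 = 0)
    (hd0 : fderiv ℝ h 0 = 0) (hK : 0 ≤ K)
    (hb : ∀ k : ℕ, k ≤ 2 → ∀ y ∈ Metric.ball (0 : F) a, ‖iteratedFDeriv ℝ k h y‖ ≤ K) {y : F}
    (hy : y ∈ Metric.ball 0 a) : |h y| ≤ K * ‖y‖ ^ 2 := by
  have hsub : ∀ z ∈ Metric.closedBall (0 : F) ‖y‖, z ∈ Metric.ball (0 : F) a := fun z hz =>
    mem_ball_zero_iff.2 ((mem_closedBall_zero_iff.1 hz).trans_lt (mem_ball_zero_iff.1 hy))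
  have := (convex_closedBall (0 : F) ‖y‖).norm_image_sub_le_of_norm_fderiv_le (𝕜 := ℝ) (f := h)
    (C := K * ‖y‖) (x := 0) (y := y)
    (fun z hz => (hh.contDiffAt (Metric.isOpen_ball.mem_nhds (hsub z hz))).differentiableAt
      (by norm_num))
    (fun z hz => (norm_fderiv_le_mul_norm hh hd0 hb (hsub z hz)).trans
      (mul_le_mul_of_nonneg_left (mem_closedBall_zero_iff.1 hz) hK))
    (Metric.mem_closedBall_self (norm_nonneg y)) (by simp)
  rw [h0, sub_zero, sub_zero, Real.norm_eq_abs] at this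
  calc |h y| ≤ K * ‖y‖ * ‖y‖ := this
    _ = K * ‖y‖ ^ 2 := by ring

end Chart

/-- The orthogonal decomposition along a unit vector. -/
lemma exists_orthogonal_add_smul {e : Space d} (he : ‖e‖ = 1) (z : Space d) :
    ∃ y : (ℝ ∙ e)ᗮ, z = (y : Space d) + ⟪z, e⟫ • e ∧ ‖y‖ ≤ ‖z‖ := by
  have hmem : z - ⟪z, e⟫ • e ∈ (ℝ ∙ e)ᗮ := by
    rw [Submodule.mem_orthogonal_singleton_iff_inner_right, inner_sub_right, inner_smul_right,
      real_inner_self_eq_norm_sq, he, real_inner_comm]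
    ring
  refine ⟨⟨z - ⟪z, e⟫ • e, hmem⟩, by simp, ?_⟩
  rw [Submodule.coe_norm, ← sq_le_sq₀ (norm_nonneg _) (norm_nonneg _), norm_sub_sq_real,
    inner_smul_right, norm_smul, he, mul_one, Real.norm_eq_abs, sq_abs]
  nlinarith [sq_nonneg ⟪z, e⟫]

/-- In a chart at `x` with axis `e`, the bound `|h(y)| ≤ K |y|²` on the graph gives the tangent
paraboloids, with outer normal `-e`. -/
lemma IsUniformlyC2Domain.exists_isParabolicNormal {Ω : Set (Space d)}
    (hΩ : IsUniformlyC2Domain Ω) : ∃ r K : ℝ, 0 < r ∧ 0 < K ∧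
      ∀ x ∈ frontier Ω, IsParabolicNormal Ω r K x (outerNormal Ω x) := by
  obtain ⟨a, b, K, ha, hb, hK, hch⟩ := hΩ.exists_chart
  set r := min a (min 1 (b / (1 + K))) with hr
  have hr0 : 0 < r := by positivity
  refine ⟨r, K, hr0, hK, fun x hx => ?_⟩
  obtain ⟨e, he, h, hh, h0, hd0, hbd, hg⟩ := hch x hx
  have key : IsParabolicNormal Ω r K x (-e) := by
    refine ⟨by rwa [norm_neg], fun z hz => ?_⟩
    obtain ⟨y, hy, hyz⟩ := exists_orthogonal_add_smul he z
    rw [hr, lt_min_iff, lt_min_iff, lt_div_iff₀ (by positivity)] at hz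
    have hya : ‖y‖ < a := hyz.trans_lt hz.1
    have hhy := abs_le_mul_norm_sq hh h0 hd0 hK.le hbd (mem_ball_zero_iff.2 hya)
    have hhz : |h y| ≤ K * ‖z‖ ^ 2 := hhy.trans (by gcongr)
    have hs : |⟪z, e⟫| ≤ ‖z‖ := by simpa [he] using abs_real_inner_le_norm z e
    have hsb : |⟪z, e⟫ - h y| < b := by
      refine (abs_sub _ _).trans_lt ?_
      nlinarith [mul_nonneg hK.le (mul_nonneg (norm_nonneg z) (sub_nonneg.2 hz.2.1.le))]
    have h1 := (hg y ⟪z, e⟫ hya hsb).1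
    rw [add_assoc, ← hy] at h1
    rw [h1, inner_neg_right]
    have := abs_le.1 hhz
    exact ⟨fun h2 => by linarith, fun h2 => by linarith⟩
  rwa [(key.isOuterNormal hr0 hK).outerNormal_eq]

/-- A two-sided paraboloid condition forces the normal to be Lipschitz: if the normals at two
points of the boundary were too different, a point between them would lie on both sides. -/
lemma norm_normal_sub_le {Ω : Set (Space d)} (hΩ : IsOpen Ω) {r K : ℝ} (hK : 0 < K)
    {x x' n n' : Space d} (hx : x ∈ frontier Ω)
    (hn : IsParabolicNormal Ω r K x n) (hn' : IsParabolicNormal Ω r K x' n')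
    (hr : 2 * ‖x - x'‖ < r) (hne : x ≠ x') : ‖n - n'‖ ≤ 10 * K * ‖x - x'‖ := by
  by_contra! hlt
  set t := ‖x - x'‖ with ht
  have ht0 : 0 < t := norm_pos_iff.2 (sub_ne_zero.2 hne)
  set κ := ‖n - n'‖ with hκ
  have hκ0 : 0 < κ := lt_trans (by positivity) hlt
  set m : Space d := κ⁻¹ • (n' - n) with hm
  have hsq : κ ^ 2 = 2 - 2 * ⟪n, n'⟫ := by
    have h1 : κ ^ 2 = ‖n‖ ^ 2 - 2 * ⟪n, n'⟫ + ‖n'‖ ^ 2 := norm_sub_sq_real n n'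
    rw [hn.1, hn'.1] at h1
    linarith
  have hmn : ⟪m, n⟫ = -(κ / 2) := by
    rw [hm, inner_smul_left, inner_sub_left, real_inner_self_eq_norm_sq, hn.1, real_inner_comm,
      RCLike.conj_to_real]
    field_simp
    linarith
  have hmn' : ⟪m, n'⟫ = κ / 2 := by
    rw [hm, inner_smul_left, inner_sub_left, real_inner_self_eq_norm_sq, hn'.1,
      RCLike.conj_to_real]
    field_simp
    linarith
  have hmnorm : ‖m‖ = 1 := by
    rw [hm, norm_smul, norm_inv, norm_sub_rev, ← hκ, Real.norm_of_nonneg hκ0.le,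
      inv_mul_cancel₀ hκ0.ne']
  have hw : ‖t • m‖ = t := by rw [norm_smul, hmnorm, mul_one, Real.norm_of_nonneg ht0.le]
  have hin : x + t • m ∈ Ω := by
    refine (hn.2 (t • m) (by rw [hw]; linarith)).2 ?_
    rw [hw, inner_smul_left, hmn, RCLike.conj_to_real]
    nlinarith
  have hxΩ : x ∉ Ω := by
    rw [hΩ.frontier_eq] at hx
    exact hx.2
  have hxx' : -(K * t ^ 2) ≤ ⟪x - x', n'⟫ := by
    by_contra! h
    have := (hn'.2 (x - x') (by rw [← ht]; linarith)).2 (by rwa [← ht])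
    rw [add_sub_cancel] at this
    exact hxΩ this
  have hz : ‖t • m + (x - x')‖ ≤ 2 * t := by
    refine (norm_add_le _ _).trans ?_
    rw [hw]; linarith
  have hout := (hn'.2 (t • m + (x - x')) (hz.trans_lt hr)).1 ?_
  · rw [add_comm (t • m), ← add_assoc, add_sub_cancel] at hout
    exact hout hin
  · have h4 : ‖t • m + (x - x')‖ ^ 2 ≤ (2 * t) ^ 2 := by gcongr
    rw [inner_add_left, inner_smul_left, hmn', RCLike.conj_to_real]
    nlinarith

/-- The map `v ↦ 2 v / (1 + |v|²)` is Lipschitz, takes values in the unit ball and fixes the unit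
sphere: it corrects an extension of the normal whose norm may exceed one. -/
lemma lipschitzWith_two_div_one_add_norm_sq_smul {F : Type*} [NormedAddCommGroup F]
    [NormedSpace ℝ F] : LipschitzWith 6 fun v : F => (2 / (1 + ‖v‖ ^ 2)) • v := by
  refine LipschitzWith.of_dist_le_mul fun v w => ?_
  rw [dist_eq_norm, dist_eq_norm]
  have e : (2 / (1 + ‖v‖ ^ 2)) • v - (2 / (1 + ‖w‖ ^ 2)) • w =
      (2 / (1 + ‖v‖ ^ 2)) • (v - w) + (2 / (1 + ‖v‖ ^ 2) - 2 / (1 + ‖w‖ ^ 2)) • w := by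
    rw [smul_sub, sub_smul]; abel
  rw [e]
  refine (norm_add_le _ _).trans ?_
  rw [norm_smul, norm_smul]
  have hA : (0 : ℝ) < 1 + ‖v‖ ^ 2 := by positivity
  have hB : (0 : ℝ) < 1 + ‖w‖ ^ 2 := by positivity
  have h1 : ‖2 / (1 + ‖v‖ ^ 2)‖ ≤ 2 := by
    rw [Real.norm_of_nonneg (by positivity), div_le_iff₀ hA]
    nlinarith [sq_nonneg ‖v‖]
  have h2 : ‖2 / (1 + ‖v‖ ^ 2) - 2 / (1 + ‖w‖ ^ 2)‖ * ‖w‖ ≤ 4 * ‖v - w‖ := by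
    rw [div_sub_div _ _ hA.ne' hB.ne', norm_div, Real.norm_of_nonneg (mul_pos hA hB).le,
      div_mul_eq_mul_div, div_le_iff₀ (mul_pos hA hB)]
    have h3 : 2 * (1 + ‖w‖ ^ 2) - (1 + ‖v‖ ^ 2) * 2 = 2 * ((‖w‖ - ‖v‖) * (‖w‖ + ‖v‖)) := by ring
    rw [h3, norm_mul, norm_mul, Real.norm_of_nonneg (add_nonneg (norm_nonneg w) (norm_nonneg v)),
      Real.norm_of_nonneg (by norm_num : (0 : ℝ) ≤ 2)]
    have h4 : ‖‖w‖ - ‖v‖‖ ≤ ‖v - w‖ := by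
      rw [norm_sub_rev v w]; exact abs_norm_sub_norm_le w v
    have h5 : (‖w‖ + ‖v‖) * ‖w‖ ≤ 2 * ((1 + ‖v‖ ^ 2) * (1 + ‖w‖ ^ 2)) := by
      nlinarith [sq_nonneg (‖w‖ - ‖v‖), sq_nonneg ‖w‖, sq_nonneg ‖v‖,
        mul_nonneg (sq_nonneg ‖w‖) (sq_nonneg ‖v‖)]
    calc 2 * (‖‖w‖ - ‖v‖‖ * (‖w‖ + ‖v‖)) * ‖w‖
        = 2 * ‖‖w‖ - ‖v‖‖ * ((‖w‖ + ‖v‖) * ‖w‖) := by ring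
      _ ≤ 2 * ‖v - w‖ * (2 * ((1 + ‖v‖ ^ 2) * (1 + ‖w‖ ^ 2))) := by gcongr
      _ = _ := by ring
  have h6 : ((6 : NNReal) : ℝ) = 6 := rfl
  rw [h6]
  nlinarith [mul_le_mul_of_nonneg_right h1 (norm_nonneg (v - w))]

lemma norm_two_div_one_add_norm_sq_smul_le {F : Type*} [NormedAddCommGroup F]
    [NormedSpace ℝ F] (v : F) : ‖(2 / (1 + ‖v‖ ^ 2)) • v‖ ≤ 1 := by
  rw [norm_smul, Real.norm_of_nonneg (by positivity), div_mul_eq_mul_div,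
    div_le_one (by positivity)]
  nlinarith [sq_nonneg (‖v‖ - 1)]

/-- The outer normal extends to a globally defined Lipschitz field of norm at most one. -/
lemma IsUniformlyC2Domain.exists_lipschitz_extension {Ω : Set (Space d)}
    (hΩ : IsUniformlyC2Domain Ω) : ∃ (L : NNReal) (N : Space d → Space d), LipschitzWith L N ∧
      (∀ x, ‖N x‖ ≤ 1) ∧ ∀ x ∈ frontier Ω, N x = outerNormal Ω x := by
  obtain ⟨r, K, hr, hK, hn⟩ := hΩ.exists_isParabolicNormal
  have hlip : LipschitzOnWith (Real.toNNReal (max (10 * K) (4 / r))) (outerNormal Ω)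
      (frontier Ω) := by
    refine LipschitzOnWith.of_dist_le_mul fun x hx x' hx' => ?_
    rw [dist_eq_norm, dist_eq_norm, Real.coe_toNNReal _ (by positivity)]
    rcases eq_or_ne x x' with rfl | hne
    · simp
    rcases lt_or_ge (2 * ‖x - x'‖) r with h | h
    · refine (norm_normal_sub_le hΩ.isOpen hK hx (hn x hx) (hn x' hx') h hne).trans ?_
      gcongr
      exact le_max_left _ _
    · calc ‖outerNormal Ω x - outerNormal Ω x'‖ ≤ 2 := by
            refine (norm_sub_le _ _).trans ?_
            rw [(hn x hx).1, (hn x' hx').1]; norm_num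
        _ ≤ 4 / r * ‖x - x'‖ := by
            rw [div_mul_eq_mul_div, le_div_iff₀ hr]; linarith
        _ ≤ _ := by gcongr; exact le_max_right _ _
  obtain ⟨g, hg, hgeq⟩ := hlip.extend_finite_dimension
  refine ⟨_, fun x => (2 / (1 + ‖g x‖ ^ 2)) • g x,
    lipschitzWith_two_div_one_add_norm_sq_smul.comp hg,
    fun x => norm_two_div_one_add_norm_sq_smul_le _, fun x hx => ?_⟩
  dsimp only
  rw [← hgeq hx, (hn x hx).1]
  norm_num

/-! ### The surface measure near the boundary -/

/-- Near a boundary point the boundary is the graph of a Lipschitz function. -/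
lemma IsUniformlyC2Domain.exists_local_graph {Ω : Set (Space d)} (hΩ : IsUniformlyC2Domain Ω)
    {x₀ : Space d} (hx₀ : x₀ ∈ frontier Ω) :
    ∃ (e : Space d) (h : (ℝ ∙ e)ᗮ → ℝ) (r : ℝ) (L : NNReal), ‖e‖ = 1 ∧ 0 < r ∧
      LipschitzOnWith L h (Metric.ball 0 (2 * r)) ∧
      (∀ y ∈ Metric.ball (0 : (ℝ ∙ e)ᗮ) (2 * r), x₀ + (y : Space d) + h y • e ∈ frontier Ω) ∧
      ∀ p ∈ frontier Ω, p ∈ Metric.ball x₀ (2 * r) →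
        ∃ y ∈ Metric.ball (0 : (ℝ ∙ e)ᗮ) (2 * r), p = x₀ + (y : Space d) + h y • e := by
  obtain ⟨a, b, K, ha, hb, hK, hch⟩ := hΩ.exists_chart
  obtain ⟨e, he, h, hh, h0, hd0, hbd, hg⟩ := hch x₀ hx₀
  set r := min a (b / (1 + K)) / 2 with hr
  have hr0 : 0 < r := by positivity
  have hra : 2 * r ≤ a := by rw [hr]; linarith [min_le_left a (b / (1 + K))]
  have hrb : 2 * r ≤ b / (1 + K) := by rw [hr]; linarith [min_le_right a (b / (1 + K))]
  rw [le_div_iff₀ (by positivity)] at hrb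
  have hsub : Metric.ball (0 : (ℝ ∙ e)ᗮ) (2 * r) ⊆ Metric.ball 0 a := Metric.ball_subset_ball hra
  refine ⟨e, h, r, Real.toNNReal K, he, hr0, ?_, fun y hy => ?_, fun p hp hpr => ?_⟩
  · refine LipschitzOnWith.of_dist_le_mul fun y hy y' hy' => ?_
    rw [Real.coe_toNNReal _ hK.le, Real.dist_eq, dist_eq_norm]
    exact abs_sub_le_of_iteratedFDeriv hh hbd (hsub hy) (hsub hy')
  · exact ((hg y (h y) (mem_ball_zero_iff.1 (hsub hy)) (by simpa using hb)).2).2 rfl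
  · obtain ⟨y, hy, hyz⟩ := exists_orthogonal_add_smul he (p - x₀)
    rw [Metric.mem_ball, dist_eq_norm] at hpr
    have hyr : ‖y‖ < 2 * r := hyz.trans_lt hpr
    have hya : y ∈ Metric.ball (0 : (ℝ ∙ e)ᗮ) a := hsub (mem_ball_zero_iff.2 hyr)
    have hhy : |h y| ≤ K * ‖y‖ := by
      have := abs_sub_le_of_iteratedFDeriv hh hbd hya (Metric.mem_ball_self ha)
      simpa [h0] using this
    have hs : |⟪p - x₀, e⟫| ≤ ‖p - x₀‖ := by simpa [he] using abs_real_inner_le_norm (p - x₀) e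
    have hsb : |⟪p - x₀, e⟫ - h y| < b := by
      refine (abs_sub _ _).trans_lt ?_
      nlinarith
    have h1 := (hg y _ (mem_ball_zero_iff.1 hya) hsb).2
    have h2 : p = x₀ + (y : Space d) + ⟪p - x₀, e⟫ • e := by
      rw [add_assoc, ← hy, add_sub_cancel]
    rw [← h2] at h1
    exact ⟨y, mem_ball_zero_iff.2 hyr, by rw [← h1.1 hp]; exact h2⟩

lemma finrank_orthogonal_unit {e : Space d} (he : ‖e‖ = 1) :
    Module.finrank ℝ (ℝ ∙ e)ᗮ = d - 1 := by
  have h1 := (ℝ ∙ e).finrank_add_finrank_orthogonal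
  rw [finrank_span_singleton (by rintro rfl; simp at he), finrank_euclideanSpace_fin] at h1
  omega

lemma euclideanHausdorffMeasure_image_lt_top {X Y : Type*} [MetricSpace X] [MeasurableSpace X]
    [BorelSpace X] [MetricSpace Y] [MeasurableSpace Y] [BorelSpace Y] {L : NNReal} {f : X → Y}
    {s : Set X} (hf : LipschitzOnWith L f s) {n : ℕ}
    (hs : Measure.euclideanHausdorffMeasure n s < ⊤) :
    Measure.euclideanHausdorffMeasure n (f '' s) < ⊤ := by
  have h1 := hf.hausdorffMeasure_image_le (d := n) (by positivity)
  rw [Measure.euclideanHausdorffMeasure_def, Measure.smul_apply] at hs ⊢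
  refine lt_of_le_of_lt (smul_le_smul_of_nonneg_left h1 zero_le) ?_
  rw [ENNReal.smul_def, smul_eq_mul] at hs ⊢
  rw [mul_left_comm]
  refine ENNReal.mul_lt_top ?_ hs
  exact ENNReal.rpow_lt_top_of_nonneg (by positivity) ENNReal.coe_ne_top

lemma euclideanHausdorffMeasure_image_le {X Y : Type*} [MetricSpace X] [MeasurableSpace X]
    [BorelSpace X] [MetricSpace Y] [MeasurableSpace Y] [BorelSpace Y] {f : X → Y}
    (hf : LipschitzWith 1 f) (n : ℕ) (s : Set X) :
    Measure.euclideanHausdorffMeasure n (f '' s) ≤ Measure.euclideanHausdorffMeasure n s := by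
  have h1 := hf.hausdorffMeasure_image_le (d := n) (by positivity) s
  rw [Measure.euclideanHausdorffMeasure_def, Measure.euclideanHausdorffMeasure_def,
    Measure.smul_apply, Measure.smul_apply]
  exact smul_le_smul_of_nonneg_left (by simpa using h1) zero_le

section Graph

variable {Ω : Set (Space d)} {x₀ e : Space d} {h : (ℝ ∙ e)ᗮ → ℝ} {r : ℝ} {L : NNReal}

lemma volume_eq_euclideanHausdorffMeasure (he : ‖e‖ = 1) :
    (volume : Measure (ℝ ∙ e)ᗮ) = Measure.euclideanHausdorffMeasure (d - 1) := by
  rw [← InnerProductSpace.euclideanHausdorffMeasure_eq_volume, finrank_orthogonal_unit he]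

lemma lipschitzOnWith_graph (he : ‖e‖ = 1) (hh : LipschitzOnWith L h (Metric.ball 0 (2 * r))) :
    LipschitzOnWith (1 + L) (fun y : (ℝ ∙ e)ᗮ => x₀ + (y : Space d) + h y • e)
      (Metric.ball 0 (2 * r)) := by
  refine LipschitzOnWith.of_dist_le_mul fun y hy y' hy' => ?_
  have h1 := hh.dist_le_mul y hy y' hy'
  rw [Real.dist_eq] at h1
  have e1 : x₀ + (y : Space d) + h y • e - (x₀ + (y' : Space d) + h y' • e) =
      ((y - y' : (ℝ ∙ e)ᗮ) : Space d) + (h y - h y') • e := by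
    rw [Submodule.coe_sub, sub_smul]; abel
  rw [dist_eq_norm, e1]
  refine (norm_add_le _ _).trans ?_
  rw [norm_smul, he, mul_one, Real.norm_eq_abs, ← Submodule.coe_norm, ← dist_eq_norm]
  push_cast
  linarith

/-- The measure of the base, carried to the graph, is at most the surface measure, since the
orthogonal projection does not increase distances. -/
lemma map_graph_le_surfaceMeasure (he : ‖e‖ = 1)
    (hh : LipschitzOnWith L h (Metric.ball 0 (2 * r)))
    (hg : ∀ y ∈ Metric.ball (0 : (ℝ ∙ e)ᗮ) (2 * r), x₀ + (y : Space d) + h y • e ∈ frontier Ω) :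
    (volume.restrict (Metric.ball (0 : (ℝ ∙ e)ᗮ) (2 * r))).map
      (fun y : (ℝ ∙ e)ᗮ => x₀ + (y : Space d) + h y • e) ≤ surfaceMeasure Ω := by
  have haem : AEMeasurable (fun y : (ℝ ∙ e)ᗮ => x₀ + (y : Space d) + h y • e)
      (volume.restrict (Metric.ball (0 : (ℝ ∙ e)ᗮ) (2 * r))) :=
    ((lipschitzOnWith_graph he hh).continuousOn).aemeasurable Metric.isOpen_ball.measurableSet
  rw [Measure.le_iff]
  intro A hA
  rw [Measure.map_apply_of_aemeasurable haem hA, surfaceMeasure, Measure.restrict_apply hA,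
    volume_eq_euclideanHausdorffMeasure he,
    Measure.restrict_apply' Metric.isOpen_ball.measurableSet]
  have hlip : LipschitzWith 1 fun x : Space d => (ℝ ∙ e)ᗮ.orthogonalProjectionOnto (x - x₀) := by
    have := (ℝ ∙ e)ᗮ.lipschitzWith_orthogonalProjectionOnto.comp
      (LipschitzWith.id.sub (LipschitzWith.const x₀))
    rw [show (1 * (1 + 0) : NNReal) = 1 by norm_num] at this
    exact this
  refine (measure_mono ?_).trans (euclideanHausdorffMeasure_image_le hlip _ _)
  intro y hy
  refine ⟨_, ⟨hy.1, hg y hy.2⟩, ?_⟩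
  dsimp only
  rw [add_assoc, add_sub_cancel_left, map_add, map_smul,
    Submodule.orthogonalProjectionOnto_orthogonalComplement_singleton_eq_zero, smul_zero, add_zero,
    Submodule.orthogonalProjectionOnto_mem_subspace_eq_self]

/-- Fubini's theorem in the cylindrical coordinates of a chart. -/
lemma lintegral_eq_lintegral_cylinder (he : ‖e‖ = 1) (x₀ : Space d) {f : Space d → ℝ≥0∞}
    (hf : Measurable f) :
    ∫⁻ x, f x = ∫⁻ y : (ℝ ∙ e)ᗮ, ∫⁻ s : ℝ, f (x₀ + (y : Space d) + s • e) := by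
  let ℓ := LinearIsometryEquiv.toSpanUnitSingleton (𝕜 := ℝ) e he
  have h1 : MeasurePreserving (Prod.map ℓ (id : (ℝ ∙ e)ᗮ → (ℝ ∙ e)ᗮ))
      (volume.prod volume) (volume.prod volume) :=
    ℓ.measurePreserving.prod (MeasurePreserving.id _)
  have h2 := ((ℝ ∙ e).measurePreserving_measurableEquivProd x₀).symm
  rw [InnerProductSpace.euclideanHausdorffMeasure_eq_volume] at h2
  have h3 := h2.comp h1
  rw [← h3.lintegral_comp hf]
  refine (lintegral_prod_symm _ (hf.comp h3.measurable).aemeasurable).trans ?_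
  refine lintegral_congr fun y => lintegral_congr fun s => ?_
  refine congrArg f ?_
  simp only [Function.comp, Prod.map, Submodule.measurableEquivProd_symm_apply, id, vadd_eq_add]
  have : ((ℓ s : ℝ ∙ e) : Space d) = s • e := rfl
  rw [this]; abel

/-- The local form of the strip estimate: in a chart, each fibre meets the strip of width `t` in an
interval of length at most `2 (1 + L) t` around the graph. -/
lemma lintegral_strip_le (he : ‖e‖ = 1)
    (hh : LipschitzOnWith L h (Metric.ball 0 (2 * r)))
    (hg : ∀ y ∈ Metric.ball (0 : (ℝ ∙ e)ᗮ) (2 * r), x₀ + (y : Space d) + h y • e ∈ frontier Ω)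
    (hg' : ∀ p ∈ frontier Ω, p ∈ Metric.ball x₀ (2 * r) →
        ∃ y ∈ Metric.ball (0 : (ℝ ∙ e)ᗮ) (2 * r), p = x₀ + (y : Space d) + h y • e)
    {ψ : Space d → ℝ} (hψ : Continuous ψ) {t ω : ℝ} (ht : 0 < t) (htr : t < r)
    (hω : ∀ x x' : Space d, dist x x' < (1 + L) * t → ψ x ≤ ψ x' + ω) :
    ∫⁻ x in Metric.ball x₀ r ∩ Metric.thickening t (frontier Ω), ENNReal.ofReal (ψ x) ≤
      ENNReal.ofReal (2 * ((1 + L) * t)) * ((∫⁻ x, ENNReal.ofReal (ψ x) ∂(surfaceMeasure Ω)) +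
        ENNReal.ofReal ω * volume (Metric.ball (0 : (ℝ ∙ e)ᗮ) (2 * r))) := by
  set S := Metric.ball x₀ r ∩ Metric.thickening t (frontier Ω) with hS
  have hSm : MeasurableSet S := (Metric.isOpen_ball.inter Metric.isOpen_thickening).measurableSet
  set τ : ℝ := (1 + L) * t with hτ
  set B := Metric.ball (0 : (ℝ ∙ e)ᗮ) (2 * r) with hB
  set G : (ℝ ∙ e)ᗮ → Space d := fun y => x₀ + (y : Space d) + h y • e with hG
  have hpt : ∀ (y : (ℝ ∙ e)ᗮ) (s : ℝ), x₀ + (y : Space d) + s • e ∈ S →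
      y ∈ B ∧ s ∈ Metric.ball (h y) τ := by
    intro y s hx
    obtain ⟨p, hp, hxp⟩ := Metric.mem_thickening_iff.1 hx.2
    have hx1 := Metric.mem_ball.1 hx.1
    have hye : ⟪(y : Space d), e⟫ = 0 := (Submodule.mem_orthogonal_singleton_iff_inner_left).1 y.2
    have hproj : ∀ (y' : (ℝ ∙ e)ᗮ) (s' : ℝ), ‖y'‖ ≤ ‖(y' : Space d) + s' • e‖ ∧
        |s'| ≤ ‖(y' : Space d) + s' • e‖ := by
      intro y' s'
      have hye : ⟪(y' : Space d), e⟫ = 0 :=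
        (Submodule.mem_orthogonal_singleton_iff_inner_left).1 y'.2
      have hsq : ‖(y' : Space d) + s' • e‖ ^ 2 = ‖y'‖ ^ 2 + s' ^ 2 := by
        rw [norm_add_sq_real, inner_smul_right, hye, norm_smul, he, Submodule.coe_norm,
          Real.norm_eq_abs, mul_one, sq_abs]
        ring
      exact ⟨by rw [← sq_le_sq₀ (norm_nonneg _) (norm_nonneg _), hsq]; nlinarith [sq_nonneg s'],
        abs_le_of_sq_le_sq (by rw [hsq]; nlinarith [sq_nonneg ‖y'‖]) (norm_nonneg _)⟩
    have hyr : ‖y‖ < r := by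
      refine (hproj y s).1.trans_lt ?_
      rw [dist_eq_norm] at hx1
      rwa [add_assoc, add_sub_cancel_left] at hx1
    have hyB : y ∈ B := mem_ball_zero_iff.2 (by linarith)
    refine ⟨hyB, ?_⟩
    have hpB : p ∈ Metric.ball x₀ (2 * r) := by
      rw [Metric.mem_ball]
      rw [dist_comm] at hxp
      linarith [dist_triangle p (x₀ + (y : Space d) + s • e) x₀]
    obtain ⟨y', hy', rfl⟩ := hg' p hp hpB
    rw [dist_eq_norm] at hxp
    have e1 : x₀ + (y : Space d) + s • e - (x₀ + (y' : Space d) + h y' • e) =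
        ((y - y' : (ℝ ∙ e)ᗮ) : Space d) + (s - h y') • e := by
      rw [Submodule.coe_sub, sub_smul]; abel
    rw [e1] at hxp
    obtain ⟨h1, h2⟩ := hproj (y - y') (s - h y')
    have h3 := hh.dist_le_mul y' hy' y hyB
    rw [Real.dist_eq, dist_eq_norm, norm_sub_rev] at h3
    rw [Metric.mem_ball, Real.dist_eq, hτ]
    have h4 : |s - h y| ≤ |s - h y'| + |h y' - h y| := abs_sub_le _ _ _
    have h5 : (L : ℝ) * ‖y - y'‖ ≤ L * t := mul_le_mul_of_nonneg_left (h1.trans hxp.le) L.2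
    linarith
  have hbound : ∀ (y : (ℝ ∙ e)ᗮ) (s : ℝ),
      S.indicator (fun x => ENNReal.ofReal (ψ x)) (x₀ + (y : Space d) + s • e) ≤
        B.indicator (fun y => ENNReal.ofReal (ψ (G y)) + ENNReal.ofReal ω) y *
          (Metric.ball (h y) τ).indicator 1 s := by
    intro y s
    by_cases hx : x₀ + (y : Space d) + s • e ∈ S
    · obtain ⟨hy, hs⟩ := hpt y s hx
      rw [indicator_of_mem hx, indicator_of_mem hy, indicator_of_mem hs, Pi.one_apply, mul_one]
      refine (ENNReal.ofReal_le_ofReal (hω _ (G y) ?_)).trans ENNReal.ofReal_add_le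
      rw [dist_eq_norm, hG, add_sub_add_left_eq_sub, ← sub_smul, norm_smul, he, mul_one]
      exact Metric.mem_ball.1 hs
    · rw [indicator_of_notMem hx]
      exact zero_le
  have haem : AEMeasurable G (volume.restrict B) :=
    ((lipschitzOnWith_graph he hh).continuousOn).aemeasurable Metric.isOpen_ball.measurableSet
  have hψm : Measurable fun x => ENNReal.ofReal (ψ x) := hψ.measurable.ennreal_ofReal
  calc ∫⁻ x in S, ENNReal.ofReal (ψ x)
      = ∫⁻ x, S.indicator (fun x => ENNReal.ofReal (ψ x)) x := (lintegral_indicator hSm _).symm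
    _ = ∫⁻ y : (ℝ ∙ e)ᗮ, ∫⁻ s : ℝ,
          S.indicator (fun x => ENNReal.ofReal (ψ x)) (x₀ + (y : Space d) + s • e) :=
        lintegral_eq_lintegral_cylinder he x₀ (hψm.indicator hSm)
    _ ≤ ∫⁻ y : (ℝ ∙ e)ᗮ, ∫⁻ s : ℝ,
          B.indicator (fun y => ENNReal.ofReal (ψ (G y)) + ENNReal.ofReal ω) y *
          (Metric.ball (h y) τ).indicator 1 s :=
        lintegral_mono fun y => lintegral_mono fun s => hbound y s
    _ = ∫⁻ y : (ℝ ∙ e)ᗮ, ENNReal.ofReal (2 * τ) *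
          B.indicator (fun y => ENNReal.ofReal (ψ (G y)) + ENNReal.ofReal ω) y := by
        refine lintegral_congr fun y => ?_
        rw [lintegral_const_mul _ (measurable_one.indicator Metric.isOpen_ball.measurableSet),
          lintegral_indicator_one Metric.isOpen_ball.measurableSet, Real.volume_ball, mul_comm]
    _ = ENNReal.ofReal (2 * τ) * ∫⁻ y in B, (ENNReal.ofReal (ψ (G y)) + ENNReal.ofReal ω) := by
        rw [lintegral_const_mul' _ _ ENNReal.ofReal_ne_top,
          lintegral_indicator Metric.isOpen_ball.measurableSet]
    _ = ENNReal.ofReal (2 * τ) * ((∫⁻ y in B, ENNReal.ofReal (ψ (G y))) +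
          ENNReal.ofReal ω * volume B) := by
        rw [lintegral_add_right _ measurable_const, setLIntegral_const]
    _ ≤ _ := by
        gcongr
        rw [← lintegral_map' hψm.aemeasurable haem]
        exact lintegral_mono' (map_graph_le_surfaceMeasure he hh hg) le_rfl

end Graph

/-- Volume integrals over thin strips along the boundary are controlled, per unit of width, by
surface integrals, with a constant that is uniform on compact sets. -/
lemma IsUniformlyC2Domain.exists_strip_bound {Ω : Set (Space d)} (hΩ : IsUniformlyC2Domain Ω)
    {A : Set (Space d)} (hA : IsCompact A) :
    surfaceMeasure Ω A < ⊤ ∧ ∃ C : NNReal, ∀ ψ : Space d → ℝ, Continuous ψ → HasCompactSupport ψ →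
      ∀ η : ℝ, 0 < η → ∀ᶠ t in 𝓝[>] (0 : ℝ),
        ∫⁻ x in A ∩ Metric.thickening t (frontier Ω), ENNReal.ofReal (ψ x) ≤
          ENNReal.ofReal t * (C * (∫⁻ x, ENNReal.ofReal (ψ x) ∂(surfaceMeasure Ω)) +
            ENNReal.ofReal η) := by
  set P : Set (Space d) → Prop := fun S => ∃ U, IsOpen U ∧ S ⊆ U ∧ surfaceMeasure Ω U < ⊤ ∧
    ∃ C : NNReal, ∀ ψ : Space d → ℝ, Continuous ψ → HasCompactSupport ψ →
      ∀ η : ℝ, 0 < η → ∀ᶠ t in 𝓝[>] (0 : ℝ),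
        ∫⁻ x in U ∩ Metric.thickening t (frontier Ω), ENNReal.ofReal (ψ x) ≤
          ENNReal.ofReal t * (C * (∫⁻ x, ENNReal.ofReal (ψ x) ∂(surfaceMeasure Ω)) +
            ENNReal.ofReal η) with hP
  have hS : IsCompact (frontier Ω ∩ Metric.cthickening 1 A) := by
    rw [inter_comm]
    exact (hA.cthickening).inter_right isClosed_frontier
  have hPS : P (frontier Ω ∩ Metric.cthickening 1 A) := by
    refine hS.induction_on ?_ ?_ ?_ ?_
    · exact ⟨∅, isOpen_empty, subset_rfl, by simp, 0, fun ψ _ _ η _ => by simp⟩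
    · rintro s s' hss ⟨U, hU, hsU, h⟩
      exact ⟨U, hU, hss.trans hsU, h⟩
    · rintro s s' ⟨U, hU, hsU, hfin, C, hC⟩ ⟨U', hU', hsU', hfin', C', hC'⟩
      refine ⟨U ∪ U', hU.union hU', union_subset_union hsU hsU',
        (measure_union_le _ _).trans_lt (ENNReal.add_lt_top.2 ⟨hfin, hfin'⟩), C + C',
        fun ψ hψ hψc η hη => ?_⟩
      filter_upwards [hC ψ hψ hψc (η / 2) (half_pos hη), hC' ψ hψ hψc (η / 2) (half_pos hη)]
        with t h1 h2
      rw [union_inter_distrib_right]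
      refine (lintegral_union_le _ _ _).trans ((add_le_add h1 h2).trans_eq ?_)
      rw [← mul_add, show η = η / 2 + η / 2 by ring, ENNReal.ofReal_add (by linarith) (by linarith)]
      push_cast
      ring_nf
    · intro x₀ hx₀
      obtain ⟨e, h, r, L, he, hr, hh, hg, hg'⟩ := hΩ.exists_local_graph hx₀.1
      refine ⟨Metric.ball x₀ r, mem_nhdsWithin_of_mem_nhds (Metric.ball_mem_nhds x₀ hr),
        Metric.ball x₀ r, Metric.isOpen_ball, subset_rfl, ?_, 2 * (1 + L),
        fun ψ hψ hψc η hη => ?_⟩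
      · have h1 : Measure.euclideanHausdorffMeasure (d - 1)
            (Metric.ball (0 : (ℝ ∙ e)ᗮ) (2 * r)) < ⊤ := by
          rw [← volume_eq_euclideanHausdorffMeasure he]
          exact Metric.isBounded_ball.measure_lt_top
        have h2 :=
          euclideanHausdorffMeasure_image_lt_top (lipschitzOnWith_graph (x₀ := x₀) he hh) h1
        rw [surfaceMeasure, Measure.restrict_apply Metric.isOpen_ball.measurableSet]
        refine (measure_mono ?_).trans_lt h2
        rintro p ⟨hp, hpf⟩
        obtain ⟨y, hy, rfl⟩ := hg' p hpf (Metric.ball_subset_ball (by linarith) hp)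
        exact ⟨y, hy, rfl⟩
      · set v : ℝ := (volume (Metric.ball (0 : (ℝ ∙ e)ᗮ) (2 * r))).toReal with hv
        have hvt : volume (Metric.ball (0 : (ℝ ∙ e)ᗮ) (2 * r)) = ENNReal.ofReal v :=
          (ENNReal.ofReal_toReal Metric.isBounded_ball.measure_lt_top.ne).symm
        have hv0 : 0 ≤ v := ENNReal.toReal_nonneg
        set c : ℝ := 2 * (1 + L) with hc
        have hc0 : 0 < c := by positivity
        set ω : ℝ := η / (c * (v + 1)) with hω
        have hω0 : 0 < ω := by positivity
        obtain ⟨δ, hδ, huc⟩ := Metric.uniformContinuous_iff.1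
          (hψc.uniformContinuous_of_continuous hψ) ω hω0
        have hev : ∀ᶠ t in 𝓝[>] (0 : ℝ), t < min r (δ / (1 + L)) :=
          mem_nhdsWithin_of_mem_nhds (Iio_mem_nhds (by positivity))
        filter_upwards [hev, eventually_mem_nhdsWithin] with t ht ht0
        have ht0 : 0 < t := ht0
        rw [lt_min_iff, lt_div_iff₀ (by positivity)] at ht
        refine (lintegral_strip_le he hh hg hg' hψ ht0 ht.1 (ω := ω) fun x x' hxx' => ?_).trans ?_
        · have := huc (a := x) (b := x') (by linarith)
          rw [Real.dist_eq] at this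
          linarith [le_abs_self (ψ x - ψ x')]
        · have e1 : 2 * ((1 + (L : ℝ)) * t) = t * c := by rw [hc]; ring
          have e2 : ((2 * (1 + L) : NNReal) : ℝ≥0∞) = ENNReal.ofReal c := by
            rw [hc, ← ENNReal.ofReal_coe_nnreal]; push_cast; rfl
          rw [e1, ENNReal.ofReal_mul ht0.le, mul_assoc, e2, mul_add, hvt,
            ← ENNReal.ofReal_mul hω0.le, ← ENNReal.ofReal_mul hc0.le]
          gcongr
          rw [hω, ← mul_assoc, mul_div_assoc', div_mul_eq_mul_div, div_le_iff₀ (by positivity)]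
          nlinarith [mul_pos hc0 hη]
  obtain ⟨U, hU, hSU, hfin, C, hC⟩ := hPS
  constructor
  · have h1 : surfaceMeasure Ω A = surfaceMeasure Ω (frontier Ω ∩ A) := by
      rw [surfaceMeasure, Measure.restrict_apply hA.measurableSet,
        Measure.restrict_apply (isClosed_frontier.measurableSet.inter hA.measurableSet)]
      congr 1
      ext x; simp only [mem_inter_iff]; tauto
    rw [h1]
    refine (measure_mono ?_).trans_lt hfin
    exact (inter_subset_inter_right _ (Metric.self_subset_cthickening A)).trans hSU
  · refine ⟨C, fun ψ hψ hψc η hη => ?_⟩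
    obtain ⟨δ, hδ, hsub⟩ := hS.exists_thickening_subset_open hU hSU
    have hev : ∀ᶠ t in 𝓝[>] (0 : ℝ), t < min δ 1 :=
      mem_nhdsWithin_of_mem_nhds (Iio_mem_nhds (by positivity))
    filter_upwards [hC ψ hψ hψc η hη, hev] with t h1 ht
    rw [lt_min_iff] at ht
    refine (lintegral_mono_set ?_).trans h1
    rintro x ⟨hxA, hxt⟩
    refine ⟨hsub ?_, hxt⟩
    obtain ⟨p, hp, hxp⟩ := Metric.mem_thickening_iff.1 hxt
    refine Metric.mem_thickening_iff.2 ⟨p, ⟨hp, ?_⟩, hxp.trans ht.1⟩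
    refine Metric.mem_cthickening_of_dist_le p x 1 A hxA ?_
    rw [dist_comm]
    exact (hxp.trans ht.2).le

/-! ### Cutoff functions near the boundary -/

lemma exists_frontier_dist_eq_infDist {Ω : Set (Space d)} (hΩ : IsOpen Ω) (hne : Ωᶜ.Nonempty)
    {y : Space d} (hy : y ∈ Ω) :
    ∃ p ∈ frontier Ω, Metric.infDist y Ωᶜ = dist y p ∧ 0 < dist y p := by
  obtain ⟨p, hp, hpd⟩ := hΩ.isClosed_compl.exists_infDist_eq_dist hne y
  have hyp : 0 < dist y p := dist_pos.2 fun h => hp (h ▸ hy)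
  refine ⟨p, ?_, hpd, hyp⟩
  rw [hΩ.frontier_eq]
  refine ⟨?_, hp⟩
  -- the ball around `y` whose radius is the distance to the complement lies in `Ω`
  have hsub : Metric.ball y (dist y p) ⊆ Ω := by
    intro z hz
    by_contra hzΩ
    have := Metric.infDist_le_dist_of_mem (x := y) (show z ∈ Ωᶜ from hzΩ)
    rw [hpd, dist_comm y z] at this
    exact absurd (Metric.mem_ball.1 hz) (not_lt.2 this)
  refine closure_mono hsub ?_
  rw [closure_ball _ hyp.ne', Metric.mem_closedBall, dist_comm]

/-- A ball inside `Ω` that touches the boundary at `p` does so along the normal at `p`. -/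
lemma sub_eq_neg_smul_of_ball_subset {Ω : Set (Space d)} {y p n : Space d}
    (hsub : Metric.ball y (dist y p) ⊆ Ω) (hyp : 0 < dist y p) (hn : IsOuterNormal Ω p n) :
    y - p = -(dist y p • n) := by
  set D := dist y p with hD
  set w := D⁻¹ • (y - p) with hw
  have hyw : y - p = D • w := by rw [hw, smul_inv_smul₀ hyp.ne']
  have hw1 : ‖w‖ = 1 := by
    rw [hw, norm_smul, ← dist_eq_norm, norm_inv, Real.norm_of_nonneg hyp.le,
      inv_mul_cancel₀ hyp.ne']
  have hexp : ‖w + n‖ ^ 2 = 2 * (1 + ⟪w, n⟫) := by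
    rw [norm_add_sq_real, hw1, hn.1]; ring
  suffices h : ‖w + n‖ = 0 by
    rw [hyw, eq_neg_of_add_eq_zero_left (norm_eq_zero.1 h), smul_neg]
  by_contra h0
  have hpos : 0 < ‖w + n‖ := lt_of_le_of_ne (norm_nonneg _) (Ne.symm h0)
  set q := ‖w + n‖ with hq
  -- the point `p + t (w + n)` lies in the ball and in the exterior cone, for small `t`
  have hev := hn.2 (q / 4) (by positivity)
  have hc : Tendsto (fun t : ℝ => p + t • (w + n)) (𝓝[>] 0) (𝓝 p) := by
    refine Tendsto.mono_left ?_ nhdsWithin_le_nhds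
    have : Continuous fun t : ℝ => p + t • (w + n) := by fun_prop
    simpa using this.tendsto 0
  have hsmall : ∀ᶠ t in 𝓝[>] (0 : ℝ), t < D :=
    mem_nhdsWithin_of_mem_nhds (Iio_mem_nhds hyp)
  obtain ⟨t, ⟨ht, htD⟩, ht0⟩ :=
    (((hc.eventually hev).and hsmall).and eventually_mem_nhdsWithin).exists
  have ht0 : 0 < t := ht0
  have h1 := ht.1
  have e1 : ⟪w + n, n⟫ = q ^ 2 / 2 := by
    rw [inner_add_left, real_inner_self_eq_norm_sq, hn.1]; linarith
  have e2 : ⟪w + n, w⟫ = q ^ 2 / 2 := by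
    rw [inner_add_left, real_inner_self_eq_norm_sq, hw1, real_inner_comm]; linarith
  rw [add_sub_cancel_left, norm_smul, Real.norm_of_nonneg ht0.le, inner_smul_left,
    RCLike.conj_to_real, e1] at h1
  refine h1 ?_ (hsub ?_)
  · nlinarith [mul_pos ht0 (pow_pos hpos 2)]
  · rw [Metric.mem_ball, dist_eq_norm]
    have e3 : p + t • (w + n) - y = t • (w + n) - D • w := by rw [← hyw]; abel
    rw [e3, ← sq_lt_sq₀ (norm_nonneg _) hyp.le, norm_sub_sq_real, norm_smul, norm_smul,
      inner_smul_left, inner_smul_right, RCLike.conj_to_real, e2, hw1, mul_one,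
      Real.norm_of_nonneg ht0.le, Real.norm_of_nonneg hyp.le, ← hq]
    nlinarith [mul_pos ht0 (pow_pos hpos 2)]

/-- The distance to the complement grows at most linearly, at the rate given by the normal at the
nearest boundary point. -/
lemma infDist_add_sub_le {Ω : Set (Space d)} {N : Space d → Space d} (hΩ : IsOpen Ω)
    (hne : Ωᶜ.Nonempty) (hN : ∀ p ∈ frontier Ω, IsOuterNormal Ω p (N p)) {y : Space d}
    (hy : y ∈ Ω) : ∃ p ∈ frontier Ω, Metric.infDist y Ωᶜ = dist y p ∧ 0 < dist y p ∧
      ∀ v, Metric.infDist (y + v) Ωᶜ - Metric.infDist y Ωᶜ ≤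
        -⟪v, N p⟫ + ‖v‖ ^ 2 / (2 * dist y p) := by
  obtain ⟨p, hp, hd, hpos⟩ := exists_frontier_dist_eq_infDist hΩ hne hy
  refine ⟨p, hp, hd, hpos, fun v => ?_⟩
  have hsub : Metric.ball y (dist y p) ⊆ Ω := by
    intro z hz
    by_contra hzΩ
    have := Metric.infDist_le_dist_of_mem (x := y) (show z ∈ Ωᶜ from hzΩ)
    rw [hd, dist_comm y z] at this
    exact absurd (Metric.mem_ball.1 hz) (not_lt.2 this)
  have hyp := sub_eq_neg_smul_of_ball_subset hsub hpos (hN p hp)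
  have hpc : p ∈ Ωᶜ := by
    rw [hΩ.frontier_eq] at hp; exact hp.2
  have h1 : Metric.infDist (y + v) Ωᶜ ≤ dist (y + v) p := Metric.infDist_le_dist_of_mem hpc
  rw [hd]
  set D := dist y p with hD
  have h2 : dist (y + v) p ^ 2 = D ^ 2 - 2 * D * ⟪v, N p⟫ + ‖v‖ ^ 2 := by
    have e : y + v - p = v + (y - p) := by abel
    rw [dist_eq_norm, e, hyp, norm_add_sq_real, norm_neg, norm_smul, (hN p hp).1, inner_neg_right,
      inner_smul_right, Real.norm_of_nonneg hpos.le]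
    ring
  have h3 : dist (y + v) p ≤ D + (-⟪v, N p⟫ + ‖v‖ ^ 2 / (2 * D)) := by
    -- `a ≤ (a² + D²) / (2 D)`
    have e : D + (-⟪v, N p⟫ + ‖v‖ ^ 2 / (2 * D)) = (dist (y + v) p ^ 2 + D ^ 2) / (2 * D) := by
      rw [h2]; field_simp; ring
    rw [e, le_div_iff₀ (by positivity)]
    nlinarith [sq_nonneg (dist (y + v) p - D)]
  linarith

/-- The gradient of the regularized distance is nearly `-N` at distance comparable to the scale of
regularization. The distance has one-sided difference bounds, which survive averaging; applied to
`v` and `-v`, they determine the derivative of the average up to `O(s)`. -/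
lemma abs_fderiv_mollify_infDist_add_le {Ω : Set (Space d)} {N : Space d → Space d} {L : NNReal}
    (hΩ : IsOpen Ω) (hne : Ωᶜ.Nonempty) (hN : ∀ p ∈ frontier Ω, IsOuterNormal Ω p (N p))
    (hL : LipschitzWith L N) {s : ℝ} (hs : 0 < s) {ρ : Space d → ℝ} (hρ : IsMollifier ρ (s / 4))
    {x : Space d} (hx1 : 3 / 4 * s ≤ Metric.infDist x Ωᶜ)
    (hx2 : Metric.infDist x Ωᶜ ≤ 9 / 4 * s) (v : Space d) :
    |fderiv ℝ (mollify ρ fun y => Metric.infDist y Ωᶜ) x v + ⟪N x, v⟫| ≤ 3 * L * s * ‖v‖ := by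
  set D : Space d → ℝ := fun y => Metric.infDist y Ωᶜ with hD
  have hDl : LipschitzWith 1 D := Metric.lipschitz_infDist_pt Ωᶜ
  have hDc : Continuous D := hDl.continuous
  have hdiff : DifferentiableAt ℝ (mollify ρ D) x :=
    (hρ.contDiff_mollify hDc.locallyIntegrable).differentiable (by norm_num) x
  have key : ∀ v : Space d, fderiv ℝ (mollify ρ D) x v ≤ -⟪N x, v⟫ + 3 * L * s * ‖v‖ := by
    intro v
    have hpt : ∀ z ∈ Metric.ball (0 : Space d) (s / 4), ∀ t : ℝ, 0 < t →
        D (x - z + t • v) - D (x - z) ≤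
          t * (-⟪N x, v⟫ + 3 * L * s * ‖v‖) + t ^ 2 * (‖v‖ ^ 2 / s) := by
      intro z hz t ht
      rw [mem_ball_zero_iff] at hz
      have h1 := hDl.dist_le_mul (x - z) x
      rw [Real.dist_eq, dist_eq_norm, NNReal.coe_one, one_mul] at h1
      have e1 : x - z - x = -z := by abel
      rw [e1, norm_neg, abs_le] at h1
      have hDx : D x = Metric.infDist x Ωᶜ := rfl
      have hy : x - z ∈ Ω := by
        by_contra h
        have : D (x - z) = 0 := Metric.infDist_zero_of_mem (show x - z ∈ Ωᶜ from h)
        linarith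
      obtain ⟨p, -, hd, hpos, hv⟩ := infDist_add_sub_le hΩ hne hN hy
      have hv := hv (t • v)
      rw [inner_smul_left, norm_smul, Real.norm_of_nonneg ht.le, RCLike.conj_to_real] at hv
      have hdp : dist (x - z) p = D (x - z) := hd.symm
      have hd1 : s / 2 ≤ dist (x - z) p := by rw [hdp]; linarith
      have hd2 : dist (x - z) p ≤ 5 / 2 * s := by rw [hdp]; linarith
      have hxp : dist p x ≤ 3 * s := by
        have := dist_triangle x (x - z) p
        rw [dist_comm x (x - z), dist_eq_norm (x - z) x, e1, norm_neg] at this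
        rw [dist_comm]; linarith
      have h2 : ⟪v, N x⟫ - ⟪v, N p⟫ ≤ 3 * L * s * ‖v‖ := by
        rw [← inner_sub_right]
        refine (real_inner_le_norm _ _).trans ?_
        have h3 := hL.dist_le_mul p x
        rw [dist_eq_norm, norm_sub_rev] at h3
        have h4 : (L : ℝ) * dist p x ≤ L * (3 * s) := mul_le_mul_of_nonneg_left hxp L.2
        nlinarith [mul_le_mul_of_nonneg_left (h3.trans h4) (norm_nonneg v)]
      have h5 : (t * ‖v‖) ^ 2 / (2 * dist (x - z) p) ≤ t ^ 2 * (‖v‖ ^ 2 / s) := by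
        rw [mul_pow, mul_div_assoc]
        gcongr
        linarith
      have h6 := mul_le_mul_of_nonneg_left h2 ht.le
      rw [real_inner_comm (N x) v] at *
      change Metric.infDist _ _ - Metric.infDist _ _ ≤ _
      nlinarith
    have hlim : Tendsto (fun t : ℝ => t⁻¹ * (mollify ρ D (x + t • v) - mollify ρ D x)) (𝓝[>] 0)
        (𝓝 (fderiv ℝ (mollify ρ D) x v)) := by
      have := (hdiff.hasFDerivAt.hasLineDerivAt v).tendsto_slope_zero_right
      simpa using this
    have hlim2 : Tendsto (fun t : ℝ => -⟪N x, v⟫ + 3 * L * s * ‖v‖ + t * (‖v‖ ^ 2 / s)) (𝓝[>] 0)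
        (𝓝 (-⟪N x, v⟫ + 3 * L * s * ‖v‖)) := by
      refine Tendsto.mono_left ?_ nhdsWithin_le_nhds
      have : Continuous fun t : ℝ => -⟪N x, v⟫ + 3 * L * s * ‖v‖ + t * (‖v‖ ^ 2 / s) := by fun_prop
      simpa using this.tendsto 0
    refine le_of_tendsto_of_tendsto hlim hlim2 ?_
    filter_upwards [eventually_mem_nhdsWithin] with t ht
    have ht : 0 < t := ht
    rw [inv_mul_le_iff₀ ht, hρ.mollify_sub_mollify hDc]
    have hint1 := hρ.integrable_smul_comp_sub hDc (x + t • v)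
    have hint2 := hρ.integrable_smul_comp_sub hDc x
    calc ∫ z, ρ z • (D (x + t • v - z) - D (x - z))
        ≤ ∫ z, ρ z * (t * (-⟪N x, v⟫ + 3 * L * s * ‖v‖) + t ^ 2 * (‖v‖ ^ 2 / s)) := by
          refine integral_mono (by simpa only [smul_sub] using! hint1.sub hint2)
            (hρ.integrable.mul_const _) fun z => ?_
          by_cases hz : z ∈ Metric.ball (0 : Space d) (s / 4)
          · have := hpt z hz t ht
            rw [show x - z + t • v = x + t • v - z by abel] at this
            exact mul_le_mul_of_nonneg_left this (hρ.nonneg z)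
          · have : ρ z = 0 := by
              by_contra h0
              exact hz (hρ.support_subset h0)
            simp [this]
      _ = t * (-⟪N x, v⟫ + 3 * L * s * ‖v‖ + t * (‖v‖ ^ 2 / s)) := by
          rw [integral_mul_const, hρ.integral_eq_one]; ring
  rw [abs_le]
  have h1 := key v
  have h2 := key (-v)
  rw [map_neg, inner_neg_right, norm_neg] at h2
  constructor <;> linarith

/-- A cutoff function `η` at scale `s`: it has support in `Ω`, it is `1` at distance at least
`3 s` from the boundary, and its gradient is nearly `-c N`, with `c ≥ 0` of size at most `C / s`,
for the extension `N` of the outer normal. -/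
structure IsBoundaryCutoff (Ω : Set (Space d)) (N : Space d → Space d) (C s : ℝ)
    (η c : Space d → ℝ) : Prop where
  contDiff : ContDiff ℝ 1 η
  nonneg : ∀ x, 0 ≤ η x
  le_one : ∀ x, η x ≤ 1
  tsupport_subset : tsupport η ⊆ Ω
  eq_one : ∀ x ∈ Ω, x ∉ Metric.thickening (3 * s) (frontier Ω) → η x = 1
  eq_zero : ∀ x ∈ Metric.thickening (s / 2) (frontier Ω), η x = 0
  coeff_nonneg : ∀ x, 0 ≤ c x
  coeff_le : ∀ x, c x ≤ C / s
  coeff_eq_zero : ∀ x, x ∉ Metric.thickening (3 * s) (frontier Ω) → c x = 0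
  abs_fderiv_add_le : ∀ x v, |fderiv ℝ η x v + c x * ⟪N x, v⟫| ≤ C * s * c x * ‖v‖

/-- The cutoff at scale `s` is a fixed function of `D / s`, for the regularized distance `D` to the
complement. If the complement is empty, so is the boundary, and the constant `1` serves. -/
lemma exists_isBoundaryCutoff {Ω : Set (Space d)} {N : Space d → Space d} {L : NNReal}
    (hΩ : IsOpen Ω) (hN : ∀ p ∈ frontier Ω, IsOuterNormal Ω p (N p)) (hL : LipschitzWith L N) :
    ∃ C : ℝ, 0 < C ∧ ∀ s : ℝ, 0 < s → ∃ η c, IsBoundaryCutoff Ω N C s η c := by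
  rcases eq_empty_or_nonempty Ωᶜ with he | hne
  · have hu : Ω = univ := compl_empty_iff.1 he
    subst hu
    refine ⟨1, one_pos, fun s hs => ⟨fun _ => 1, fun _ => 0, contDiff_const, by simp, by simp,
      by simp, by simp, by simp, by simp, fun _ => by positivity, by simp, by simp⟩⟩
  set χ : ℝ → ℝ := fun t => Real.smoothTransition (t - 1) with hχ
  have hχc : ContDiff ℝ 1 χ := Real.smoothTransition.contDiff.comp (contDiff_id.sub contDiff_const)
  have hχ0 : ∀ t ≤ 1, χ t = 0 := fun t ht => Real.smoothTransition.zero_of_nonpos (by linarith)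
  have hχ1 : ∀ t, 2 ≤ t → χ t = 1 := fun t ht => Real.smoothTransition.one_of_one_le (by linarith)
  have hχmono : Monotone χ := fun a b hab => Real.smoothTransition.monotone (by linarith)
  have hd0 : ∀ t < 1, deriv χ t = 0 := fun t ht => by
    have : χ =ᶠ[𝓝 t] fun _ => 0 := by
      filter_upwards [Iio_mem_nhds ht] with a ha using hχ0 a (le_of_lt ha)
    rw [this.deriv_eq, deriv_const]
  have hd1 : ∀ t, 2 < t → deriv χ t = 0 := fun t ht => by
    have : χ =ᶠ[𝓝 t] fun _ => 1 := by
      filter_upwards [Ioi_mem_nhds ht] with a ha using hχ1 a (le_of_lt ha)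
    rw [this.deriv_eq, deriv_const]
  obtain ⟨B, hB⟩ : ∃ B, ∀ t, ‖deriv χ t‖ ≤ B := by
    refine HasCompactSupport.exists_bound_of_continuous (HasCompactSupport.intro
      (isCompact_Icc (a := (1 : ℝ)) (b := 2)) fun t ht => ?_) (hχc.continuous_deriv (by norm_num))
    rw [mem_Icc, not_and_or, not_le, not_le] at ht
    exact ht.elim (hd0 t) (hd1 t)
  have hB0 : 0 ≤ B := (norm_nonneg _).trans (hB 0)
  refine ⟨B + 3 * L + 1, by positivity, fun s hs => ?_⟩
  obtain ⟨ρ, hρ⟩ := exists_isMollifier (d := d) (show 0 < s / 4 by positivity)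
  set D : Space d → ℝ := fun y => Metric.infDist y Ωᶜ with hD
  have hDl : LipschitzWith 1 D := Metric.lipschitz_infDist_pt Ωᶜ
  set Dₛ := mollify ρ D with hDs
  have hDsc : ContDiff ℝ 2 Dₛ := hρ.contDiff_mollify hDl.continuous.locallyIntegrable
  have hclose : ∀ x, |Dₛ x - D x| ≤ s / 4 := fun x => by
    refine hρ.norm_mollify_sub_le (by positivity) hDl.continuous.aestronglyMeasurable
      fun y hy => ?_
    have := hDl.dist_le_mul y x
    rw [NNReal.coe_one, one_mul, dist_eq_norm] at this
    exact this.trans (Metric.mem_ball.1 hy).le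
  have hDf : ∀ x r, x ∈ Metric.thickening r (frontier Ω) → D x < r := by
    intro x r hx
    obtain ⟨p, hp, hxp⟩ := Metric.mem_thickening_iff.1 hx
    rw [hΩ.frontier_eq] at hp
    exact (Metric.infDist_le_dist_of_mem (show p ∈ Ωᶜ from hp.2)).trans_lt hxp
  have hDf' : ∀ x ∈ Ω, ∀ r, x ∉ Metric.thickening r (frontier Ω) → r ≤ D x := by
    intro x hx r hxr
    obtain ⟨p, hp, hd, -⟩ := exists_frontier_dist_eq_infDist hΩ hne hx
    by_contra! h
    exact hxr (Metric.mem_thickening_iff.2 ⟨p, hp, by rw [← hd]; exact h⟩)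
  have hD0 : ∀ x ∉ Ω, D x = 0 := fun x hx => Metric.infDist_zero_of_mem hx
  set η : Space d → ℝ := fun x => χ (Dₛ x / s) with hη
  set c : Space d → ℝ := fun x => deriv χ (Dₛ x / s) / s with hc
  have hDs1 : ∀ x, Dₛ x / s < 1 ↔ Dₛ x < s := fun x => by rw [div_lt_one hs]
  have hDs2 : ∀ x, 2 < Dₛ x / s ↔ 2 * s < Dₛ x := fun x => by rw [lt_div_iff₀ hs]
  have hder : ∀ x v, fderiv ℝ η x v = c x * fderiv ℝ Dₛ x v := by
    intro x v
    have h1 : HasFDerivAt (fun x => Dₛ x / s) (s⁻¹ • fderiv ℝ Dₛ x) x := by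
      simpa only [div_eq_mul_inv, mul_comm] using
        ((hDsc.differentiable (by norm_num) x).hasFDerivAt.mul_const s⁻¹)
    have h2 := (hχc.differentiable (by norm_num) (Dₛ x / s)).hasDerivAt.comp_hasFDerivAt x h1
    have h3 : fderiv ℝ η x = deriv χ (Dₛ x / s) • s⁻¹ • fderiv ℝ Dₛ x := h2.fderiv
    rw [h3]
    simp only [smul_apply, smul_eq_mul, hc]
    ring
  refine ⟨η, c, hχc.comp (by fun_prop (disch := norm_num) : ContDiff ℝ 1 fun x => Dₛ x / s),
    fun x => Real.smoothTransition.nonneg _,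
    fun x => Real.smoothTransition.le_one _, ?_, fun x hx hxt => ?_, fun x hx => ?_, fun x => ?_,
    fun x => ?_, fun x hx => ?_, fun x v => ?_⟩
  · have h1 : tsupport η ⊆ {x | 3 / 4 * s ≤ D x} := by
      refine closure_minimal (fun x hx => ?_) (isClosed_le continuous_const hDl.continuous)
      by_contra h
      rw [mem_ofPred_eq, not_le] at h
      have h2 := abs_le.1 (hclose x)
      exact hx (hχ0 _ (((hDs1 x).2 (by linarith)).le))
    intro x hx
    by_contra h
    have := h1 hx
    rw [mem_ofPred_eq, hD0 x h] at this
    linarith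
  · have h1 := hDf' x hx _ hxt
    have h2 := abs_le.1 (hclose x)
    exact hχ1 _ (((hDs2 x).2 (by linarith)).le)
  · have h1 := hDf x _ hx
    have h2 := abs_le.1 (hclose x)
    exact hχ0 _ (((hDs1 x).2 (by linarith)).le)
  · exact div_nonneg hχmono.deriv_nonneg hs.le
  · have h1 : deriv χ (Dₛ x / s) ≤ B := (le_abs_self _).trans (hB _)
    change deriv χ (Dₛ x / s) / s ≤ _
    gcongr
    linarith [L.2, show (0 : ℝ) ≤ L from L.2]
  · change deriv χ (Dₛ x / s) / s = 0
    have h2 := abs_le.1 (hclose x)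
    by_cases hxΩ : x ∈ Ω
    · have h1 := hDf' x hxΩ _ hx
      rw [hd1 _ ((hDs2 x).2 (by linarith)), zero_div]
    · rw [hD0 x hxΩ] at h2
      rw [hd0 _ ((hDs1 x).2 (by linarith)), zero_div]
  · have hc0 : 0 ≤ c x := div_nonneg hχmono.deriv_nonneg hs.le
    rw [hder, ← mul_add, abs_mul, abs_of_nonneg hc0]
    rcases eq_or_ne (c x) 0 with h0 | h0
    · simp [h0]
    have h2 := abs_le.1 (hclose x)
    have hx1 : 3 / 4 * s ≤ D x := by
      by_contra! h
      exact h0 (by change deriv χ (Dₛ x / s) / s = 0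
                   rw [hd0 _ ((hDs1 x).2 (by linarith)), zero_div])
    have hx2 : D x ≤ 9 / 4 * s := by
      by_contra! h
      exact h0 (by change deriv χ (Dₛ x / s) / s = 0
                   rw [hd1 _ ((hDs2 x).2 (by linarith)), zero_div])
    have h3 := abs_fderiv_mollify_infDist_add_le hΩ hne hN hL hs hρ hx1 hx2 v
    have h4 : 3 * (L : ℝ) * s * ‖v‖ ≤ (B + 3 * L + 1) * s * ‖v‖ := by
      gcongr
      linarith
    nlinarith [mul_le_mul_of_nonneg_left (h3.trans h4) hc0]

/-! ### The flux of a function through the boundary -/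

/-- The flux `-∫_Ω u ∇η · φ`. As the cutoff function `η` increases to the indicator function of `Ω`,
it tends to the boundary term of the Gauss–Green formula. -/
def flux (Ω : Set (Space d)) (u η : Space d → ℝ) (φ : Space d → Space d) : ℝ :=
  -∫ x in Ω, u x * fderiv ℝ η x (φ x)

section Flux

variable {Ω : Set (Space d)} {u v η : Space d → ℝ} {φ : Space d → Space d}

lemma integrableOn_mul_fderiv (hu : IntegrableOn u Ω) (hη : ContDiff ℝ 1 η)
    (hφ : Continuous φ) (hc : HasCompactSupport φ) :
    IntegrableOn (fun x => u x * fderiv ℝ η x (φ x)) Ω := by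
  have hcont : Continuous fun x => fderiv ℝ η x (φ x) :=
    (hη.continuous_fderiv (by norm_num)).clm_apply hφ
  have hcs : HasCompactSupport fun x => fderiv ℝ η x (φ x) :=
    hc.mono fun x hx h => hx (by simp [h])
  obtain ⟨C, hC⟩ := hcs.exists_bound_of_continuous hcont
  exact hu.mul_bdd hcont.aestronglyMeasurable (ae_of_all _ hC)

lemma flux_sub_left (hu : IntegrableOn u Ω) (hv : IntegrableOn v Ω) (hη : ContDiff ℝ 1 η)
    (hφ : Continuous φ) (hc : HasCompactSupport φ) :
    flux Ω (fun x => u x - v x) η φ = flux Ω u η φ - flux Ω v η φ := by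
  unfold flux
  simp only [sub_mul]
  rw [integral_sub (integrableOn_mul_fderiv hu hη hφ hc) (integrableOn_mul_fderiv hv hη hφ hc)]
  ring

lemma flux_eq (hu : IntegrableOn u Ω) (hη : ContDiff ℝ 1 η) (hηb : ∀ x, |η x| ≤ 1)
    (hφ : ContDiff ℝ 1 φ) (hc : HasCompactSupport φ) :
    flux Ω u η φ = (∫ x in Ω, u x * (η x * divergence φ x)) +
      pairing Ω u fun x => η x • φ x := by
  have h1 : IntegrableOn (fun x => u x * (η x * divergence φ x)) Ω := by
    have := (integrableOn_mul_divergence hu hφ hc).mul_bdd (c := 1)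
      hη.continuous.aestronglyMeasurable (ae_of_all _ hηb)
    exact this.congr (ae_of_all _ fun x => by ring)
  have h2 := integrableOn_mul_fderiv hu hη hφ.continuous hc
  have h3 : pairing Ω u (fun x => η x • φ x) =
      -((∫ x in Ω, u x * (η x * divergence φ x)) + ∫ x in Ω, u x * fderiv ℝ η x (φ x)) := by
    rw [pairing, ← integral_add h1 h2]
    congr 2
    ext x
    rw [divergence_smul (hη.differentiable (by norm_num) x) (hφ.differentiable (by norm_num) x),
      mul_add]
  rw [h3, flux]
  ring

/-- The flux is bounded by the `BV` norm, uniformly in the cutoff function. -/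
lemma abs_flux_le (hu : IntegrableOn u Ω) (hV : totalVariation Ω u ≠ ⊤) (hη : ContDiff ℝ 1 η)
    (hηb : ∀ x, |η x| ≤ 1) (hηΩ : tsupport η ⊆ Ω) (hφ : ContDiff ℝ 1 φ)
    (hc : HasCompactSupport φ) {D B : ℝ} (hD : ∀ x, |divergence φ x| ≤ D) (hB0 : 0 < B)
    (hB : ∀ x, ‖φ x‖ ≤ B) :
    |flux Ω u η φ| ≤ D * (∫ x in Ω, |u x|) + B * (totalVariation Ω u).toReal := by
  have hmem := smul_mem_testFields hη hηΩ hφ hc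
  have hb : ∀ x, ‖η x • φ x‖ ≤ B := fun x => by
    rw [norm_smul]
    exact (mul_le_mul (hηb x) (hB x) (norm_nonneg _) zero_le_one).trans_eq (one_mul B)
  have h1 := pairing_le_mul_toReal hV hmem hB0 hb
  have h2 := pairing_le_mul_toReal hV (testFields_neg hmem) hB0 (by simpa using hb)
  rw [pairing_neg_right] at h2
  have h3 : |∫ x in Ω, u x * (η x * divergence φ x)| ≤ D * ∫ x in Ω, |u x| := by
    rw [← integral_const_mul]
    refine norm_integral_le_of_norm_le (μ := volume.restrict Ω)
      (f := fun x => u x * (η x * divergence φ x)) (hu.abs.const_mul D)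
      (ae_of_all _ fun x => ?_)
    rw [norm_mul, norm_mul, mul_comm]
    refine mul_le_mul_of_nonneg_right ?_ (abs_nonneg _)
    exact (mul_le_mul (hηb x) (hD x) (abs_nonneg _) zero_le_one).trans_eq (one_mul D)
  rw [flux_eq hu hη hηb hφ hc]
  refine (abs_add_le _ _).trans (add_le_add h3 ?_)
  rw [abs_le]
  constructor <;> linarith

end Flux

/-- A compact subset of an open set stays away from the boundary. -/
lemma exists_disjoint_thickening_frontier {Ω K : Set (Space d)} (hΩ : IsOpen Ω) (hK : IsCompact K)
    (hKΩ : K ⊆ Ω) : ∃ δ > 0, Disjoint (Metric.thickening δ (frontier Ω)) K := by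
  have hd : Disjoint (frontier Ω) K := by
    rw [hΩ.frontier_eq]
    exact disjoint_left.2 fun x hx hxK => hx.2 (hKΩ hxK)
  obtain ⟨δ, hδ, h⟩ := hd.symm.exists_thickenings hK isClosed_frontier
  exact ⟨δ, hδ, (h.mono_left (Metric.self_subset_thickening hδ K)).symm⟩

section Sequence

variable {Ω : Set (Space d)} {N : Space d → Space d} {C : ℝ} {η c : ℕ → Space d → ℝ}
  {u u' g g' : Space d → ℝ} {φ : Space d → Space d}

lemma IsBoundaryCutoff.abs_le_one {s : ℝ} {η c : Space d → ℝ}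
    (h : IsBoundaryCutoff Ω N C s η c) (x : Space d) : |η x| ≤ 1 := by
  rw [abs_of_nonneg (h.nonneg x)]
  exact h.le_one x

lemma eventually_cutoff_eq_one (hΩ : IsOpen Ω)
    (hη : ∀ k : ℕ, IsBoundaryCutoff Ω N C (1 / ((k : ℝ) + 1)) (η k) (c k)) {x : Space d}
    (hx : x ∈ Ω) : ∀ᶠ k in atTop, η k x = 1 := by
  obtain ⟨δ, hδ, hd⟩ := exists_disjoint_thickening_frontier hΩ isCompact_singleton
    (singleton_subset_iff.2 hx)
  have hlim := tendsto_one_div_add_atTop_nhds_zero_nat (𝕜 := ℝ)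
  filter_upwards [hlim.eventually (Iio_mem_nhds (show 0 < δ / 3 by positivity))] with k hk
  refine (hη k).eq_one x hx fun hxt => ?_
  have hk : 1 / ((k : ℝ) + 1) < δ / 3 := hk
  exact disjoint_left.1 hd (Metric.thickening_mono (by linarith) _ hxt) rfl

/-- The limit of the fluxes is the boundary term of the Gauss–Green formula. -/
lemma tendsto_flux (hΩ : IsOpen Ω)
    (hη : ∀ k : ℕ, IsBoundaryCutoff Ω N C (1 / ((k : ℝ) + 1)) (η k) (c k))
    (hu : IntegrableOn u Ω) {μ : Measure (Space d)} {σ : Space d → Space d}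
    (hμ : IsGradientMeasure Ω u μ σ) (hφ : ContDiff ℝ 1 φ) (hc : HasCompactSupport φ) :
    Tendsto (fun k => flux Ω u (η k) φ) atTop
      (𝓝 ((∫ x in Ω, u x * divergence φ x) + ∫ x, ⟪φ x, σ x⟫ ∂μ)) := by
  have := hμ.isFiniteMeasure
  obtain ⟨B, hB⟩ := hc.exists_bound_of_continuous hφ.continuous
  have heq : ∀ k, flux Ω u (η k) φ = (∫ x in Ω, u x * (η k x * divergence φ x)) +
      ∫ x, η k x * ⟪φ x, σ x⟫ ∂μ := fun k => by
    rw [flux_eq hu (hη k).contDiff (hη k).abs_le_one hφ hc, pairing,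
      hμ.integral_eq _ (smul_mem_testFields (hη k).contDiff (hη k).tsupport_subset hφ hc), neg_neg]
    simp only [inner_smul_left, RCLike.conj_to_real]
  simp only [heq]
  refine Tendsto.add ?_ ?_
  · refine tendsto_integral_of_dominated_convergence (fun x => |u x * divergence φ x|)
      (fun k => ?_) (integrableOn_mul_divergence hu hφ hc).abs
      (fun k => ae_of_all _ fun x => ?_) ?_
    · exact hu.aestronglyMeasurable.mul ((hη k).contDiff.continuous.mul
        (continuous_divergence hφ)).aestronglyMeasurable
    · rw [show u x * (η k x * divergence φ x) = η k x * (u x * divergence φ x) by ring, norm_mul,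
        Real.norm_eq_abs, Real.norm_eq_abs]
      exact mul_le_of_le_one_left (abs_nonneg _) ((hη k).abs_le_one x)
    · filter_upwards [ae_restrict_mem hΩ.measurableSet] with x hx
      refine tendsto_const_nhds.congr' ?_
      filter_upwards [eventually_cutoff_eq_one hΩ hη hx] with k hk
      rw [hk, one_mul]
  · have hmeas : AEStronglyMeasurable (fun x => ⟪φ x, σ x⟫) μ :=
      hφ.continuous.aestronglyMeasurable.inner hμ.aestronglyMeasurable
    refine tendsto_integral_of_dominated_convergence (fun _ => B)
      (fun k => (hη k).contDiff.continuous.aestronglyMeasurable.mul hmeas) (integrable_const B)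
      (fun k => ?_) ?_
    · filter_upwards [hμ.norm_eq_one] with x hx
      rw [norm_mul, Real.norm_eq_abs, Real.norm_eq_abs]
      refine (mul_le_of_le_one_left (abs_nonneg _) ((hη k).abs_le_one x)).trans ?_
      refine (abs_real_inner_le_norm _ _).trans ?_
      rw [hx, mul_one]
      exact hB x
    · have : ∀ᵐ x ∂μ, x ∈ Ω := hμ.measure_compl
      filter_upwards [this] with x hx
      refine tendsto_const_nhds.congr' ?_
      filter_upwards [eventually_cutoff_eq_one hΩ hη hx] with k hk
      rw [hk, one_mul]

/-- The trace is the density of the limit of the fluxes. -/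
lemma isTrace_iff (hΩ : IsOpen Ω)
    (hη : ∀ k : ℕ, IsBoundaryCutoff Ω N C (1 / ((k : ℝ) + 1)) (η k) (c k)) (hu : IsBV Ω u) :
    IsTrace Ω u g ↔ Integrable g (surfaceMeasure Ω) ∧
      ∀ φ : Space d → Space d, ContDiff ℝ 1 φ → HasCompactSupport φ →
        Tendsto (fun k => flux Ω u (η k) φ) atTop
          (𝓝 (∫ x, g x * ⟪φ x, outerNormal Ω x⟫ ∂(surfaceMeasure Ω))) := by
  constructor
  · rintro ⟨hg, μ, σ, hμ, h⟩
    refine ⟨hg, fun φ hφ hc => ?_⟩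
    have h1 := tendsto_flux hΩ hη hu.1 hμ hφ hc
    rwa [h φ hφ hc, neg_add_cancel_comm] at h1
  · rintro ⟨hg, h⟩
    obtain ⟨μ, σ, hμ⟩ := exists_isGradientMeasure hΩ hu.1 hu.2.ne
    refine ⟨hg, μ, σ, hμ, fun φ hφ hc => ?_⟩
    have h1 := tendsto_nhds_unique (h φ hφ hc) (tendsto_flux hΩ hη hu.1 hμ hφ hc)
    rw [h1]
    ring

lemma IsBV.sub (hu : IsBV Ω u) (hu' : IsBV Ω u') : IsBV Ω fun x => u x - u' x :=
  ⟨hu.1.sub hu'.1, (totalVariation_sub_le hu.1 hu'.1).trans_lt (ENNReal.add_lt_top.2 ⟨hu.2, hu'.2⟩)⟩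

lemma norm_outerNormal_le (Ω : Set (Space d)) (x : Space d) : ‖outerNormal Ω x‖ ≤ 1 := by
  unfold outerNormal
  split_ifs with h
  · exact h.choose_spec.1.le
  · simp

end Sequence

/-! ### The trace inequality -/

/-- `N` is a Lipschitz extension of the outer normal of `Ω`, of norm at most one. -/
structure IsNormalExtension (Ω : Set (Space d)) (L : NNReal) (N : Space d → Space d) : Prop where
  lipschitzWith : LipschitzWith L N
  norm_le_one : ∀ x, ‖N x‖ ≤ 1
  isOuterNormal : ∀ x ∈ frontier Ω, IsOuterNormal Ω x (N x)

lemma IsUniformlyC2Domain.exists_isNormalExtension {Ω : Set (Space d)}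
    (hΩ : IsUniformlyC2Domain Ω) : ∃ L N, IsNormalExtension Ω L N := by
  obtain ⟨L, N, hL, hN1, hN⟩ := hΩ.exists_lipschitz_extension
  obtain ⟨r, K, hr, hK, h⟩ := hΩ.exists_isParabolicNormal
  exact ⟨L, N, hL, hN1, fun x hx => by rw [hN x hx]; exact (h x hx).isOuterNormal hr hK⟩

lemma ae_mem_frontier (Ω : Set (Space d)) : ∀ᵐ x ∂(surfaceMeasure Ω), x ∈ frontier Ω :=
  ae_restrict_mem isClosed_frontier.measurableSet

lemma IsUniformlyC2Domain.isFiniteMeasureOnCompacts {Ω : Set (Space d)}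
    (hΩ : IsUniformlyC2Domain Ω) : IsFiniteMeasureOnCompacts (surfaceMeasure Ω) :=
  ⟨fun _ hA => (hΩ.exists_strip_bound hA).1⟩

/-- Cutoff functions on balls, with the natural bound on the gradient. -/
lemma exists_cutoff_ball (d : ℕ) : ∃ C : ℝ, 0 < C ∧ ∀ R : ℝ, 0 < R → ∃ θ : Space d → ℝ,
    ContDiff ℝ 1 θ ∧ HasCompactSupport θ ∧ (∀ x, 0 ≤ θ x) ∧ (∀ x, θ x ≤ 1) ∧
      (∀ x ∈ Metric.closedBall (0 : Space d) R, θ x = 1) ∧ ∀ x, ‖fderiv ℝ θ x‖ ≤ C / R := by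
  let b : ContDiffBump (0 : Space d) := ⟨1, 2, one_pos, one_lt_two⟩
  have hb : ContDiff ℝ 1 b := b.contDiff
  obtain ⟨C, hC⟩ := (b.hasCompactSupport.fderiv (𝕜 := ℝ)).exists_bound_of_continuous
    (hb.continuous_fderiv (by norm_num))
  refine ⟨max C 1, by positivity, fun R hR => ⟨fun x => b (R⁻¹ • x),
    hb.comp (contDiff_id.const_smul R⁻¹), ?_, fun x => b.nonneg, fun x => b.le_one,
    fun x hx => b.one_of_mem_closedBall ?_, fun x => ?_⟩⟩
  · exact b.hasCompactSupport.comp_homeomorph (Homeomorph.smulOfNeZero R⁻¹ (inv_ne_zero hR.ne'))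
  · rw [mem_closedBall_zero_iff] at hx ⊢
    rw [norm_smul, norm_inv, Real.norm_of_nonneg hR.le]
    change R⁻¹ * ‖x‖ ≤ 1
    rwa [inv_mul_le_iff₀ hR, mul_one]
  · rw [fderiv_comp_smul, norm_smul, norm_inv, Real.norm_of_nonneg hR.le, div_eq_inv_mul]
    gcongr
    exact (hC _).trans (le_max_left _ _)

lemma IsMollifier.norm_mollify_sub_self_le {ρ : Space d → ℝ} {ε : ℝ} (h : IsMollifier ρ ε)
    (hε : 0 < ε) {N : Space d → Space d} {L : NNReal} (hL : LipschitzWith L N) (x : Space d) :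
    ‖mollify ρ N x - N x‖ ≤ L * ε := by
  refine h.norm_mollify_sub_le (by positivity) hL.continuous.aestronglyMeasurable fun y hy => ?_
  have := hL.dist_le_mul y x
  rw [dist_eq_norm] at this
  exact this.trans (mul_le_mul_of_nonneg_left (Metric.mem_ball.1 hy).le L.2)

lemma hasCompactSupport_mollify {F : Type*} [NormedAddCommGroup F] [NormedSpace ℝ F]
    {ρ : Space d → ℝ} {ε : ℝ} (h : IsMollifier ρ ε) {f : Space d → F} (hf : HasCompactSupport f) :
    HasCompactSupport (mollify ρ f) := by
  rw [mollify_eq_convolution]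
  exact h.hasCompactSupport.convolution _ hf

/-- The `L¹` norm is the supremum of the integrals against smooth compactly supported functions with
values in `[-1, 1]`. -/
lemma integral_abs_le_of_forall {m : Measure (Space d)} {g : Space d → ℝ} (hg : Integrable g m)
    {A : ℝ} (h : ∀ f : Space d → ℝ, ContDiff ℝ 1 f → HasCompactSupport f → (∀ x, |f x| ≤ 1) →
      ∫ x, g x * f x ∂m ≤ A) : ∫ x, |g x| ∂m ≤ A := by
  have hgm : AEMeasurable (fun x => ‖g x‖₊) m := hg.aestronglyMeasurable.aemeasurable.nnnorm
  set m' : Measure (Space d) := m.withDensity fun x => ((‖g x‖₊ : NNReal) : ℝ≥0∞) with hm'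
  have hfin : IsFiniteMeasure m' := isFiniteMeasure_withDensity hg.2.ne
  -- the sign of `g`
  set S : Space d → ℝ := fun x => g x / |g x| with hS
  have hSm : AEStronglyMeasurable S m' :=
    ((hg.aestronglyMeasurable.aemeasurable.div
      (continuous_abs.measurable.comp_aemeasurable
        hg.aestronglyMeasurable.aemeasurable)).aestronglyMeasurable).mono_ac
      (withDensity_absolutelyContinuous _ _)
  have hSb : ∀ x, |S x| ≤ 1 := fun x => by
    rw [hS, abs_div, abs_abs]
    exact div_self_le_one _
  have hSi : Integrable S m' := Integrable.of_bound hSm 1 (ae_of_all _ hSb)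
  refine le_of_forall_pos_le_add fun κ hκ => ?_
  set M := m'.real univ with hM
  have hM0 : 0 ≤ M := measureReal_nonneg
  set ε := κ / (1 + M) with hε
  have hε0 : 0 < ε := by positivity
  obtain ⟨f, hfc, hfS, hfcont, hfi⟩ := hSi.exists_hasCompactSupport_integral_sub_le hε0
  set f₁ : Space d → ℝ := fun x => max (-1) (min 1 (f x)) with hf₁
  have hf₁c : Continuous f₁ := by fun_prop
  have hf₁s : HasCompactSupport f₁ := hfc.mono fun x hx h0 => hx (by simp [hf₁, h0])
  have hf₁b : ∀ x, |f₁ x| ≤ 1 := fun x => abs_le.2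
    ⟨le_max_left _ _, max_le (by norm_num) (min_le_left _ _)⟩
  have hf₁S : ∀ x, |S x - f₁ x| ≤ |S x - f x| := fun x => by
    have h1 := abs_le.1 (hSb x)
    rw [hf₁]
    dsimp only
    rcases le_total (f x) 1 with h2 | h2
    · rw [min_eq_right h2]
      rcases le_total (-1) (f x) with h3 | h3
      · rw [max_eq_right h3]
      · rw [max_eq_left h3, abs_of_nonneg (by linarith), abs_of_nonneg (by linarith)]
        linarith
    · rw [min_eq_left h2, max_eq_right (by norm_num), abs_of_nonpos (by linarith),
        abs_of_nonpos (by linarith)]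
      linarith
  obtain ⟨δ, hδ, huc⟩ := Metric.uniformContinuous_iff.1
    (hf₁s.uniformContinuous_of_continuous hf₁c) ε hε0
  obtain ⟨ρ, hρ⟩ := exists_isMollifier (d := d) hδ
  set f₂ := mollify ρ f₁ with hf₂
  have hf₂C : ContDiff ℝ 2 f₂ := hρ.contDiff_mollify hf₁c.locallyIntegrable
  have hf₂b : ∀ x, |f₂ x| ≤ 1 := fun x => by
    have := hρ.norm_mollify_sub_le (x := x) (w := 0) zero_le_one hf₁c.aestronglyMeasurable
      (fun y _ => by simpa using hf₁b y)
    simpa using this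
  have hf₂₁ : ∀ x, |f₂ x - f₁ x| ≤ ε := fun x =>
    hρ.norm_mollify_sub_le hε0.le hf₁c.aestronglyMeasurable fun y hy => (huc hy).le
  have hmain := h f₂ (hf₂C.of_le (by norm_num)) (hasCompactSupport_mollify hρ hf₁s) hf₂b
  have hgf : Integrable (fun x => g x * f₂ x) m :=
    hg.mul_bdd hf₂C.continuous.aestronglyMeasurable (ae_of_all _ hf₂b)
  have hSf : Integrable (fun x => |S x - f₂ x|) m' :=
    (hSi.sub (Integrable.of_bound hf₂C.continuous.aestronglyMeasurable 1 (ae_of_all _ hf₂b))).abs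
  have hconv : ∫ x, |S x - f₂ x| ∂m' = ∫ x, |g x| * |S x - f₂ x| ∂m := by
    rw [hm', integral_withDensity_eq_integral_smul₀ hgm]
    rfl
  have hint : Integrable (fun x => |g x| * |S x - f₂ x|) m := by
    have := (integrable_withDensity_iff_integrable_smul₀ hgm).1 hSf
    exact this
  have h1 : (∫ x, |g x| ∂m) - ∫ x, g x * f₂ x ∂m ≤ ∫ x, |S x - f₂ x| ∂m' := by
    rw [hconv, ← integral_sub hg.abs hgf]
    refine integral_mono (hg.abs.sub hgf) hint fun x => ?_
    dsimp only
    rcases eq_or_ne (g x) 0 with h0 | h0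
    · simp [h0]
    · have hgS : g x = |g x| * S x := by
        rw [hS]; field_simp
      have hSS : S x * S x = 1 := by
        rw [hS]; dsimp only
        rw [div_mul_div_comm, abs_mul_abs_self, div_self (mul_ne_zero h0 h0)]
      have h3 : 1 - S x * f₂ x ≤ |S x - f₂ x| := by
        rw [← hSS, ← mul_sub]
        refine (le_abs_self _).trans ?_
        rw [abs_mul]
        exact mul_le_of_le_one_left (abs_nonneg _) (hSb x)
      calc |g x| - g x * f₂ x = |g x| * (1 - S x * f₂ x) := by
            conv_lhs => rw [show g x * f₂ x = |g x| * S x * f₂ x by rw [← hgS]]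
            ring
        _ ≤ _ := mul_le_mul_of_nonneg_left h3 (abs_nonneg _)
  have h2 : ∫ x, |S x - f₂ x| ∂m' ≤ ε + ε * M := by
    have h4 : ∫ x, |S x - f₂ x| ∂m' ≤ ∫ x, (‖S x - f x‖ + ε) ∂m' := by
      refine integral_mono hSf ((hSi.sub hfi).norm.add (integrable_const ε)) fun x => ?_
      have := abs_sub_le (S x) (f₁ x) (f₂ x)
      rw [abs_sub_comm (f₁ x)] at this
      exact this.trans (add_le_add (hf₁S x) (hf₂₁ x))
    rw [integral_add (by exact (hSi.sub hfi).norm) (integrable_const ε), integral_const,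
      smul_eq_mul,
      mul_comm] at h4
    linarith
  have h5 : ε + ε * M = κ := by rw [hε]; field_simp
  linarith

section Normal

variable {Ω : Set (Space d)} {N : Space d → Space d} {L : NNReal} {C : ℝ}
  {η c : ℕ → Space d → ℝ} {u u' g g' : Space d → ℝ} {φ : Space d → Space d}

lemma IsNormalExtension.eq_outerNormal (hN : IsNormalExtension Ω L N) {x : Space d}
    (hx : x ∈ frontier Ω) : outerNormal Ω x = N x :=
  (hN.isOuterNormal x hx).outerNormal_eq

lemma IsNormalExtension.ae_eq (hN : IsNormalExtension Ω L N) :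
    outerNormal Ω =ᵐ[surfaceMeasure Ω] N := by
  filter_upwards [ae_mem_frontier Ω] with x hx using hN.eq_outerNormal hx

lemma IsNormalExtension.integrable_mul_inner (hN : IsNormalExtension Ω L N)
    (hg : Integrable g (surfaceMeasure Ω)) (hφ : Continuous φ) {B : ℝ} (hB : ∀ x, ‖φ x‖ ≤ B) :
    Integrable (fun x => g x * ⟪φ x, outerNormal Ω x⟫) (surfaceMeasure Ω) := by
  refine hg.mul_bdd (c := B) ?_ (ae_of_all _ fun x => ?_)
  · refine (hφ.inner hN.lipschitzWith.continuous).aestronglyMeasurable.congr ?_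
    filter_upwards [hN.ae_eq] with x hx
    rw [hx]
  · refine (abs_real_inner_le_norm _ _).trans ?_
    exact (mul_le_of_le_one_right (norm_nonneg _) (norm_outerNormal_le Ω x)).trans (hB x)

lemma IsTrace.sub (hΩ : IsOpen Ω)
    (hη : ∀ k : ℕ, IsBoundaryCutoff Ω N C (1 / ((k : ℝ) + 1)) (η k) (c k))
    (hN : IsNormalExtension Ω L N) (hu : IsBV Ω u) (hu' : IsBV Ω u') (hg : IsTrace Ω u g)
    (hg' : IsTrace Ω u' g') : IsTrace Ω (fun x => u x - u' x) fun x => g x - g' x := by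
  rw [isTrace_iff hΩ hη hu] at hg
  rw [isTrace_iff hΩ hη hu'] at hg'
  rw [isTrace_iff hΩ hη (hu.sub hu')]
  refine ⟨hg.1.sub hg'.1, fun φ hφ hc => ?_⟩
  obtain ⟨B, hB⟩ := hc.exists_bound_of_continuous hφ.continuous
  have h := (hg.2 φ hφ hc).sub (hg'.2 φ hφ hc)
  rw [← integral_sub (hN.integrable_mul_inner hg.1 hφ.continuous hB)
    (hN.integrable_mul_inner hg'.1 hφ.continuous hB)] at h
  simp only [← sub_mul] at h
  refine h.congr fun k => ?_
  rw [flux_sub_left hu.1 hu'.1 (hη k).contDiff hφ.continuous hc]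

/-- A function on the boundary is controlled by its integrals against the normal components of
fields that are multiples of regularizations of the normal. -/
lemma IsNormalExtension.integral_abs_le (hN : IsNormalExtension Ω L N)
    (hg : Integrable g (surfaceMeasure Ω)) {A ε₀ : ℝ} (hε₀ : 0 < ε₀)
    (h : ∀ ε ρ, 0 < ε → ε ≤ ε₀ → IsMollifier ρ ε → ∀ f : Space d → ℝ, ContDiff ℝ 1 f →
      HasCompactSupport f → (∀ x, |f x| ≤ 1) →
      ∫ x, g x * ⟪f x • mollify ρ N x, outerNormal Ω x⟫ ∂(surfaceMeasure Ω) ≤ A) :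
    ∫ x, |g x| ∂(surfaceMeasure Ω) ≤ A := by
  refine integral_abs_le_of_forall hg fun f hf hfc hfb => ?_
  refine le_of_forall_pos_le_add fun κ hκ => ?_
  set I := ∫ x, |g x| ∂(surfaceMeasure Ω) with hI
  have hI0 : 0 ≤ I := integral_nonneg fun x => abs_nonneg _
  set ε := min ε₀ (κ / (L * I + 1)) with hε
  have hεpos : 0 < ε := by positivity
  obtain ⟨ρ, hρ⟩ := exists_isMollifier (d := d) hεpos
  have h1 := h ε ρ hεpos (min_le_left _ _) hρ f hf hfc hfb
  have hN'c : ContDiff ℝ 2 (mollify ρ N) :=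
    hρ.contDiff_mollify hN.lipschitzWith.continuous.locallyIntegrable
  have hN'1 : ∀ x, ‖mollify ρ N x‖ ≤ 1 := fun x => by
    have := hρ.norm_mollify_sub_le (x := x) (w := 0) zero_le_one
      hN.lipschitzWith.continuous.aestronglyMeasurable (fun y _ => by simpa using hN.norm_le_one y)
    simpa using this
  have hb : ∀ x, ‖f x • mollify ρ N x‖ ≤ 1 := fun x => by
    rw [norm_smul]
    exact mul_le_one₀ (hfb x) (norm_nonneg _) (hN'1 x)
  have hi1 := hN.integrable_mul_inner hg (hf.continuous.smul hN'c.continuous) hb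
  have hi2 : Integrable (fun x => g x * f x) (surfaceMeasure Ω) :=
    hg.mul_bdd hf.continuous.aestronglyMeasurable (ae_of_all _ hfb)
  have h2 : (∫ x, g x * f x ∂(surfaceMeasure Ω)) -
      ∫ x, g x * ⟪f x • mollify ρ N x, outerNormal Ω x⟫ ∂(surfaceMeasure Ω) ≤ L * ε * I := by
    rw [← integral_sub hi2 (by exact hi1), hI, ← integral_const_mul]
    refine integral_mono_ae (hi2.sub hi1) (hg.abs.const_mul _) ?_
    filter_upwards [ae_mem_frontier Ω] with x hx
    have h3 := hρ.norm_mollify_sub_self_le hεpos hN.lipschitzWith x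
    have h4 : ⟪mollify ρ N x, N x⟫ - 1 = ⟪mollify ρ N x - N x, N x⟫ := by
      rw [inner_sub_left, real_inner_self_eq_norm_sq, (hN.isOuterNormal x hx).1]; norm_num
    have h5 : |⟪mollify ρ N x, N x⟫ - 1| ≤ L * ε := by
      rw [h4]
      refine (abs_real_inner_le_norm _ _).trans ?_
      rw [(hN.isOuterNormal x hx).1, mul_one]
      exact h3
    rw [hN.eq_outerNormal hx, inner_smul_left, RCLike.conj_to_real, ← mul_sub, mul_comm _ |g x|]
    refine (le_abs_self _).trans ?_
    rw [abs_mul]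
    refine mul_le_mul_of_nonneg_left ?_ (abs_nonneg _)
    rw [show f x - f x * ⟪mollify ρ N x, N x⟫ = -(f x * (⟪mollify ρ N x, N x⟫ - 1)) by ring,
      abs_neg, abs_mul]
    exact (mul_le_of_le_one_left (abs_nonneg _) (hfb x)).trans h5
  have h6 : L * ε * I ≤ κ := by
    have : ε ≤ κ / (L * I + 1) := min_le_right _ _
    rw [le_div_iff₀ (by positivity)] at this
    nlinarith
  linarith

/-- A cutoff function at a small scale decreases in all directions close to the normal. -/
lemma IsNormalExtension.fderiv_cutoff_nonpos (hN : IsNormalExtension Ω L N) {s : ℝ}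
    {η c : Space d → ℝ} (h : IsBoundaryCutoff Ω N C s η c) (hLs : L * s ≤ 1 / 24)
    (hCs : C * s ≤ 1 / 2) {v : Space d} {x : Space d} (hv : ‖v‖ ≤ 1) (hvN : ‖v - N x‖ ≤ 1 / 8) :
    fderiv ℝ η x v ≤ 0 := by
  have h1 := abs_le.1 (h.abs_fderiv_add_le x v)
  by_cases hx : x ∈ Metric.thickening (3 * s) (frontier Ω)
  · obtain ⟨p, hp, hxp⟩ := Metric.mem_thickening_iff.1 hx
    have h2 : ‖N x - N p‖ ≤ 1 / 8 := by
      have := hN.lipschitzWith.dist_le_mul x p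
      rw [dist_eq_norm] at this
      nlinarith [mul_le_mul_of_nonneg_left hxp.le L.2]
    have hp1 : ‖N p‖ = 1 := (hN.isOuterNormal p hp).1
    have h3 : ⟪N x, v⟫ = 1 + ⟪N p, v - N x⟫ + ⟪N p, N x - N p⟫ + ⟪N x - N p, v⟫ := by
      rw [inner_sub_right, inner_sub_right, inner_sub_left, real_inner_self_eq_norm_sq, hp1]
      ring
    have h4 : -(1 / 8) ≤ ⟪N p, v - N x⟫ := by
      have := (abs_le.1 (abs_real_inner_le_norm (N p) (v - N x))).1
      rw [hp1, one_mul] at this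
      linarith
    have h5 : -(1 / 8) ≤ ⟪N p, N x - N p⟫ := by
      have := (abs_le.1 (abs_real_inner_le_norm (N p) (N x - N p))).1
      rw [hp1, one_mul] at this
      linarith
    have h6 : -(1 / 8) ≤ ⟪N x - N p, v⟫ := by
      have := (abs_le.1 (abs_real_inner_le_norm (N x - N p) v)).1
      nlinarith [norm_nonneg (N x - N p), norm_nonneg v]
    have hc := h.coeff_nonneg x
    have h7 : C * s * c x * ‖v‖ ≤ c x * (1 / 2) := by
      have h8 : C * s * c x ≤ 1 / 2 * c x := mul_le_mul_of_nonneg_right hCs hc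
      nlinarith [mul_le_mul_of_nonneg_right h8 (norm_nonneg v), mul_le_mul_of_nonneg_left hv hc]
    nlinarith [mul_le_mul_of_nonneg_left (show 1 / 2 ≤ ⟪N x, v⟫ by linarith) hc]
  · rw [h.coeff_eq_zero x hx] at h1
    linarith [h1.2]

lemma IsBoundaryCutoff.norm_fderiv_le {s : ℝ} {η c : Space d → ℝ}
    (h : IsBoundaryCutoff Ω N C s η c) (hs : 0 < s) (hC : 0 < C) (hN : IsNormalExtension Ω L N)
    (x : Space d) : ‖fderiv ℝ η x‖ ≤ C / s * (1 + C * s) := by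
  refine ContinuousLinearMap.opNorm_le_bound _ (by positivity) fun v => ?_
  have h1 := h.abs_fderiv_add_le x v
  have h2 : |c x * ⟪N x, v⟫| ≤ c x * ‖v‖ := by
    rw [abs_mul, abs_of_nonneg (h.coeff_nonneg x)]
    refine mul_le_mul_of_nonneg_left ((abs_real_inner_le_norm _ _).trans ?_) (h.coeff_nonneg x)
    exact mul_le_of_le_one_left (norm_nonneg _) (hN.norm_le_one x)
  have h3 : |fderiv ℝ η x v| ≤ c x * (1 + C * s) * ‖v‖ := by
    have := abs_add_le (fderiv ℝ η x v + c x * ⟪N x, v⟫) (-(c x * ⟪N x, v⟫))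
    rw [add_neg_cancel_right, abs_neg] at this
    linarith
  refine h3.trans ?_
  gcongr
  exact h.coeff_le x

/-- The trace inequality: the mass of the trace is at most the total variation near the boundary,
up to a multiple of the mass of the function. The constant `1` in front of the total variation is
what makes the bound `|β| ≤ 1` sufficient for lower semicontinuity. -/
theorem exists_trace_bound (hΩ : IsOpen Ω) (hN : IsNormalExtension Ω L N) (hC : 0 < C)
    (hcut : ∀ s : ℝ, 0 < s → ∃ η c, IsBoundaryCutoff Ω N C s η c) {δ : ℝ} (hδ : 0 < δ) :
    ∃ D : ℝ, 0 ≤ D ∧ ∀ w g : Space d → ℝ, IsBV Ω w → IsTrace Ω w g →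
      ∫ x, |g x| ∂(surfaceMeasure Ω) ≤ D * (∫ x in Ω, |w x|) +
        (totalVariation (Ω ∩ Metric.thickening δ (frontier Ω)) w).toReal := by
  set s₀ := δ / 4 with hs₀
  have hs₀pos : 0 < s₀ := by positivity
  obtain ⟨η₀, c₀, h₀⟩ := hcut s₀ hs₀pos
  set G := C / s₀ * (1 + C * s₀) with hG
  have hG0 : 0 < G := by positivity
  refine ⟨d * L + 1 + G, by positivity, fun w g hw hg => ?_⟩
  choose η c hη using fun k : ℕ => hcut (1 / ((k : ℝ) + 1)) (by positivity)
  obtain ⟨hgi, hlim⟩ := (isTrace_iff hΩ hη hw).1 hg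
  set U := Ω ∩ Metric.thickening δ (frontier Ω) with hU
  have hUo : IsOpen U := hΩ.inter Metric.isOpen_thickening
  have hUΩ : U ⊆ Ω := inter_subset_left
  have hVU : totalVariation U w ≠ ⊤ :=
    ((totalVariation_mono hΩ.measurableSet hUΩ).trans_lt hw.2).ne
  -- at these scales the regularized normal is within `1 / 8` of `N`
  refine hN.integral_abs_le hgi (ε₀ := 1 / (8 * (L + 1))) (by positivity)
    fun ε ρ hε hε₀ hρ f hf hfc hfb => ?_
  set N' := mollify ρ N with hN'
  have hN'c : ContDiff ℝ 1 N' :=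
    (hρ.contDiff_mollify hN.lipschitzWith.continuous.locallyIntegrable).of_le (by norm_num)
  have hN'1 : ∀ x, ‖N' x‖ ≤ 1 := fun x => by
    have := hρ.norm_mollify_sub_le (x := x) (w := 0) zero_le_one
      hN.lipschitzWith.continuous.aestronglyMeasurable (fun y _ => by simpa using hN.norm_le_one y)
    simpa using this
  have hN'L : LipschitzWith L N' := hρ.lipschitzWith_mollify hN.lipschitzWith
  have hN'N : ∀ x, ‖N' x - N x‖ ≤ 1 / 8 := fun x => by
    refine (hρ.norm_mollify_sub_self_le hε hN.lipschitzWith x).trans ?_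
    rw [le_div_iff₀ (by positivity)] at hε₀
    nlinarith
  -- a cutoff function that is `1` on the support of `f`, with a gradient of size at most `1`
  obtain ⟨Cθ, hCθ, hθ⟩ := exists_cutoff_ball d
  obtain ⟨R₀, hR₀⟩ := hfc.isBounded.subset_closedBall (0 : Space d)
  obtain ⟨θ, hθc, hθs, hθ0, hθ1, hθone, hθd⟩ := hθ (max Cθ R₀) (by positivity)
  have hθd : ∀ x, ‖fderiv ℝ θ x‖ ≤ 1 := fun x =>
    (hθd x).trans ((div_le_one (by positivity)).2 (le_max_left _ _))
  have hfθ : ∀ x, |f x| ≤ θ x := fun x => by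
    by_cases hx : x ∈ tsupport f
    · rw [hθone x (Metric.closedBall_subset_closedBall (le_max_right _ _) (hR₀ hx))]
      exact hfb x
    · rw [image_eq_zero_of_notMem_tsupport hx, abs_zero]
      exact hθ0 x
  -- the fixed cutoff `1 - η₀` localizes to `U`; its gradient accounts for the constant `G`
  set ζ : Space d → ℝ := fun x => θ x * (1 - η₀ x) with hζ
  have hη₀c := h₀.contDiff
  have hζc : ContDiff ℝ 1 ζ := by fun_prop
  have hζs : HasCompactSupport ζ := hθs.mul_right
  have hζ0 : ∀ x, 0 ≤ ζ x := fun x => mul_nonneg (hθ0 x) (by linarith [h₀.le_one x])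
  have hζ1 : ∀ x, ζ x ≤ 1 := fun x =>
    mul_le_one₀ (hθ1 x) (by linarith [h₀.le_one x]) (by linarith [h₀.nonneg x])
  have hζd : ∀ x, ‖fderiv ℝ ζ x‖ ≤ 1 + G := fun x => by
    have h1 : HasFDerivAt (fun x => 1 - η₀ x) (-fderiv ℝ η₀ x) x :=
      ((hη₀c.differentiable (by norm_num) x).hasFDerivAt).const_sub 1
    have h2 := (hθc.differentiable (by norm_num) x).hasFDerivAt.mul h1
    have h3 : fderiv ℝ ζ x = θ x • -fderiv ℝ η₀ x + (1 - η₀ x) • fderiv ℝ θ x := h2.fderiv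
    rw [h3, add_comm 1 G]
    refine (norm_add_le _ _).trans (add_le_add ?_ ?_)
    · rw [norm_smul, norm_neg, Real.norm_of_nonneg (hθ0 x)]
      exact (mul_le_of_le_one_left (norm_nonneg _) (hθ1 x)).trans
        (h₀.norm_fderiv_le hs₀pos hC hN x)
    · rw [norm_smul, Real.norm_of_nonneg (by linarith [h₀.le_one x])]
      exact mul_le_one₀ (by linarith [h₀.nonneg x]) (norm_nonneg _) (hθd x)
  set ψ : Space d → Space d := fun x => ζ x • N' x with hψ
  have hψc : ContDiff ℝ 1 ψ := by fun_prop
  have hψs : HasCompactSupport ψ := hζs.smul_right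
  have hψdiv : ∀ x, |divergence ψ x| ≤ d * L + 1 + G := fun x => by
    rw [divergence_smul (hζc.differentiable (by norm_num) x)
      (hN'c.differentiable (by norm_num) x), add_assoc]
    refine (abs_add_le _ _).trans (add_le_add ?_ ?_)
    · rw [abs_mul, abs_of_nonneg (hζ0 x)]
      refine (mul_le_of_le_one_left (abs_nonneg _) (hζ1 x)).trans ?_
      refine (abs_divergence_le N' x).trans ?_
      gcongr
      exact norm_fderiv_le_of_lipschitz ℝ hN'L
    · refine ((fderiv ℝ ζ x).le_opNorm _).trans ?_
      exact (mul_le_of_le_one_right (norm_nonneg _) (hN'1 x)).trans (hζd x)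
  -- it suffices to bound the fluxes at small scales
  refine le_of_tendsto (hlim (fun x => f x • N' x) (by fun_prop) hfc.smul_right) ?_
  have hsk := tendsto_one_div_add_atTop_nhds_zero_nat (𝕜 := ℝ)
  filter_upwards [hsk.eventually (Iio_mem_nhds (show 0 < 1 / (24 * ((L : ℝ) + 1)) by positivity)),
    hsk.eventually (Iio_mem_nhds (show 0 < 1 / (2 * C) by positivity)),
    hsk.eventually (Iio_mem_nhds (show 0 < s₀ / 6 by positivity))] with k hk1 hk2 hk3
  have hspos : 0 < 1 / ((k : ℝ) + 1) := by positivity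
  have hk := hη k
  set s := 1 / ((k : ℝ) + 1) with hs
  have hk1 : s < 1 / (24 * ((L : ℝ) + 1)) := hk1
  have hk2 : s < 1 / (2 * C) := hk2
  have hk3 : s < s₀ / 6 := hk3
  rw [lt_div_iff₀ (by positivity)] at hk1 hk2
  have hsign : ∀ x, fderiv ℝ (η k) x (N' x) ≤ 0 := fun x =>
    hN.fderiv_cutoff_nonpos hk (by nlinarith [L.2, show (0 : ℝ) ≤ L from L.2])
      (by nlinarith) (hN'1 x) (hN'N x)
  -- the gradient of `η k` lives where `η₀` vanishes
  have hη₀ : ∀ x, fderiv ℝ (η k) x (N' x) ≠ 0 → η₀ x = 0 := fun x hx => by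
    refine h₀.eq_zero x ?_
    by_contra h
    have h1 : x ∉ Metric.thickening (3 * s) (frontier Ω) := fun h2 =>
      h (Metric.thickening_mono (by linarith) _ h2)
    have h2 := hk.abs_fderiv_add_le x (N' x)
    rw [hk.coeff_eq_zero x h1, zero_mul, add_zero, mul_zero, zero_mul] at h2
    exact hx (abs_eq_zero.1 (le_antisymm h2 (abs_nonneg _)))
  -- as `-∇η · N' ≥ 0`, replacing `w f` by `|w| θ` increases the flux
  have hle1 : flux Ω w (η k) (fun x => f x • N' x) ≤ flux Ω (fun x => |w x|) (η k) ψ := by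
    have hi1 := integrableOn_mul_fderiv (u := w) (φ := fun x => f x • N' x) hw.1 hk.contDiff
      (by fun_prop) hfc.smul_right
    have hi2 := integrableOn_mul_fderiv (u := fun x => |w x|) (φ := ψ) hw.1.abs hk.contDiff
      hψc.continuous hψs
    unfold flux
    rw [← integral_neg, ← integral_neg]
    refine integral_mono hi1.neg hi2.neg fun x => ?_
    dsimp only
    rw [hψ]
    dsimp only
    rw [map_smul, map_smul, smul_eq_mul, smul_eq_mul]
    by_cases hx : fderiv ℝ (η k) x (N' x) = 0
    · rw [hx]; simp
    · have h1 : |w x| * |f x| ≤ |w x| * θ x := mul_le_mul_of_nonneg_left (hfθ x) (abs_nonneg _)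
      have h2 : w x * f x ≤ |w x| * |f x| := by rw [← abs_mul]; exact le_abs_self _
      rw [hζ]; dsimp only
      rw [hη₀ x hx, sub_zero, mul_one]
      nlinarith [hsign x]
  have hmem : (fun x => η k x • ψ x) ∈ testFields U := by
    have hm := smul_mem_testFields hk.contDiff hk.tsupport_subset hψc hψs
    refine ⟨hm.1, hm.2.1, fun x hx => ⟨hm.2.2 hx, ?_⟩⟩
    by_contra hxt
    have hxΩ := hm.2.2 hx
    refine notMem_tsupport_iff_eventuallyEq.2 ?_ hx
    filter_upwards [Metric.ball_mem_nhds x hs₀pos, hΩ.mem_nhds hxΩ] with y hy hyΩ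
    have hy3 : y ∉ Metric.thickening (3 * s₀) (frontier Ω) := fun hyt => by
      obtain ⟨p, hp, hyp⟩ := Metric.mem_thickening_iff.1 hyt
      refine hxt (Metric.mem_thickening_iff.2 ⟨p, hp, ?_⟩)
      rw [Metric.mem_ball, dist_comm] at hy
      linarith [dist_triangle x y p]
    simp [hψ, hζ, h₀.eq_one y hyΩ hy3]
  have hpair : pairing Ω (fun x => |w x|) (fun x => η k x • ψ x) ≤
      (totalVariation U w).toReal := by
    rw [pairing_eq_of_subset hΩ.measurableSet hUΩ hmem.2.2]
    refine pairing_abs_le hUo (hw.1.mono_set hUΩ) hVU hmem fun x => ?_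
    rw [norm_smul, hψ]
    dsimp only
    rw [norm_smul, Real.norm_of_nonneg (hζ0 x)]
    exact mul_le_one₀ (hk.abs_le_one x) (mul_nonneg (hζ0 x) (norm_nonneg _))
      (mul_le_one₀ (hζ1 x) (norm_nonneg _) (hN'1 x))
  have hint : ∫ x in Ω, |w x| * (η k x * divergence ψ x) ≤
      (d * L + 1 + G) * ∫ x in Ω, |w x| := by
    rw [← integral_const_mul]
    refine (le_abs_self _).trans (norm_integral_le_of_norm_le (μ := volume.restrict Ω)
      (f := fun x => |w x| * (η k x * divergence ψ x)) (hw.1.abs.const_mul _)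
      (ae_of_all _ fun x => ?_))
    rw [norm_mul, norm_mul, Real.norm_eq_abs, abs_abs, mul_comm]
    refine mul_le_mul_of_nonneg_right ?_ (abs_nonneg _)
    exact (mul_le_of_le_one_left (norm_nonneg _) (hk.abs_le_one x)).trans (hψdiv x)
  refine hle1.trans ?_
  rw [flux_eq hw.1.abs hk.contDiff hk.abs_le_one hψc hψs]
  exact add_le_add hint hpair

end Normal

/-! ### Existence and uniqueness of the trace -/

section Existence

variable {Ω : Set (Space d)} {N : Space d → Space d} {L : NNReal} {C : ℝ}
  {η c : ℕ → Space d → ℝ} {u w g g' : Space d → ℝ} {φ ψ : Space d → Space d}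

/-- The trace is unique, because the limit of the fluxes does not depend on the choice of the
gradient measure. -/
lemma IsTrace.ae_eq (hΩ : IsOpen Ω) (hN : IsNormalExtension Ω L N)
    (hη : ∀ k : ℕ, IsBoundaryCutoff Ω N C (1 / ((k : ℝ) + 1)) (η k) (c k))
    (hu : IsBV Ω u) (hg : IsTrace Ω u g) (hg' : IsTrace Ω u g') :
    g =ᵐ[surfaceMeasure Ω] g' := by
  obtain ⟨hgi, hg⟩ := (isTrace_iff hΩ hη hu).1 hg
  obtain ⟨hgi', hg'⟩ := (isTrace_iff hΩ hη hu).1 hg'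
  have h0 : ∫ x, |g x - g' x| ∂(surfaceMeasure Ω) ≤ 0 := by
    refine hN.integral_abs_le (g := fun x => g x - g' x) (hgi.sub hgi') one_pos
      fun ε ρ _ _ hρ f hf hfc _ => ?_
    have hN' : ContDiff ℝ 1 (mollify ρ N) :=
      (hρ.contDiff_mollify hN.lipschitzWith.continuous.locallyIntegrable).of_le (by norm_num)
    have hφ : ContDiff ℝ 1 fun x => f x • mollify ρ N x := by fun_prop
    have hφc : HasCompactSupport fun x => f x • mollify ρ N x := hfc.smul_right
    obtain ⟨B, hB⟩ := hφc.exists_bound_of_continuous hφ.continuous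
    have h1 := tendsto_nhds_unique (hg _ hφ hφc) (hg' _ hφ hφc)
    simp only [sub_mul]
    rw [integral_sub (hN.integrable_mul_inner hgi hφ.continuous hB)
      (hN.integrable_mul_inner hgi' hφ.continuous hB), h1, sub_self]
  have h1 : ∫ x, |g x - g' x| ∂(surfaceMeasure Ω) = 0 :=
    le_antisymm h0 (integral_nonneg fun x => abs_nonneg _)
  have h2 := (integral_eq_zero_iff_of_nonneg (fun x => abs_nonneg _) (hgi.sub hgi').abs).1 h1
  filter_upwards [h2] with x hx
  exact sub_eq_zero.1 (abs_eq_zero.1 hx)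

lemma flux_add_right (hu : IntegrableOn u Ω) {η : Space d → ℝ} (hη : ContDiff ℝ 1 η)
    (hφ : Continuous φ) (hφc : HasCompactSupport φ) (hψ : Continuous ψ)
    (hψc : HasCompactSupport ψ) : flux Ω u η (φ + ψ) = flux Ω u η φ + flux Ω u η ψ := by
  unfold flux
  simp only [Pi.add_apply, map_add, mul_add]
  rw [integral_add (integrableOn_mul_fderiv hu hη hφ hφc) (integrableOn_mul_fderiv hu hη hψ hψc)]
  ring

lemma flux_const_smul_right (a : ℝ) {η : Space d → ℝ} :
    flux Ω u η (a • φ) = a * flux Ω u η φ := by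
  unfold flux
  rw [mul_neg, ← integral_const_mul]
  congr 2
  ext x
  rw [Pi.smul_apply, map_smul, smul_eq_mul]
  ring

/-- For a bounded function with bounded support, the limit flux is controlled by the normal
component of the field on the boundary. -/
lemma IsUniformlyC2Domain.exists_abs_limit_flux_le (hΩ : IsUniformlyC2Domain Ω)
    (hN : IsNormalExtension Ω L N) (hC : 0 < C)
    (hη : ∀ k : ℕ, IsBoundaryCutoff Ω N C (1 / ((k : ℝ) + 1)) (η k) (c k)) {M R : ℝ} (hM : 0 ≤ M)
    (hwM : ∀ x, |w x| ≤ M) (hwR : ∀ x ∉ Metric.closedBall (0 : Space d) R, w x = 0) :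
    ∃ E : ℝ, 0 ≤ E ∧ ∀ φ : Space d → Space d, Continuous φ → HasCompactSupport φ → ∀ T : ℝ,
      Tendsto (fun k => flux Ω w (η k) φ) atTop (𝓝 T) →
        |T| ≤ E * ∫ x, |⟪φ x, N x⟫| ∂(surfaceMeasure Ω) := by
  have := hΩ.isFiniteMeasureOnCompacts
  set A := Metric.closedBall (0 : Space d) R with hA
  obtain ⟨-, CA, hCA⟩ := hΩ.exists_strip_bound (isCompact_closedBall (0 : Space d) R)
  refine ⟨3 * M * C * CA, by positivity, fun φ hφ hφc T hT => ?_⟩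
  have hNc := hN.lipschitzWith.continuous
  have hac : Continuous fun x => |⟪φ x, N x⟫| := by fun_prop
  have has : HasCompactSupport fun x => |⟪φ x, N x⟫| := hφc.mono fun x hx h0 => hx (by simp [h0])
  have hi1 : Integrable (fun x => |⟪φ x, N x⟫|) (surfaceMeasure Ω) :=
    hac.integrable_of_hasCompactSupport has
  have hi2 : Integrable (fun x => ‖φ x‖) (surfaceMeasure Ω) :=
    hφ.norm.integrable_of_hasCompactSupport hφc.norm
  set I := ∫ x, |⟪φ x, N x⟫| ∂(surfaceMeasure Ω) with hI
  set J := ∫ x, ‖φ x‖ ∂(surfaceMeasure Ω) with hJ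
  have hI0 : 0 ≤ I := integral_nonneg fun x => abs_nonneg _
  have hJ0 : 0 ≤ J := integral_nonneg fun x => norm_nonneg _
  have key : ∀ τ : ℝ, 0 < τ → |T| ≤ 3 * M * C * (CA * (I + τ * J) + τ) := by
    intro τ hτ
    set ψ : Space d → ℝ := fun x => |⟪φ x, N x⟫| + τ * ‖φ x‖ with hψ
    have hψc : Continuous ψ := by fun_prop
    have hψs : HasCompactSupport ψ := hφc.mono fun x hx h0 => hx (by simp [hψ, h0])
    have hψ0 : ∀ x, 0 ≤ ψ x := fun x => by positivity
    have hψI : ∫⁻ x, ENNReal.ofReal (ψ x) ∂(surfaceMeasure Ω) = ENNReal.ofReal (I + τ * J) := by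
      rw [← ofReal_integral_eq_lintegral_ofReal (hψc.integrable_of_hasCompactSupport hψs)
        (ae_of_all _ hψ0), hψ, integral_add hi1 (hi2.const_mul τ), integral_const_mul]
    refine le_of_tendsto hT.abs ?_
    have hsk := tendsto_one_div_add_atTop_nhds_zero_nat (𝕜 := ℝ)
    have hsk3 : Tendsto (fun k : ℕ => 3 * (1 / ((k : ℝ) + 1))) atTop (𝓝[>] 0) := by
      refine tendsto_nhdsWithin_iff.2 ⟨by simpa using hsk.const_mul 3, Eventually.of_forall
        fun k => ?_⟩
      have : 0 < 3 * (1 / ((k : ℝ) + 1)) := by positivity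
      exact this
    filter_upwards [hsk3.eventually (hCA ψ hψc hψs τ hτ),
      hsk.eventually (Iio_mem_nhds (show 0 < τ / C by positivity))] with k hk1 hk2
    have hspos : 0 < 1 / ((k : ℝ) + 1) := by positivity
    have hk := hη k
    set s := 1 / ((k : ℝ) + 1) with hs
    have hk2 : s < τ / C := hk2
    rw [lt_div_iff₀ hC] at hk2
    rw [hψI] at hk1
    have hpt : ∀ x, |w x * fderiv ℝ (η k) x (φ x)| ≤
        (A ∩ Metric.thickening (3 * s) (frontier Ω)).indicator (fun x => M * (C / s) * ψ x) x := by
      intro x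
      by_cases hxA : x ∈ A
      · have h1 := hk.abs_fderiv_add_le x (φ x)
        by_cases hxt : x ∈ Metric.thickening (3 * s) (frontier Ω)
        · rw [indicator_of_mem
            (show x ∈ A ∩ Metric.thickening (3 * s) (frontier Ω) from ⟨hxA, hxt⟩)]
          have h2 := abs_add_le (fderiv ℝ (η k) x (φ x) + c k x * ⟪N x, φ x⟫)
            (-(c k x * ⟪N x, φ x⟫))
          rw [add_neg_cancel_right, abs_neg, abs_mul (c k x), abs_of_nonneg (hk.coeff_nonneg x),
            real_inner_comm] at h2
          have h3 : |fderiv ℝ (η k) x (φ x)| ≤ c k x * ψ x := by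
            have h4 : C * s * c k x * ‖φ x‖ ≤ c k x * (τ * ‖φ x‖) := by
              have h5 : C * s * ‖φ x‖ ≤ τ * ‖φ x‖ :=
                mul_le_mul_of_nonneg_right (by linarith) (norm_nonneg _)
              nlinarith [mul_le_mul_of_nonneg_left h5 (hk.coeff_nonneg x)]
            rw [hψ]; dsimp only
            rw [real_inner_comm] at h1
            linarith [mul_add (c k x) |⟪φ x, N x⟫| (τ * ‖φ x‖)]
          rw [abs_mul, mul_assoc]
          refine mul_le_mul (hwM x) (h3.trans ?_) (abs_nonneg _) hM
          exact mul_le_mul_of_nonneg_right (hk.coeff_le x) (hψ0 x)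
        · rw [hk.coeff_eq_zero x hxt, zero_mul, add_zero, mul_zero, zero_mul] at h1
          rw [abs_mul, le_antisymm h1 (abs_nonneg _), mul_zero]
          exact indicator_nonneg (fun x _ => by have := hψ0 x; positivity) x
      · rw [hwR x hxA, zero_mul, abs_zero]
        exact indicator_nonneg (fun x _ => by have := hψ0 x; positivity) x
    have hAm : MeasurableSet (A ∩ Metric.thickening (3 * s) (frontier Ω)) :=
      Metric.isClosed_closedBall.measurableSet.inter Metric.isOpen_thickening.measurableSet
    have hfin : ENNReal.ofReal |flux Ω w (η k) φ| ≤
        ENNReal.ofReal (3 * M * C * (CA * (I + τ * J) + τ)) := by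
      calc ENNReal.ofReal |flux Ω w (η k) φ|
          = ‖∫ x in Ω, w x * fderiv ℝ (η k) x (φ x)‖ₑ := by
            rw [flux, abs_neg, Real.enorm_eq_ofReal_abs]
        _ ≤ ∫⁻ x in Ω, ‖w x * fderiv ℝ (η k) x (φ x)‖ₑ := enorm_integral_le_lintegral_enorm _
        _ ≤ ∫⁻ x, ‖w x * fderiv ℝ (η k) x (φ x)‖ₑ := setLIntegral_le_lintegral _ _
        _ ≤ ∫⁻ x, (A ∩ Metric.thickening (3 * s) (frontier Ω)).indicator
              (fun x => ENNReal.ofReal (M * (C / s)) * ENNReal.ofReal (ψ x)) x := by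
            refine lintegral_mono fun x => ?_
            rw [Real.enorm_eq_ofReal_abs]
            refine (ENNReal.ofReal_le_ofReal (hpt x)).trans ?_
            by_cases hx : x ∈ A ∩ Metric.thickening (3 * s) (frontier Ω)
            · rw [indicator_of_mem hx, indicator_of_mem hx, ENNReal.ofReal_mul (by positivity)]
            · rw [indicator_of_notMem hx, indicator_of_notMem hx, ENNReal.ofReal_zero]
        _ = ENNReal.ofReal (M * (C / s)) *
              ∫⁻ x in A ∩ Metric.thickening (3 * s) (frontier Ω), ENNReal.ofReal (ψ x) := by
            rw [lintegral_indicator hAm, lintegral_const_mul' _ _ ENNReal.ofReal_ne_top]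
        _ ≤ ENNReal.ofReal (M * (C / s)) * (ENNReal.ofReal (3 * s) *
              (CA * ENNReal.ofReal (I + τ * J) + ENNReal.ofReal τ)) := by gcongr
        _ = ENNReal.ofReal (3 * M * C * (CA * (I + τ * J) + τ)) := by
            rw [← ENNReal.ofReal_coe_nnreal, ← ENNReal.ofReal_mul CA.coe_nonneg,
              ← ENNReal.ofReal_add (by positivity) hτ.le, ← ENNReal.ofReal_mul (by positivity),
              ← ENNReal.ofReal_mul (by positivity)]
            congr 1
            field_simp
    exact (ENNReal.ofReal_le_ofReal_iff (by positivity)).1 hfin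
  have hlim : Tendsto (fun τ : ℝ => 3 * M * C * (CA * (I + τ * J) + τ)) (𝓝[>] 0)
      (𝓝 (3 * M * C * CA * I)) := by
    refine Tendsto.mono_left ?_ nhdsWithin_le_nhds
    have : Continuous fun τ : ℝ => 3 * M * C * (CA * (I + τ * J) + τ) := by fun_prop
    have h := this.tendsto 0
    simp only [zero_mul, add_zero] at h
    rwa [← mul_assoc] at h
  exact ge_of_tendsto hlim (by filter_upwards [eventually_mem_nhdsWithin] with τ hτ using key τ hτ)

/-- For a bounded function with bounded support, the limit flux has a density with respect to the
surface measure; it depends on the field only on a ball, where the surface measure is finite. -/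
lemma IsUniformlyC2Domain.exists_isTrace_of_bounded (hΩ : IsUniformlyC2Domain Ω)
    (hN : IsNormalExtension Ω L N) (hC : 0 < C)
    (hη : ∀ k : ℕ, IsBoundaryCutoff Ω N C (1 / ((k : ℝ) + 1)) (η k) (c k)) (hw : IsBV Ω w)
    {M R : ℝ} (hR : 0 < R) (hwM : ∀ x, |w x| ≤ M)
    (hwR : ∀ x ∉ Metric.closedBall (0 : Space d) R, w x = 0) : ∃ g, IsTrace Ω w g := by
  have := hΩ.isFiniteMeasureOnCompacts
  have hM : 0 ≤ M := (abs_nonneg _).trans (hwM 0)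
  obtain ⟨μ, σ, hμ⟩ := exists_isGradientMeasure hΩ.isOpen hw.1 hw.2.ne
  obtain ⟨E, hE, hbound⟩ := hΩ.exists_abs_limit_flux_le hN hC hη hM hwM hwR
  obtain ⟨_, -, hθ⟩ := exists_cutoff_ball d
  obtain ⟨θ, hθc, hθs, hθ0, hθ1, hθone, -⟩ := hθ R hR
  have hNc := hN.lipschitzWith.continuous
  have hT : ∀ φ ∈ testFields (univ : Set (Space d)), Tendsto (fun k => flux Ω w (η k) φ) atTop
      (𝓝 ((∫ x in Ω, w x * divergence φ x) + ∫ x, ⟪φ x, σ x⟫ ∂μ)) := fun φ hφ =>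
    tendsto_flux hΩ.isOpen hη hw.1 hμ hφ.1 hφ.2.1
  let T : testSubmodule (univ : Set (Space d)) →ₗ[ℝ] ℝ :=
    { toFun := fun φ => (∫ x in Ω, w x * divergence φ x) + ∫ x, ⟪(φ : Space d → Space d) x, σ x⟫ ∂μ
      map_add' := fun φ ψ => by
        refine tendsto_nhds_unique (hT _ (φ + ψ).2) (((hT _ φ.2).add (hT _ ψ.2)).congr fun k => ?_)
        exact (flux_add_right hw.1 (hη k).contDiff φ.2.1.continuous φ.2.2.1 ψ.2.1.continuous
          ψ.2.2.1).symm
      map_smul' := fun a φ => by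
        refine tendsto_nhds_unique (hT _ (a • φ).2) (((hT _ φ.2).const_mul a).congr fun k => ?_)
        exact (flux_const_smul_right a).symm }
  let J : testSubmodule (univ : Set (Space d)) →ₗ[ℝ] (Space d → ℝ) :=
    { toFun := fun φ x => ⟪(φ : Space d → Space d) x, N x⟫
      map_add' := fun φ ψ => by
        ext x
        exact inner_add_left _ _ _
      map_smul' := fun a φ => by
        ext x
        exact real_inner_smul_left _ _ _ }
  set S := tsupport θ with hS
  have hSm : MeasurableSet S := (isClosed_tsupport θ).measurableSet
  set m := (surfaceMeasure Ω).restrict S with hm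
  have hmfin : IsFiniteMeasure m := ⟨by
    rw [hm, Measure.restrict_apply_univ]
    exact IsCompact.measure_lt_top hθs⟩
  have hJm : ∀ φ, MemLp (J φ) 2 m := fun φ => by
    refine Continuous.memLp_of_hasCompactSupport (φ.2.1.continuous.inner hNc) ?_
    refine φ.2.2.1.mono fun x hx h0 => hx ?_
    change ⟪(φ : Space d → Space d) x, N x⟫ = 0
    rw [h0, inner_zero_left]
  have hTJ : ∀ φ, |T φ| ≤ E * ∫ x, ‖J φ x‖ ∂m := fun φ => by
    have hθφ : Tendsto (fun k => flux Ω w (η k) fun x => θ x • (φ : Space d → Space d) x) atTop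
        (𝓝 (T φ)) := by
      refine (hT _ φ.2).congr fun k => ?_
      unfold flux
      congr 2
      ext x
      rw [map_smul, smul_eq_mul]
      by_cases hx : x ∈ Metric.closedBall (0 : Space d) R
      · rw [hθone x hx, one_mul]
      · rw [hwR x hx, zero_mul, zero_mul]
    refine (hbound (fun x => θ x • (φ : Space d → Space d) x)
      (hθc.continuous.smul φ.2.1.continuous) hθs.smul_right _ hθφ).trans ?_
    refine mul_le_mul_of_nonneg_left ?_ hE
    rw [← setIntegral_eq_integral_of_forall_compl_eq_zero (s := S) fun x hx => by
      rw [image_eq_zero_of_notMem_tsupport hx, zero_smul, inner_zero_left, abs_zero]]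
    refine integral_mono_of_nonneg (ae_of_all _ fun x => abs_nonneg _)
      ((hJm φ).integrable one_le_two).norm (ae_of_all _ fun x => ?_)
    dsimp only
    rw [inner_smul_left, RCLike.conj_to_real, abs_mul, abs_of_nonneg (hθ0 x)]
    exact mul_le_of_le_one_left (abs_nonneg _) (hθ1 x)
  obtain ⟨κ, hκ, hTκ⟩ := exists_density_of_le T J hJm E hE hTJ
  refine ⟨S.indicator κ, (isTrace_iff hΩ.isOpen hη hw).2
    ⟨(integrable_indicator_iff hSm).2 (hκ.integrable one_le_two), fun φ hφ hφc => ?_⟩⟩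
  have hmem : φ ∈ testFields (univ : Set (Space d)) := ⟨hφ, hφc, subset_univ _⟩
  have h1 : T ⟨φ, hmem⟩ =
      ∫ x, S.indicator κ x * ⟪φ x, outerNormal Ω x⟫ ∂(surfaceMeasure Ω) := by
    rw [hTκ, hm, ← integral_indicator hSm]
    refine integral_congr_ae ?_
    filter_upwards [hN.ae_eq] with x hx
    rw [hx]
    by_cases hxS : x ∈ S
    · rw [indicator_of_mem hxS, indicator_of_mem hxS]
      rfl
    · rw [indicator_of_notMem hxS, indicator_of_notMem hxS, zero_mul]
  rw [← h1]
  exact hT φ hmem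

/-- Functions of bounded variation are approximated, in norm, by bounded functions with bounded
support. -/
lemma exists_bounded_support_approx (hΩ : IsOpen Ω) (hu : IsBV Ω u) {ε : ℝ} (hε : 0 < ε) :
    ∃ (v : Space d → ℝ) (M R : ℝ), 0 < R ∧ (∀ x, |v x| ≤ M) ∧
      (∀ x ∉ Metric.closedBall (0 : Space d) R, v x = 0) ∧ IsBV Ω v ∧
      ∫ x in Ω, |u x - v x| ≤ ε ∧ totalVariation Ω (fun x => u x - v x) ≤ ENNReal.ofReal ε := by
  obtain ⟨v, ⟨M, hM⟩, hv, hVv, hv1, hv2⟩ :=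
    exists_bounded_approx hΩ hu.1 hu.2.ne (half_pos hε)
  obtain ⟨Cθ, hCθ, hθ⟩ := exists_cutoff_ball d
  choose θ hθc hθs hθ0 hθ1 hθone hθd using fun n : ℕ => hθ ((n : ℝ) + 1) (by positivity)
  have hb : ∀ n x, |1 - θ n x| ≤ 1 := fun n x =>
    abs_le.2 ⟨by linarith [hθ1 n x], by linarith [hθ0 n x]⟩
  have hint : ∀ n, IntegrableOn (fun x => (1 - θ n x) * v x) Ω := fun n =>
    hv.bdd_mul (c := 1) (by have := (hθc n).continuous; fun_prop) (ae_of_all _ (hb n))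
  obtain ⟨K, hKΩ, hK, hKV, -⟩ :=
    exists_isCompact_totalVariation_le hΩ.measurableSet hv hVv (show 0 < ε / 4 by positivity)
  obtain ⟨R₀, hR₀⟩ := hK.isBounded.subset_closedBall (0 : Space d)
  set Iv := ∫ x in Ω, |v x| with hIv
  have hIv0 : 0 ≤ Iv := integral_nonneg fun x => abs_nonneg _
  have htail : Tendsto (fun n => ∫ x in Ω, |(1 - θ n x) * v x|) atTop (𝓝 0) := by
    have : Tendsto (fun n => ∫ x in Ω, |(1 - θ n x) * v x|) atTop
        (𝓝 (∫ _ in Ω, (0 : ℝ))) := by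
      refine tendsto_integral_of_dominated_convergence (fun x => |v x|)
        (fun n => (hint n).abs.aestronglyMeasurable) hv.abs
        (fun n => ae_of_all _ fun x => ?_) (ae_of_all _ fun x => ?_)
      · rw [Real.norm_eq_abs, abs_abs, abs_mul]
        exact mul_le_of_le_one_left (abs_nonneg _) (hb n x)
      · refine tendsto_const_nhds.congr' ?_
        filter_upwards [eventually_ge_atTop ⌈‖x‖⌉₊] with n hn
        rw [hθone n x, sub_self, zero_mul, abs_zero]
        rw [mem_closedBall_zero_iff]
        have := (Nat.le_ceil ‖x‖).trans (Nat.cast_le.2 hn)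
        linarith
    simpa using this
  have hlim : Tendsto (fun n : ℕ => Cθ / ((n : ℝ) + 1) * Iv) atTop (𝓝 0) := by
    have := (tendsto_one_div_add_atTop_nhds_zero_nat (𝕜 := ℝ)).const_mul (Cθ * Iv)
    rw [mul_zero] at this
    exact this.congr fun n => by ring
  obtain ⟨n, ⟨hn1, hn2⟩, hn3⟩ := (((htail.eventually (Iio_mem_nhds (half_pos hε))).and
    (hlim.eventually (Iio_mem_nhds (show 0 < ε / 4 by positivity)))).and
    (eventually_ge_atTop ⌈R₀⌉₊)).exists
  have hn1 : ∫ x in Ω, |(1 - θ n x) * v x| < ε / 2 := hn1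
  have hn2 : Cθ / ((n : ℝ) + 1) * Iv < ε / 4 := hn2
  have hKn : K ⊆ Metric.ball (0 : Space d) ((n : ℝ) + 1) := by
    refine hR₀.trans fun x hx => ?_
    rw [mem_closedBall_zero_iff] at hx
    rw [mem_ball_zero_iff]
    have := (Nat.le_ceil R₀).trans (Nat.cast_le.2 hn3)
    linarith
  set f : Space d → ℝ := fun x => 1 - θ n x with hf
  have hθn := hθc n
  have hfc : ContDiff ℝ 1 f := by fun_prop
  have hfd : ∀ x, ‖fderiv ℝ f x‖ ≤ Cθ / ((n : ℝ) + 1) := fun x => by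
    rw [hf, fderiv_const_sub, norm_neg]
    exact hθd n x
  have hts : tsupport f ⊆ (Metric.ball (0 : Space d) ((n : ℝ) + 1))ᶜ := by
    refine closure_minimal (fun x hx hxb => hx ?_) Metric.isOpen_ball.isClosed_compl
    rw [hf]; dsimp only
    rw [hθone n x (Metric.ball_subset_closedBall hxb), sub_self]
  have hVf : totalVariation Ω (fun x => f x * v x) ≤ ENNReal.ofReal (ε / 2) := by
    refine totalVariation_le fun φ hφ hφb => ?_
    have h1 : pairing Ω (fun x => f x * v x) φ =
        pairing Ω v (fun x => f x • φ x) - flux Ω v f φ := by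
      rw [flux_eq hv hfc (hb n) hφ.1 hφ.2.1, pairing]
      have : ∀ x, f x * v x * divergence φ x = v x * (f x * divergence φ x) := fun x => by ring
      simp only [this]
      ring
    have h2 : |flux Ω v f φ| ≤ ε / 4 := by
      refine le_trans ?_ hn2.le
      rw [flux, abs_neg, ← integral_const_mul]
      refine norm_integral_le_of_norm_le (μ := volume.restrict Ω)
        (f := fun x => v x * fderiv ℝ f x (φ x)) (hv.abs.const_mul _) (ae_of_all _ fun x => ?_)
      rw [norm_mul, mul_comm]
      refine mul_le_mul_of_nonneg_right (((fderiv ℝ f x).le_opNorm _).trans ?_) (abs_nonneg _)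
      exact (mul_le_of_le_one_right (norm_nonneg _) (hφb x)).trans (hfd x)
    have hmem := smul_mem_testFields' hfc hφ
    have hmem' : (fun x => f x • φ x) ∈ testFields (Ω \ K) :=
      ⟨hmem.1, hmem.2.1, fun x hx => ⟨hmem.2.2 hx, fun hxK =>
        hts (tsupport_smul_subset_left f φ hx) (hKn hxK)⟩⟩
    have h3 : ENNReal.ofReal (pairing Ω v fun x => f x • φ x) ≤ ENNReal.ofReal (ε / 4) := by
      rw [pairing_eq_of_subset hΩ.measurableSet sdiff_subset hmem'.2.2]
      refine (ofReal_pairing_le hmem' fun x => ?_).trans (hKV _ sdiff_subset disjoint_sdiff_left)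
      rw [norm_smul]
      exact mul_le_one₀ (hb n x) (norm_nonneg _) (hφb x)
    rw [ENNReal.ofReal_le_ofReal_iff (by positivity)] at h3
    rw [h1]
    exact ENNReal.ofReal_le_ofReal (by linarith [(abs_le.1 h2).1])
  set v' : Space d → ℝ := fun x => θ n x * v x with hv'
  have hv'i : IntegrableOn v' Ω := hv.bdd_mul (c := 1) (hθc n).continuous.aestronglyMeasurable
    (ae_of_all _ fun x => by rw [Real.norm_of_nonneg (hθ0 n x)]; exact hθ1 n x)
  have hdecomp : ∀ x, u x - v' x = (u x - v x) + f x * v x := fun x => by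
    rw [hv', hf]; ring
  have hV : totalVariation Ω (fun x => u x - v' x) ≤ ENNReal.ofReal ε := by
    simp only [hdecomp]
    refine (totalVariation_add_le (hu.1.sub hv) (hint n)).trans ((add_le_add hv2 hVf).trans_eq ?_)
    rw [← ENNReal.ofReal_add (by positivity) (by positivity), add_halves]
  obtain ⟨R₁, hR₁⟩ := (hθs n).isBounded.subset_closedBall (0 : Space d)
  refine ⟨v', M, max R₁ 1, by positivity, fun x => ?_, fun x hx => ?_, ⟨hv'i, ?_⟩, ?_, hV⟩
  · rw [hv', abs_mul, abs_of_nonneg (hθ0 n x)]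
    exact (mul_le_of_le_one_left (abs_nonneg _) (hθ1 n x)).trans (hM x)
  · have hx' : x ∉ tsupport (θ n) := fun h =>
      hx (Metric.closedBall_subset_closedBall (le_max_left _ _) (hR₁ h))
    rw [hv']; dsimp only
    rw [image_eq_zero_of_notMem_tsupport hx', zero_mul]
  · have h1 : totalVariation Ω v' ≤ totalVariation Ω u + totalVariation Ω fun x => u x - v' x := by
      have := totalVariation_sub_le hu.1 (hu.1.sub hv'i)
      simpa using! this
    exact h1.trans_lt (ENNReal.add_lt_top.2 ⟨hu.2, hV.trans_lt ENNReal.ofReal_lt_top⟩)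
  · simp only [hdecomp]
    have h1 : ∫ x in Ω, |(u x - v x) + f x * v x| ≤
        ∫ x in Ω, (|u x - v x| + |f x * v x|) :=
      integral_mono ((hu.1.sub hv).add (hint n)).abs ((hu.1.sub hv).abs.add (hint n).abs)
        fun x => abs_add_le _ _
    rw [integral_add (by exact (hu.1.sub hv).abs) (by exact (hint n).abs)] at h1
    linarith

/-- Every function of bounded variation has a trace: the traces of approximating functions converge
in `L¹` of the boundary, by the trace inequality. -/
theorem IsUniformlyC2Domain.exists_isTrace (hΩ : IsUniformlyC2Domain Ω)
    (hN : IsNormalExtension Ω L N) (hC : 0 < C)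
    (hcut : ∀ s : ℝ, 0 < s → ∃ η c, IsBoundaryCutoff Ω N C s η c) (hu : IsBV Ω u) :
    ∃ g, IsTrace Ω u g := by
  choose η c hη using fun k : ℕ => hcut (1 / ((k : ℝ) + 1)) (by positivity)
  obtain ⟨D, hD0, hD⟩ := exists_trace_bound hΩ.isOpen hN hC hcut one_pos
  set a : ℕ → ℝ := fun n => 1 / ((n : ℝ) + 1) with ha
  have ha0 : ∀ n, 0 < a n := fun n => by positivity
  have halim : Tendsto a atTop (𝓝 0) := tendsto_one_div_add_atTop_nhds_zero_nat
  choose v M R hR hvM hvR hv hv1 hv2 using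
    fun n => exists_bounded_support_approx hΩ.isOpen hu (ha0 n)
  choose g hg using fun n => hΩ.exists_isTrace_of_bounded hN hC hη (hv n) (hR n) (hvM n) (hvR n)
  have hgi : ∀ n, Integrable (g n) (surfaceMeasure Ω) := fun n => (hg n).1
  have hcauchy : ∀ n m, ∫ x, |g n x - g m x| ∂(surfaceMeasure Ω) ≤ (D + 1) * (a n + a m) := by
    intro n m
    have h1 := hD _ _ ((hv n).sub (hv m))
      ((hg n).sub hΩ.isOpen hη hN (hv n) (hv m) (hg m))
    have hin := hu.1.sub (hv n).1
    have him := hu.1.sub (hv m).1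
    have h2 : ∫ x in Ω, |v n x - v m x| ≤ a n + a m := by
      have h3 : ∫ x in Ω, |v n x - v m x| ≤ ∫ x in Ω, (|u x - v n x| + |u x - v m x|) := by
        refine integral_mono ((hv n).1.sub (hv m).1).abs (hin.abs.add him.abs) fun x => ?_
        have := abs_sub (u x - v m x) (u x - v n x)
        rw [sub_sub_sub_cancel_left] at this
        dsimp only
        linarith
      rw [integral_add (by exact hin.abs) (by exact him.abs)] at h3
      linarith [hv1 n, hv1 m]
    have h4 : totalVariation Ω (fun x => v n x - v m x) ≤ ENNReal.ofReal (a n + a m) := by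
      have e : ∀ x, v n x - v m x = (u x - v m x) - (u x - v n x) := fun x => by ring
      simp only [e]
      refine (totalVariation_sub_le him hin).trans ?_
      rw [ENNReal.ofReal_add (ha0 n).le (ha0 m).le, add_comm]
      exact add_le_add (hv2 n) (hv2 m)
    have h5 := ENNReal.toReal_mono ENNReal.ofReal_ne_top
      ((totalVariation_mono hΩ.isOpen.measurableSet (inter_subset_left (s := Ω)
        (t := Metric.thickening 1 (frontier Ω)))).trans h4)
    rw [ENNReal.toReal_ofReal (by have := ha0 n; have := ha0 m; positivity)] at h5
    linarith [mul_le_mul_of_nonneg_left h2 hD0, h1.trans (add_le_add_right h5 _)]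
  have hdist : ∀ f₁ f₂ : Space d → ℝ, ∀ (h₁ : Integrable f₁ (surfaceMeasure Ω))
      (h₂ : Integrable f₂ (surfaceMeasure Ω)),
      dist (h₁.toL1 f₁) (h₂.toL1 f₂) = ∫ x, |f₁ x - f₂ x| ∂(surfaceMeasure Ω) := by
    intro f₁ f₂ h₁ h₂
    rw [dist_eq_norm, ← Integrable.toL1_sub, L1.norm_eq_integral_norm]
    refine integral_congr_ae ?_
    filter_upwards [(h₁.sub h₂).coeFn_toL1] with x hx
    rw [hx]
    rfl
  have hcs : CauchySeq fun n => (hgi n).toL1 (g n) := by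
    refine cauchySeq_of_le_tendsto_0 (fun n => (D + 1) * (a n + a n)) (fun n m k hn hm => ?_) ?_
    · rw [hdist]
      have hmono : ∀ n, k ≤ n → a n ≤ a k := fun n hn => by
        have : (k : ℝ) ≤ n := Nat.cast_le.2 hn
        exact one_div_le_one_div_of_le (by positivity) (by linarith)
      refine (hcauchy n m).trans ?_
      gcongr
      · exact hmono n hn
      · exact hmono m hm
    · simpa using (halim.add halim).const_mul (D + 1)
  obtain ⟨ℓ, hℓ⟩ := cauchySeq_tendsto_of_complete hcs
  have hℓi : Integrable ℓ (surfaceMeasure Ω) := L1.integrable_coeFn ℓ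
  have hℓlim : Tendsto (fun n => ∫ x, |g n x - ℓ x| ∂(surfaceMeasure Ω)) atTop (𝓝 0) := by
    have h := tendsto_iff_dist_tendsto_zero.1 hℓ
    refine h.congr fun n => ?_
    rw [← hdist (g n) ℓ (hgi n) hℓi, Integrable.toL1_coeFn]
  refine ⟨ℓ, (isTrace_iff hΩ.isOpen hη hu).2 ⟨hℓi, fun φ hφ hφc => ?_⟩⟩
  obtain ⟨μ, σ, hμ⟩ := exists_isGradientMeasure hΩ.isOpen hu.1 hu.2.ne
  have hT := tendsto_flux hΩ.isOpen hη hu.1 hμ hφ hφc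
  set T := (∫ x in Ω, u x * divergence φ x) + ∫ x, ⟪φ x, σ x⟫ ∂μ with hTdef
  obtain ⟨Q, hQ0, hQ⟩ := exists_bound_divergence hφ hφc
  obtain ⟨B, hB⟩ := hφc.exists_bound_of_continuous hφ.continuous
  have hB' : ∀ x, ‖φ x‖ ≤ |B| + 1 := fun x => (hB x).trans ((le_abs_self B).trans (by linarith))
  have hBpos : 0 < |B| + 1 := by positivity
  have hle : ∀ n, |T - ∫ x, ℓ x * ⟪φ x, outerNormal Ω x⟫ ∂(surfaceMeasure Ω)| ≤
      (Q + (|B| + 1)) * a n + (|B| + 1) * ∫ x, |g n x - ℓ x| ∂(surfaceMeasure Ω) := by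
    intro n
    obtain ⟨-, hgn⟩ := (isTrace_iff hΩ.isOpen hη (hv n)).1 (hg n)
    have h1 : |T - ∫ x, g n x * ⟪φ x, outerNormal Ω x⟫ ∂(surfaceMeasure Ω)| ≤
        (Q + (|B| + 1)) * a n := by
      refine le_of_tendsto (hT.sub (hgn φ hφ hφc)).abs (Eventually.of_forall fun k => ?_)
      rw [← flux_sub_left hu.1 (hv n).1 (hη k).contDiff hφ.continuous hφc]
      have hbv := hu.sub (hv n)
      refine (abs_flux_le hbv.1 hbv.2.ne (hη k).contDiff (hη k).abs_le_one (hη k).tsupport_subset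
        hφ hφc hQ hBpos hB').trans ?_
      have h2 := ENNReal.toReal_mono ENNReal.ofReal_ne_top (hv2 n)
      rw [ENNReal.toReal_ofReal (ha0 n).le] at h2
      linarith [mul_le_mul_of_nonneg_left (hv1 n) hQ0, mul_le_mul_of_nonneg_left h2 hBpos.le]
    have h3 : |(∫ x, g n x * ⟪φ x, outerNormal Ω x⟫ ∂(surfaceMeasure Ω)) -
        ∫ x, ℓ x * ⟪φ x, outerNormal Ω x⟫ ∂(surfaceMeasure Ω)| ≤
        (|B| + 1) * ∫ x, |g n x - ℓ x| ∂(surfaceMeasure Ω) := by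
      rw [← integral_sub (hN.integrable_mul_inner (hgi n) hφ.continuous hB)
        (hN.integrable_mul_inner hℓi hφ.continuous hB), ← integral_const_mul]
      refine norm_integral_le_of_norm_le (g := fun x => (|B| + 1) * |g n x - ℓ x|)
        (f := fun x => g n x * ⟪φ x, outerNormal Ω x⟫ - ℓ x * ⟪φ x, outerNormal Ω x⟫)
        (((hgi n).sub hℓi).abs.const_mul _) (ae_of_all _ fun x => ?_)
      rw [← sub_mul, norm_mul, mul_comm]
      refine mul_le_mul_of_nonneg_right ?_ (abs_nonneg _)
      refine (abs_real_inner_le_norm _ _).trans ?_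
      exact (mul_le_of_le_one_right (norm_nonneg _) (norm_outerNormal_le Ω x)).trans (hB' x)
    exact (abs_sub_le _ _ _).trans (add_le_add h1 h3)
  have hzero : Tendsto (fun n => (Q + (|B| + 1)) * a n +
      (|B| + 1) * ∫ x, |g n x - ℓ x| ∂(surfaceMeasure Ω)) atTop (𝓝 0) := by
    simpa using (halim.const_mul (Q + (|B| + 1))).add (hℓlim.const_mul (|B| + 1))
  have heq : T = ∫ x, ℓ x * ⟪φ x, outerNormal Ω x⟫ ∂(surfaceMeasure Ω) :=
    sub_eq_zero.1 (abs_nonpos_iff.1 (ge_of_tendsto' hzero hle))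
  rw [← heq]
  exact hT

end Existence

/-! ### Lower semicontinuity -/

section Semicontinuity

variable {Ω : Set (Space d)} {β u v : Space d → ℝ}

/-- The analytic consequences of the regularity of `Ω`: existence, uniqueness and linearity of the
trace, and the trace inequality near the boundary. -/
lemma IsUniformlyC2Domain.trace_theory (hΩ : IsUniformlyC2Domain Ω) :
    (∀ u, IsBV Ω u → IsTrace Ω u (trace Ω u)) ∧
    (∀ u g g', IsBV Ω u → IsTrace Ω u g → IsTrace Ω u g' → g =ᵐ[surfaceMeasure Ω] g') ∧
    (∀ u u' g g', IsBV Ω u → IsBV Ω u' → IsTrace Ω u g → IsTrace Ω u' g' →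
      IsTrace Ω (fun x => u x - u' x) fun x => g x - g' x) ∧
    ∀ δ : ℝ, 0 < δ → ∃ D : ℝ, 0 ≤ D ∧ ∀ w g : Space d → ℝ, IsBV Ω w → IsTrace Ω w g →
      ∫ x, |g x| ∂(surfaceMeasure Ω) ≤ D * (∫ x in Ω, |w x|) +
        (totalVariation (Ω ∩ Metric.thickening δ (frontier Ω)) w).toReal := by
  obtain ⟨L, N, hN⟩ := hΩ.exists_isNormalExtension
  obtain ⟨C, hC, hcut⟩ := exists_isBoundaryCutoff hΩ.isOpen hN.isOuterNormal hN.lipschitzWith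
  choose η c hη using fun k : ℕ => hcut (1 / ((k : ℝ) + 1)) (by positivity)
  refine ⟨fun u hu => ?_, fun u g g' hu hg hg' => hg.ae_eq hΩ.isOpen hN hη hu hg',
    fun u u' g g' hu hu' hg hg' => hg.sub hΩ.isOpen hη hN hu hu' hg',
    fun δ hδ => exists_trace_bound hΩ.isOpen hN hC hcut hδ⟩
  have hex := hΩ.exists_isTrace hN hC hcut hu
  rw [trace, dif_pos hex]
  exact hex.choose_spec

lemma capillary_of_isBV (hv : IsBV Ω v) : capillary Ω β v =
    (((totalVariation Ω v).toReal + ∫ x, β x * trace Ω v x ∂(surfaceMeasure Ω) : ℝ) : EReal) :=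
  if_pos hv

lemma capillary_of_not_isBV (hv : ¬IsBV Ω v) : capillary Ω β v = ⊤ := if_neg hv

/-- Near a function of bounded variation, the functional drops by at most a multiple of the distance
in `L¹`, up to an arbitrarily small error. The variation of `u` is almost exhausted by a compactly
supported field, and near the boundary the variation of `v` pays for the boundary term. -/
lemma IsUniformlyC2Domain.exists_capillary_sub_le (hΩ : IsUniformlyC2Domain Ω)
    (hβm : AEStronglyMeasurable β (surfaceMeasure Ω))
    (hβ : ∀ᵐ x ∂(surfaceMeasure Ω), |β x| ≤ 1) (hu : IsBV Ω u) {ε : ℝ} (hε : 0 < ε) :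
    ∃ Q : ℝ, 0 ≤ Q ∧ ∀ v, IsBV Ω v →
      (totalVariation Ω u).toReal + (∫ x, β x * trace Ω u x ∂(surfaceMeasure Ω)) -
          2 * ε - Q * ∫ x in Ω, |v x - u x| ≤
        (totalVariation Ω v).toReal + ∫ x, β x * trace Ω v x ∂(surfaceMeasure Ω) := by
  obtain ⟨htr, -, hsub, hbd⟩ := hΩ.trace_theory
  have hΩm := hΩ.isOpen.measurableSet
  obtain ⟨K, hKΩ, hK, hKV, φ, hφ, hφK, hφ1, hφu⟩ :=
    exists_isCompact_totalVariation_le hΩm hu.1 hu.2.ne hε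
  obtain ⟨δ, hδ, hdisj⟩ := exists_disjoint_thickening_frontier hΩ.isOpen hK hKΩ
  obtain ⟨D, hD0, hD⟩ := hbd δ hδ
  obtain ⟨Q, hQ0, hQ⟩ := exists_bound_divergence hφ.1 hφ.2.1
  refine ⟨Q + D, by positivity, fun v hv => ?_⟩
  set U := Ω ∩ Metric.thickening δ (frontier Ω) with hU
  have hUΩ : U ⊆ Ω := inter_subset_left
  have hUu : (totalVariation U u).toReal ≤ ε := by
    refine ENNReal.toReal_le_of_le_ofReal hε.le (hKV U hUΩ ?_)
    exact hdisj.mono_left inter_subset_right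
  have hfin : ∀ w, IsBV Ω w → ∀ V ⊆ Ω, totalVariation V w ≠ ⊤ := fun w hw V hV =>
    ((totalVariation_mono hΩm hV).trans_lt hw.2).ne
  have hsum : (totalVariation U v).toReal + (totalVariation (Ω \ U) v).toReal ≤
      (totalVariation Ω v).toReal := by
    rw [← ENNReal.toReal_add (hfin v hv _ hUΩ) (hfin v hv _ sdiff_subset)]
    exact ENNReal.toReal_mono hv.2.ne
      (totalVariation_add_le_of_disjoint hΩm hv.1 hUΩ sdiff_subset disjoint_sdiff_right)
  have hφU : φ ∈ testFields (Ω \ U) := by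
    refine ⟨hφ.1, hφ.2.1, fun x hx => ⟨hφ.2.2 hx, fun hxU => ?_⟩⟩
    rw [hφK] at hx
    exact disjoint_left.1 hdisj hxU.2 hx
  have hin : pairing Ω v φ ≤ (totalVariation (Ω \ U) v).toReal := by
    rw [pairing_eq_of_subset hΩm sdiff_subset hφU.2.2]
    exact pairing_le_toReal (hfin v hv _ sdiff_subset) hφU hφ1
  have hnear := (abs_le.1 (abs_pairing_sub_le hv.1 hu.1 hφ.1 hφ.2.1 hQ)).1
  have htrace := hD _ _ (hv.sub hu) (hsub v u _ _ hv hu (htr v hv) (htr u hu))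
  have hUsub : (totalVariation U fun x => v x - u x).toReal ≤
      (totalVariation U v).toReal + (totalVariation U u).toReal := by
    rw [← ENNReal.toReal_add (hfin v hv _ hUΩ) (hfin u hu _ hUΩ)]
    exact ENNReal.toReal_mono (ENNReal.add_ne_top.2 ⟨hfin v hv _ hUΩ, hfin u hu _ hUΩ⟩)
      (totalVariation_sub_le (hv.1.mono_set hUΩ) (hu.1.mono_set hUΩ))
  have hiv := (htr v hv).1
  have hiu := (htr u hu).1
  have hboundary : (∫ x, β x * trace Ω u x ∂(surfaceMeasure Ω)) -
      ∫ x, β x * trace Ω v x ∂(surfaceMeasure Ω) ≤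
        ∫ x, |trace Ω v x - trace Ω u x| ∂(surfaceMeasure Ω) := by
    have h1 := hiv.bdd_mul hβm (c := 1) (by simpa using hβ)
    have h2 := hiu.bdd_mul hβm (c := 1) (by simpa using hβ)
    rw [← integral_sub h2 h1]
    refine integral_mono_ae (h2.sub h1) (hiv.sub hiu).abs ?_
    filter_upwards [hβ] with x hx
    rw [← mul_sub, abs_sub_comm]
    refine (le_abs_self _).trans ?_
    rw [abs_mul]
    exact mul_le_of_le_one_left (abs_nonneg _) hx
  linarith [add_mul Q D (∫ x in Ω, |v x - u x|)]

/-- If `|β| ≤ b < 1`, the functional controls the total variation. -/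
lemma IsUniformlyC2Domain.exists_mul_totalVariation_le (hΩ : IsUniformlyC2Domain Ω)
    {b : ℝ} (hb0 : 0 ≤ b) (hβ : ∀ᵐ x ∂(surfaceMeasure Ω), |β x| ≤ b) :
    ∃ Q : ℝ, 0 ≤ Q ∧ ∀ v, IsBV Ω v →
      (1 - b) * (totalVariation Ω v).toReal - Q * ∫ x in Ω, |v x| ≤
        (totalVariation Ω v).toReal + ∫ x, β x * trace Ω v x ∂(surfaceMeasure Ω) := by
  obtain ⟨htr, -, -, hbd⟩ := hΩ.trace_theory
  obtain ⟨D, hD0, hD⟩ := hbd 1 one_pos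
  refine ⟨b * D, by positivity, fun v hv => ?_⟩
  have h1 := hD v _ hv (htr v hv)
  have h2 := ENNReal.toReal_mono hv.2.ne (totalVariation_mono (u := v) hΩ.isOpen.measurableSet
    (inter_subset_left (s := Ω) (t := Metric.thickening 1 (frontier Ω))))
  have h3 : |∫ x, β x * trace Ω v x ∂(surfaceMeasure Ω)| ≤
      b * ∫ x, |trace Ω v x| ∂(surfaceMeasure Ω) := by
    rw [← integral_const_mul]
    refine norm_integral_le_of_norm_le (f := fun x => β x * trace Ω v x)
      ((htr v hv).1.abs.const_mul b) ?_
    filter_upwards [hβ] with x hx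
    rw [norm_mul]
    exact mul_le_mul_of_nonneg_right hx (abs_nonneg _)
  have h4 := mul_le_mul_of_nonneg_left (h1.trans (add_le_add_right h2 _)) hb0
  linarith [(abs_le.1 h3).1, mul_assoc b D (∫ x in Ω, |v x|)]

lemma IsUniformlyC2Domain.exists_lt_capillary (hΩ : IsUniformlyC2Domain Ω)
    (hβm : AEStronglyMeasurable β (surfaceMeasure Ω))
    (hβ : ∀ᵐ x ∂(surfaceMeasure Ω), |β x| ≤ 1) (hu : IsBV Ω u) {y : EReal}
    (hy : y < capillary Ω β u) :
    ∃ δ : ℝ, 0 < δ ∧ ∀ v, IntegrableOn v Ω → ∫ x in Ω, |v x - u x| < δ →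
      y < capillary Ω β v := by
  rw [capillary_of_isBV hu] at hy
  obtain ⟨z, hyz, hz⟩ := EReal.lt_iff_exists_real_btwn.1 hy
  rw [EReal.coe_lt_coe_iff] at hz
  set r := (totalVariation Ω u).toReal + ∫ x, β x * trace Ω u x ∂(surfaceMeasure Ω) with hr
  obtain ⟨Q, hQ0, hQ⟩ := hΩ.exists_capillary_sub_le hβm hβ hu (ε := (r - z) / 4) (by linarith)
  refine ⟨(r - z) / (4 * (Q + 1)), div_pos (by linarith) (by positivity), fun v _ hvu => ?_⟩
  by_cases hv : IsBV Ω v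
  · rw [capillary_of_isBV hv]
    refine hyz.trans (EReal.coe_lt_coe_iff.2 (lt_of_lt_of_le ?_ (hQ v hv)))
    rw [lt_div_iff₀ (by positivity)] at hvu
    have : 0 ≤ ∫ x in Ω, |v x - u x| := integral_nonneg fun x => abs_nonneg _
    linarith
  · rw [capillary_of_not_isBV hv]
    exact hyz.trans (EReal.coe_lt_top z)

/-- Outside `BV(Ω)` the functional is `+∞`, and near such a function the total variation, hence also
the functional, is large. -/
lemma IsUniformlyC2Domain.exists_lt_capillary_of_lt_one (hΩ : IsUniformlyC2Domain Ω)
    (hβm : AEStronglyMeasurable β (surfaceMeasure Ω)) {b : ℝ} (hb0 : 0 ≤ b) (hb1 : b < 1)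
    (hβ : ∀ᵐ x ∂(surfaceMeasure Ω), |β x| ≤ b) (hui : IntegrableOn u Ω) {y : EReal}
    (hy : y < capillary Ω β u) :
    ∃ δ : ℝ, 0 < δ ∧ ∀ v, IntegrableOn v Ω → ∫ x in Ω, |v x - u x| < δ →
      y < capillary Ω β v := by
  by_cases hu : IsBV Ω u
  · exact hΩ.exists_lt_capillary hβm (hβ.mono fun x hx => hx.trans hb1.le) hu hy
  rw [capillary_of_not_isBV hu] at hy
  obtain ⟨z, hyz, -⟩ := EReal.lt_iff_exists_real_btwn.1 hy
  obtain ⟨Q, hQ0, hQ⟩ := hΩ.exists_mul_totalVariation_le hb0 hβ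
  have hV : totalVariation Ω u = ⊤ := by
    by_contra h
    exact hu ⟨hui, Ne.lt_top h⟩
  set I := ∫ x in Ω, |u x| with hI
  have hI0 : 0 ≤ I := integral_nonneg fun x => abs_nonneg _
  -- the variation that makes the lower bound exceed `z` for all `v` at distance at most `1`
  set Z := (|z| + Q * (I + 1)) / (1 - b) + 1 with hZ
  have hb : 0 < 1 - b := by linarith
  obtain ⟨φ, hφ, hφ1, hφZ⟩ := exists_lt_pairing (u := u) (Ω := Ω) (a := ENNReal.ofReal Z)
    (by rw [hV]; exact ENNReal.ofReal_lt_top)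
  have hφZ : Z < pairing Ω u φ := (ENNReal.ofReal_lt_ofReal_iff' .. |>.1 hφZ).1
  obtain ⟨P, hP0, hP⟩ := exists_bound_divergence hφ.1 hφ.2.1
  refine ⟨1 / (P + 1), by positivity, fun v hv hvu => ?_⟩
  by_cases hvb : IsBV Ω v
  · rw [capillary_of_isBV hvb]
    refine hyz.trans (EReal.coe_lt_coe_iff.2 (lt_of_lt_of_le ?_ (hQ v hvb)))
    have h0 : 0 ≤ ∫ x in Ω, |v x - u x| := integral_nonneg fun x => abs_nonneg _
    rw [lt_div_iff₀ (by positivity)] at hvu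
    have h1 : ∫ x in Ω, |v x| ≤ I + 1 := by
      have : ∫ x in Ω, |v x| ≤ ∫ x in Ω, (|u x| + |v x - u x|) := by
        refine integral_mono hv.abs (hui.abs.add (hv.sub hui).abs) fun x => ?_
        have := abs_add_le (u x) (v x - u x)
        rwa [add_sub_cancel] at this
      rw [integral_add (by exact hui.abs) (by exact (hv.sub hui).abs)] at this
      nlinarith
    have h2 := (abs_le.1 (abs_pairing_sub_le hv hui hφ.1 hφ.2.1 hP)).1
    have h3 := pairing_le_toReal hvb.2.ne hφ hφ1
    have h4 : (|z| + Q * (I + 1)) / (1 - b) < (totalVariation Ω v).toReal := by nlinarith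
    rw [div_lt_iff₀ hb] at h4
    linarith [le_abs_self z, mul_le_mul_of_nonneg_left h1 hQ0]
  · rw [capillary_of_not_isBV hvb]
    exact hyz.trans (EReal.coe_lt_top z)

/-- Lower semicontinuity with respect to the `L¹` distance passes to the spaces `L^p` that embed
continuously in `L¹`. -/
lemma lowerSemicontinuousAt_Lp {F : (Space d → ℝ) → EReal} {p κ : ℝ≥0∞} [Fact (1 ≤ p)]
    (hκ : κ ≠ ⊤)
    (hp : ∀ f : Space d → ℝ, AEStronglyMeasurable f (volume.restrict Ω) →
      eLpNorm f 1 (volume.restrict Ω) ≤ eLpNorm f p (volume.restrict Ω) * κ)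
    (u : Lp ℝ p (volume.restrict Ω))
    (h : IntegrableOn u Ω → ∀ y < F u, ∃ δ : ℝ, 0 < δ ∧
      ∀ v, IntegrableOn v Ω → ∫ x in Ω, |v x - u x| < δ → y < F v) :
    LowerSemicontinuousAt (fun v : Lp ℝ p (volume.restrict Ω) => F v) u := by
  have hint : ∀ v : Lp ℝ p (volume.restrict Ω), IntegrableOn v Ω := fun v => by
    have hv := Lp.memLp v
    exact memLp_one_iff_integrable.1
      ⟨hv.1, (hp v hv.1).trans_lt (ENNReal.mul_lt_top hv.2 hκ.lt_top)⟩
  intro y hy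
  obtain ⟨δ, hδ, hF⟩ := h (hint u) y hy
  -- the constant `κ + 1` rather than `κ`, which may vanish
  have hpos : 0 < ENNReal.ofReal δ / (κ + 1) :=
    ENNReal.div_pos (ENNReal.ofReal_pos.2 hδ).ne' (ENNReal.add_ne_top.2 ⟨hκ, ENNReal.one_ne_top⟩)
  filter_upwards [Metric.eball_mem_nhds u hpos] with v hv
  refine hF v (hint v) ?_
  rw [Metric.mem_eball, Lp.edist_def,
    ENNReal.lt_div_iff_mul_lt (Or.inl (by simp))
      (Or.inl (ENNReal.add_ne_top.2 ⟨hκ, ENNReal.one_ne_top⟩))] at hv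
  have hvu := ((hint v).sub (hint u))
  have h1 : eLpNorm (fun x => v x - u x) 1 (volume.restrict Ω) < ENNReal.ofReal δ := by
    refine (hp _ hvu.aestronglyMeasurable).trans_lt (lt_of_le_of_lt ?_ hv)
    gcongr
    exact le_self_add
  have h2 : ∫ x in Ω, |v x - u x| =
      (eLpNorm (fun x => v x - u x) 1 (volume.restrict Ω)).toReal := by
    rw [eLpNorm_one_eq_lintegral_enorm]
    exact integral_norm_eq_lintegral_enorm hvu.aestronglyMeasurable
  rw [h2]
  exact (ENNReal.lt_ofReal_iff_toReal_lt h1.ne_top).1 h1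

lemma ae_abs_le_of_eLpNorm_top_le {m : Measure (Space d)} {b : ℝ} (hb : 0 ≤ b)
    (h : eLpNorm β ⊤ m ≤ ENNReal.ofReal b) : ∀ᵐ x ∂m, |β x| ≤ b := by
  rw [eLpNorm_exponent_top] at h
  filter_upwards [ae_le_eLpNormEssSup (f := β) (μ := m)] with x hx
  have := hx.trans h
  rwa [Real.enorm_eq_ofReal_abs, ENNReal.ofReal_le_ofReal_iff hb] at this

lemma IsUniformlyC2Domain.lowerSemicontinuous_Lp (hΩ : IsUniformlyC2Domain Ω)
    (hβm : AEStronglyMeasurable β (surfaceMeasure Ω)) {p κ : ℝ≥0∞} [Fact (1 ≤ p)] (hκ : κ ≠ ⊤)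
    (hp : ∀ f : Space d → ℝ, AEStronglyMeasurable f (volume.restrict Ω) →
      eLpNorm f 1 (volume.restrict Ω) ≤ eLpNorm f p (volume.restrict Ω) * κ) :
    (eLpNorm β ⊤ (surfaceMeasure Ω) ≤ 1 → ∀ u : Lp ℝ p (volume.restrict Ω), IsBV Ω u →
      LowerSemicontinuousAt (fun v : Lp ℝ p (volume.restrict Ω) => capillary Ω β v) u) ∧
    (eLpNorm β ⊤ (surfaceMeasure Ω) < 1 →
      LowerSemicontinuous (fun v : Lp ℝ p (volume.restrict Ω) => capillary Ω β v)) := by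
  refine ⟨fun hβ u hu => ?_, fun hβ u => ?_⟩
  · exact lowerSemicontinuousAt_Lp (F := capillary Ω β) hκ hp u fun _ y hy =>
      hΩ.exists_lt_capillary hβm
        (ae_abs_le_of_eLpNorm_top_le zero_le_one (by simpa using hβ)) hu hy
  · set b := (eLpNorm β ⊤ (surfaceMeasure Ω)).toReal with hb
    have hb1 : b < 1 := by
      rw [hb, ← ENNReal.toReal_one]
      exact (ENNReal.toReal_lt_toReal hβ.ne_top ENNReal.one_ne_top).2 hβ
    exact lowerSemicontinuousAt_Lp (F := capillary Ω β) hκ hp u fun hui y hy =>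
      hΩ.exists_lt_capillary_of_lt_one hβm ENNReal.toReal_nonneg hb1
        (ae_abs_le_of_eLpNorm_top_le ENNReal.toReal_nonneg
          (ENNReal.ofReal_toReal hβ.ne_top).ge) hui hy

end Semicontinuity

end Capillary

end

theorem mainTheorem3 (d : ℕ) (hd : 1 ≤ d) (Ω : Set (EuclideanSpace ℝ (Fin d)))
    (hΩ : Capillary.IsUniformlyC2Domain Ω) :
    -- the functional is well defined: the trace exists and is unique almost everywhere
    (∀ u : EuclideanSpace ℝ (Fin d) → ℝ, Capillary.IsBV Ω u →
      ∃ g, Capillary.IsTrace Ω u g ∧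
        ∀ g', Capillary.IsTrace Ω u g' → g' =ᵐ[Capillary.surfaceMeasure Ω] g) ∧
    ∀ β : EuclideanSpace ℝ (Fin d) → ℝ,
      AEStronglyMeasurable β (Capillary.surfaceMeasure Ω) →
      -- lower semicontinuity in `L¹(Ω)`
      ((eLpNorm β ⊤ (Capillary.surfaceMeasure Ω) ≤ 1 →
          ∀ u : Lp ℝ 1 (volume.restrict Ω), Capillary.IsBV Ω u →
            LowerSemicontinuousAt
              (fun v : Lp ℝ 1 (volume.restrict Ω) => Capillary.capillary Ω β v) u) ∧
        (eLpNorm β ⊤ (Capillary.surfaceMeasure Ω) < 1 →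
          LowerSemicontinuous
            (fun v : Lp ℝ 1 (volume.restrict Ω) => Capillary.capillary Ω β v))) ∧
      -- lower semicontinuity in `L^p(Ω)`, when `Ω` has finite measure
      (volume Ω < ⊤ → ∀ (p : ℝ≥0∞) [Fact (1 ≤ p)], p ≠ ⊤ →
        (eLpNorm β ⊤ (Capillary.surfaceMeasure Ω) ≤ 1 →
          ∀ u : Lp ℝ p (volume.restrict Ω), Capillary.IsBV Ω u →
            LowerSemicontinuousAt
              (fun v : Lp ℝ p (volume.restrict Ω) => Capillary.capillary Ω β v) u) ∧
        (eLpNorm β ⊤ (Capillary.surfaceMeasure Ω) < 1 →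
          LowerSemicontinuous
            (fun v : Lp ℝ p (volume.restrict Ω) => Capillary.capillary Ω β v))) := by
  obtain ⟨htr, huniq, -, -⟩ := hΩ.trace_theory
  refine ⟨fun u hu => ⟨_, htr u hu, fun g' hg' => huniq u _ _ hu hg' (htr u hu)⟩,
    fun β hβ => ⟨?_, fun hfin p _ hp => ?_⟩⟩
  · exact hΩ.lowerSemicontinuous_Lp hβ ENNReal.one_ne_top fun f _ => (mul_one _).ge
  · have h1p : 1 ≤ p := Fact.out
    refine hΩ.lowerSemicontinuous_Lp hβ ?_ fun f hf =>
      eLpNorm_le_eLpNorm_mul_rpow_measure_univ h1p hf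
    refine ENNReal.rpow_ne_top_of_nonneg ?_ (by rw [Measure.restrict_apply_univ]; exact hfin.ne)
    have h2 : 1 ≤ p.toReal := by
      rw [← ENNReal.toReal_one]
      exact ENNReal.toReal_mono hp h1p
    rw [ENNReal.toReal_one, sub_nonneg]
    exact one_div_le_one_div_of_le one_pos h2
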